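/- **Setting.** Fix a family of primitive operations, i.e. measurable functions $f:\mathbb R^{|f|}\to\mathbb R$. SPCF is the simply-typed call-by-value language with terms $$M::=x\mid \underline r\mid\lambda x.M\mid\mu^\varphi_x.M\mid MN\mid \mathsf{if}(M,N,P)\mid f(M_1,\dots,M_{|f|})\mid\mathsf{sample}\mid\mathsf{score}(M),$$ with types generated by $\mathsf R$ and $\to$. A program is a closed term $P:\mathsf R$. Run on a trace $s\in\mathbb T=\bigcup_n[0,1]^n$, starting with weight $1$: $\mathsf{sample}$ consumes the next entry of $s$; $\mathsf{if}(\underline r,N,P)$ continues with $N$ if $r\le 0$ and with $P$ if $r>0$; $\mathsf{score}(\underline r)$ multiplies the weight by $r$ and returns $\underline r$ if $r\ge0$, and is stuck if $r<0$. If $P$ reduces to some $\underline r$ using up exactly $s$, put $\mathsf{val}_P(s)=r$ and let $\mathsf{wt}_P(s)$ be the final weight; otherwise $\mathsf{val}_P(s)$ is undefined and $\mathsf{wt}_P(s)=0$. With $\mu_{\mathbb T}(A)=\sum_n\lambda_n(A\cap[0,1]^n)$, $$\llbracket P\rrbracket(U)=\int_{\mathsf{val}_P^{-1}(U)}\mathsf{wt}_P\,d\mu_{\mathbb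 T},$$ and $P$ is *almost surely terminating* if $\mu_{\mathbb T}(\mathsf{val}_P^{-1}(\mathbb R))=1$. **Intervals and types.** Intervals are the sets $[a,b]=\{x\in\mathbb R: a\le x\le b\}$ with $a,b\in\mathbb R\cup\{\pm\infty\}$, together with the empty interval; $f^{\mathbb I}(I_1,\dots,I_n)=[\inf F,\sup F]$ with $F=f(I_1\times\dots\times I_n)$ (empty if $F$ is), and $\times^{\mathbb I}$ is the lifting of multiplication. Weightless types are $\sigma::=I\mid\sigma\to(\sigma',J)$, and weighted types are pairs $(\sigma,J)$, with $I,J$ intervals; $J$ bounds the weight. Subtyping $\sqsubseteq$ is inclusion on intervals, componentwise on pairs, and contravariant in the argument of a function type. The typing rules, with $\mathbf 1=[1,1]$, are: $x:(\sigma,\mathbf 1)$ if $x:\sigma$ is in the context; subsumption; $\underline I:(I,\mathbf 1)$, where $\underline r$ is read as $\underline{[r,r]}$; $\mathsf{sample}:([0,1],\mathbf 1)$ and $\alpha_i:([0,1],\mathbf 1)$; $\lambda x.M:(\sigma\to\mathcal A,\mathbf 1)$ if $x:\sigma\vdash M:\mathcal A$; $\mu^\varphi_x.M:(\sigma\to\mathcal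 A,\mathbf 1)$ if $\varphi:\sigma\to\mathcal A,x:\sigma\vdash M:\mathcal A$; $MN:(\tau,I\times^{\mathbb I}J\times^{\mathbb I}K)$ if $M:(\sigma\to(\tau,K),I)$ and $N:(\sigma,J)$; $\mathsf{if}(M,N,P):(\sigma,I\times^{\mathbb I}J)$ if $M:(A,I)$ with $A$ an interval, and $N,P:(\sigma,J)$; $f(\vec M):(f^{\mathbb I}(\vec I),\prod^{\mathbb I}_iJ_i)$ if $M_i:(I_i,J_i)$ for all $i$; $\mathsf{score}(M):(I\cap[0,\infty],\,J\times^{\mathbb I}(I\cap[0,\infty]))$ if $M:(I,J)$. **Symbolic execution.** Symbolic interval terms are terms with interval literals $\underline I$ in place of real ones and with sample variables $\alpha_1,\alpha_2,\dots$. Symbolic values are variables, interval literals, sample variables, $\lambda$-abstractions, fixpoints, and primitive operations applied to symbolic values (postponed applications). Configurations are $(\mathcal M,n,\Delta,\Xi)$ with a term $\mathcal M$, $n\in\mathbb N$, a list $\Delta$ of constraints $\mathcal V\bowtie r$ ($\bowtie\,\in\{\le,<,\ge,>\}$) and a list $\Xi$ of scored values (with multiplicity). The relation $\rightsquigarrow$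 is closed under call-by-value evaluation contexts and has, besides the usual rules for $(\lambda x.\mathcal M)\mathcal V$ and $(\mu^\varphi_x.\mathcal M)\mathcal V$, the following rules on redexes: $\mathsf{sample}$ becomes $\alpha_{n+1}$ and $n$ becomes $n+1$; $\mathsf{if}(\mathcal V,\mathcal N,\mathcal P)$ becomes $\mathcal N$ with $\mathcal V\le0$ added to $\Delta$, or $\mathcal P$ with $\mathcal V>0$ added to $\Delta$; $\mathsf{score}(\mathcal V)$ becomes $\mathcal V$ with $\mathcal V\ge0$ added to $\Delta$ and $\mathcal V$ added to $\Xi$. A configuration $\Psi=(\mathcal V,n,\Delta,\Xi)$ with $\mathcal V$ a symbolic value is a symbolic interval path. For $s\in[0,1]^n$ let $\ulcorner\mathcal V[s]\urcorner\subseteq\mathbb R$ be the set of all values obtained by substituting $s$ for the sample variables, replacing each occurrence of an interval by some number in it, and evaluating. Put $$\llbracket\Psi\rrbracket_{lb}(U)=\int_{[0,1]^n}\big[\ulcorner\mathcal V[s]\urcorner\subseteq U\big]\prod_{\mathcal C\bowtie r\in\Delta}\big[\forall t\in\ulcorner\mathcal C[s]\urcorner.\ t\bowtie r\big]\prod_{\mathcal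 W\in\Xi}\inf\ulcorner\mathcal W[s]\urcorner\,ds,$$ $$\llbracket\Psi\rrbracket_{ub}(U)=\int_{[0,1]^n}\big[\ulcorner\mathcal V[s]\urcorner\cap U\ne\emptyset\big]\prod_{\mathcal C\bowtie r\in\Delta}\big[\exists t\in\ulcorner\mathcal C[s]\urcorner.\ t\bowtie r\big]\prod_{\mathcal W\in\Xi}\sup\ulcorner\mathcal W[s]\urcorner\,ds.$$ Here $\inf\emptyset=+\infty$, $0\cdot\infty=0$. **The algorithm.** Input: a program $P$ and a depth limit $D\in\mathbb N$. Start with $S=\{((P,0,\emptyset,\emptyset),0)\}$ and $T=\emptyset$. While $S\neq\emptyset$, remove some $(\psi,d)$ from $S$. If $\psi$ is a path, add it to $T$. Otherwise, if $\psi$ contains no fixpoint or $d\le D$, add $(\psi',d+1)$ to $S$ for all $\psi'$ with $\psi\rightsquigarrow\psi'$. Otherwise add $(\mathrm{approxFix}(\psi),d)$ to $S$. Here $\mathrm{approxFix}(\psi)$ takes some typing derivation of a type $(I,J)$ with $I$ an interval for the term of $\psi$, and replaces every outermost fixpoint, typed $\sigma\to(\tau,K)$ in it, by $\langle\sigma\to(\tau,K)\rangle$,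 where $\langle I\rangle=\underline I$ and $\langle\sigma\to(\tau,K)\rangle=\lambda\_.\big(\mathsf{score}(\underline K);\langle\tau\rangle\big)$. **Corollary (correctness of the algorithm).** Let $P$ be a program, $D\in\mathbb N$, let $T$ be the set of symbolic interval paths that the algorithm has computed when its loop ends (for any choices made during the run), and let $U\subseteq\mathbb R$ be Borel. Then $T$ is finite; $$\llbracket P\rrbracket(U)\le\sum_{\Psi\in T}\llbracket\Psi\rrbracket_{ub}(U);$$ and if $P$ is almost surely terminating, then also $$\sum_{\Psi\in T}\llbracket\Psi\rrbracket_{lb}(U)\le\llbracket P\rrbracket(U).$$ -/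

import Mathlib

open MeasureTheory Set
open scoped ENNReal

universe u

noncomputable section

namespace GuBPI

/-! ## Intervals -/

/-- Intervals: the sets of all reals between two extended reals. The empty interval (the bottom
element of the lattice of intervals) is included. -/
@[ext]
structure Itv where
  carrier : Set ℝ
  isItv : ∃ a b : EReal, carrier = {x : ℝ | a ≤ (x : EReal) ∧ (x : EReal) ≤ b}

namespace Itv

/-- The interval with end points `a` and `b`. -/
def mk2 (a b : EReal) : Itv := ⟨{x : ℝ | a ≤ (x : EReal) ∧ (x : EReal) ≤ b}, a, b, rfl⟩

/-- The degenerate interval `[r, r]`. -/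
def point (r : ℝ) : Itv := mk2 (r : EReal) (r : EReal)

/-- The weight interval `[1, 1]`. -/
def one : Itv := point 1

/-- Interval inclusion. -/
def Le (I J : Itv) : Prop := I.carrier ⊆ J.carrier

/-- The meet of two intervals. -/
def meet (I J : Itv) : Itv where
  carrier := I.carrier ∩ J.carrier
  isItv := by
    obtain ⟨a, b, h⟩ := I.isItv
    obtain ⟨c, d, k⟩ := J.isItv
    refine ⟨max a c, min b d, ?_⟩
    ext x
    simp only [h, k, mem_inter_iff, mem_ofPred_eq, max_le_iff, le_min_iff]
    tauto

/-- The interval `[inf A, sup A]` of a set `A` of reals (the empty interval if `A` is empty). -/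
def hull (A : Set ℝ) : Itv :=
  mk2 (sInf ((fun x : ℝ => (x : EReal)) '' A)) (sSup ((fun x : ℝ => (x : EReal)) '' A))

/-- The interval lifting `[inf A, sup A]` with `A = f (I₁, …, Iₙ)` of a function `f` on `ℝⁿ`. -/
def lift {n : ℕ} (f : (Fin n → ℝ) → ℝ) (I : Fin n → Itv) : Itv :=
  hull {y | ∃ x : Fin n → ℝ, (∀ i, x i ∈ (I i).carrier) ∧ y = f x}

/-- Interval multiplication: the lifting of multiplication. -/
def mul (I J : Itv) : Itv := hull {z | ∃ x ∈ I.carrier, ∃ y ∈ J.carrier, z = x * y}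

/-- The product of finitely many intervals: the lifting of the product of `n` numbers. -/
def prod {n : ℕ} (I : Fin n → Itv) : Itv := lift (fun x => ∏ i, x i) I

end Itv

/-! ## Terms -/

/-- The primitive operations of the language: measurable functions of finite arity. -/
structure Signature where
  Op : Type u
  arity : Op → ℕ
  fn : (o : Op) → (Fin (arity o) → ℝ) → ℝ
  measurable_fn : ∀ o, Measurable (fn o)

/-- Terms over literals in `L`, with de Bruijn indices. `lam M` binds one variable; `fix M` binds
two, of which index `0` is the argument and index `1` is the function itself.
`ite M N P` is "if `M ≤ 0` then `N` else `P`". -/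
inductive Tm (F : Signature.{u}) (L : Type) : Type u
  | var (i : ℕ) : Tm F L
  | lit (c : L) : Tm F L
  | lam (M : Tm F L) : Tm F L
  | fix (M : Tm F L) : Tm F L
  | app (M N : Tm F L) : Tm F L
  | ite (M N P : Tm F L) : Tm F L
  | prim (o : F.Op) (args : Fin (F.arity o) → Tm F L) : Tm F L
  | sample : Tm F L
  | score (M : Tm F L) : Tm F L

/-- Literals of symbolic interval terms: intervals and sample variables (numbered from `0`). -/
inductive SymLit : Type
  | itv (I : Itv) : SymLit
  | svar (i : ℕ) : SymLit

namespace Tm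

variable {F : Signature.{u}} {L L₁ : Type}

/-- Apply a function to all literals. -/
def map (g : L → L₁) : Tm F L → Tm F L₁
  | var i => var i
  | lit c => lit (g c)
  | lam M => lam (M.map g)
  | fix M => fix (M.map g)
  | app M N => app (M.map g) (N.map g)
  | ite M N P => ite (M.map g) (N.map g) (P.map g)
  | prim o args => prim o (fun i => (args i).map g)
  | sample => sample
  | score M => score (M.map g)

/-- Extend a renaming under one binder. -/
def upRen (ρ : ℕ → ℕ) : ℕ → ℕ
  | 0 => 0
  | n + 1 => ρ n + 1

def rename (ρ : ℕ → ℕ) : Tm F L → Tm F L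
  | var i => var (ρ i)
  | lit c => lit c
  | lam M => lam (M.rename (upRen ρ))
  | fix M => fix (M.rename (upRen (upRen ρ)))
  | app M N => app (M.rename ρ) (N.rename ρ)
  | ite M N P => ite (M.rename ρ) (N.rename ρ) (P.rename ρ)
  | prim o args => prim o (fun i => (args i).rename ρ)
  | sample => sample
  | score M => score (M.rename ρ)

/-- Extend a substitution under one binder. -/
def upSubst (θ : ℕ → Tm F L) : ℕ → Tm F L
  | 0 => var 0
  | n + 1 => (θ n).rename Nat.succ

/-- Simultaneous capture-avoiding substitution. -/
def subst (θ : ℕ → Tm F L) : Tm F L → Tm F L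
  | var i => θ i
  | lit c => lit c
  | lam M => lam (M.subst (upSubst θ))
  | fix M => fix (M.subst (upSubst (upSubst θ)))
  | app M N => app (M.subst θ) (N.subst θ)
  | ite M N P => ite (M.subst θ) (N.subst θ) (P.subst θ)
  | prim o args => prim o (fun i => (args i).subst θ)
  | sample => sample
  | score M => score (M.subst θ)

/-- `M[V/x]` for the body `M` of an abstraction. -/
def inst1 (M V : Tm F L) : Tm F L :=
  M.subst fun
    | 0 => V
    | n + 1 => var n

/-- `M[V/x, W/φ]` for the body `M` of a fixpoint. -/
def inst2 (M V W : Tm F L) : Tm F L :=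
  M.subst fun
    | 0 => V
    | 1 => W
    | n + 2 => var n

/-- The term contains a fixpoint. -/
def HasFix : Tm F L → Prop
  | var _ => False
  | lit _ => False
  | lam M => M.HasFix
  | fix _ => True
  | app M N => M.HasFix ∨ N.HasFix
  | ite M N P => M.HasFix ∨ N.HasFix ∨ P.HasFix
  | prim _ args => ∃ i, (args i).HasFix
  | sample => False
  | score M => M.HasFix

/-- Values of SPCF. -/
inductive IsVal : Tm F L → Prop
  | var (i : ℕ) : IsVal (var i)
  | lit (c : L) : IsVal (lit c)
  | lam (M : Tm F L) : IsVal (lam M)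
  | fix (M : Tm F L) : IsVal (fix M)

/-- Symbolic values: a primitive operation applied to symbolic values is also a value. -/
inductive IsSymVal : Tm F L → Prop
  | var (i : ℕ) : IsSymVal (var i)
  | lit (c : L) : IsSymVal (lit c)
  | lam (M : Tm F L) : IsSymVal (lam M)
  | fix (M : Tm F L) : IsSymVal (fix M)
  | prim (o : F.Op) (args : Fin (F.arity o) → Tm F L) (h : ∀ i, IsSymVal (args i)) :
      IsSymVal (prim o args)

/-- The closure of a relation under call-by-value evaluation contexts
`E ::= [] | E N | V E | if E N P | f(V, …, V, E, N, …, N) | score(E)`, for a given notion `Val`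
of value. -/
inductive InCtx (Val : Tm F L → Prop) (R : Tm F L → Tm F L → Prop) : Tm F L → Tm F L → Prop
  | here {M M₁ : Tm F L} (h : R M M₁) : InCtx Val R M M₁
  | appL {M M₁ : Tm F L} (N : Tm F L) (h : InCtx Val R M M₁) :
      InCtx Val R (app M N) (app M₁ N)
  | appR {V N N₁ : Tm F L} (hV : Val V) (h : InCtx Val R N N₁) :
      InCtx Val R (app V N) (app V N₁)
  | ite {M M₁ : Tm F L} (N P : Tm F L) (h : InCtx Val R M M₁) :
      InCtx Val R (ite M N P) (ite M₁ N P)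
  | prim (o : F.Op) (args : Fin (F.arity o) → Tm F L) (i : Fin (F.arity o)) {N : Tm F L}
      (hV : ∀ j < i, Val (args j)) (h : InCtx Val R (args i) N) :
      InCtx Val R (prim o args) (prim o (Function.update args i N))
  | score {M M₁ : Tm F L} (h : InCtx Val R M M₁) : InCtx Val R (score M) (score M₁)

end Tm

variable {F : Signature.{u}}

/-! ## SPCF: simple types and trace semantics -/

/-- Simple types. -/
inductive Ty : Type
  | real : Ty
  | arr (a b : Ty) : Ty

/-- Simple typing of SPCF terms; entry `i` of the context is the type of variable `i`. -/
inductive HasType : List Ty → Tm F ℝ → Ty → Prop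
  | var {Γ : List Ty} {i : ℕ} {a : Ty} (h : Γ[i]? = some a) : HasType Γ (.var i) a
  | lit {Γ : List Ty} (r : ℝ) : HasType Γ (.lit r) .real
  | lam {Γ : List Ty} {a b : Ty} {M : Tm F ℝ} (h : HasType (a :: Γ) M b) :
      HasType Γ (.lam M) (.arr a b)
  | fix {Γ : List Ty} {a b : Ty} {M : Tm F ℝ} (h : HasType (a :: .arr a b :: Γ) M b) :
      HasType Γ (.fix M) (.arr a b)
  | app {Γ : List Ty} {a b : Ty} {M N : Tm F ℝ} (hM : HasType Γ M (.arr a b))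
      (hN : HasType Γ N a) : HasType Γ (.app M N) b
  | ite {Γ : List Ty} {a : Ty} {M N P : Tm F ℝ} (hM : HasType Γ M .real)
      (hN : HasType Γ N a) (hP : HasType Γ P a) : HasType Γ (.ite M N P) a
  | prim {Γ : List Ty} (o : F.Op) (args : Fin (F.arity o) → Tm F ℝ)
      (h : ∀ i, HasType Γ (args i) .real) : HasType Γ (.prim o args) .real
  | sample {Γ : List Ty} : HasType Γ .sample .real
  | score {Γ : List Ty} {M : Tm F ℝ} (h : HasType Γ M .real) : HasType Γ (.score M) .real

/-- Reduction of redexes: `Redex M s w M₁ s₁ w₁` is `(M, s, w) → (M₁, s₁, w₁)`. -/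
inductive Redex :
    Tm F ℝ → List unitInterval → ℝ → Tm F ℝ → List unitInterval → ℝ → Prop
  | beta (M V : Tm F ℝ) (s : List unitInterval) (w : ℝ) (hV : V.IsVal) :
      Redex (.app (.lam M) V) s w (M.inst1 V) s w
  | fix (M V : Tm F ℝ) (s : List unitInterval) (w : ℝ) (hV : V.IsVal) :
      Redex (.app (.fix M) V) s w (M.inst2 V (.fix M)) s w
  | sample (r : unitInterval) (s : List unitInterval) (w : ℝ) :
      Redex .sample (r :: s) w (.lit (r : ℝ)) s w
  | prim (o : F.Op) (r : Fin (F.arity o) → ℝ) (s : List unitInterval) (w : ℝ) :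
      Redex (.prim o fun i => .lit (r i)) s w (.lit (F.fn o r)) s w
  | iteLe (r : ℝ) (N P : Tm F ℝ) (s : List unitInterval) (w : ℝ) (h : r ≤ 0) :
      Redex (.ite (.lit r) N P) s w N s w
  | iteGt (r : ℝ) (N P : Tm F ℝ) (s : List unitInterval) (w : ℝ) (h : 0 < r) :
      Redex (.ite (.lit r) N P) s w P s w
  | score (r : ℝ) (s : List unitInterval) (w : ℝ) (h : 0 ≤ r) :
      Redex (.score (.lit r)) s w (.lit r) s (w * r)

/-- Configurations of a term, a trace and a weight. -/
structure Conf (F : Signature.{u}) where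
  tm : Tm F ℝ
  trace : List unitInterval
  weight : ℝ

/-- One step of the standard reduction. -/
def Step (c d : Conf F) : Prop :=
  Tm.InCtx Tm.IsVal (fun M M₁ => Redex M c.trace c.weight M₁ d.trace d.weight) c.tm d.tm

/-- Concrete traces: finite sequences with entries in `[0, 1]`. -/
abbrev Trace : Type := Σ n : ℕ, (Fin n → unitInterval)

/-- The measure on traces: the sum over `n` of the Lebesgue measures on `[0, 1]ⁿ`. -/
def traceMeasure : Measure Trace :=
  Measure.sum fun n : ℕ => (volume : Measure (Fin n → unitInterval)).map (Sigma.mk n)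

/-- On trace `s`, program `P` terminates with value `r` and weight `w`, using up the trace. -/
def Evaluates (P : Tm F ℝ) (s : Trace) (r w : ℝ) : Prop :=
  Relation.ReflTransGen Step (⟨P, List.ofFn s.2, 1⟩ : Conf F) ⟨.lit r, [], w⟩

open Classical in
/-- The weight function of a program; it is `0` on nonterminating traces. -/
def weight (P : Tm F ℝ) (s : Trace) : ℝ :=
  if h : ∃ w r : ℝ, Evaluates P s r w then h.choose else 0

/-- The traces on which the program evaluates to a value in `U`. -/
def valuePreimage (P : Tm F ℝ) (U : Set ℝ) : Set Trace :=
  {s | ∃ r ∈ U, ∃ w : ℝ, Evaluates P s r w}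

/-- The (unnormalised) denotation of a program. -/
def denotation (P : Tm F ℝ) (U : Set ℝ) : ℝ≥0∞ :=
  ∫⁻ s in valuePreimage P U, ENNReal.ofReal (weight P s) ∂traceMeasure

/-- Almost sure termination. -/
def AlmostSurelyTerminating (P : Tm F ℝ) : Prop :=
  traceMeasure (valuePreimage P Set.univ) = 1

/-! ## Symbolic interval execution -/

/-- Symbolic interval terms. -/
abbrev SymTm (F : Signature.{u}) : Type u := Tm F SymLit

/-- A program read as a symbolic term, where `r` stands for `[r, r]`. -/
def toSym (P : Tm F ℝ) : SymTm F := P.map fun r => .itv (Itv.point r)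

/-- The comparisons allowed in constraints. -/
inductive Cmp : Type
  | le : Cmp
  | lt : Cmp
  | ge : Cmp
  | gt : Cmp

def Cmp.Holds : Cmp → ℝ → ℝ → Prop
  | .le, x, y => x ≤ y
  | .lt, x, y => x < y
  | .ge, x, y => x ≥ y
  | .gt, x, y => x > y

/-- A symbolic constraint `lhs ⋈ rhs`. -/
structure Constraint (F : Signature.{u}) where
  lhs : SymTm F
  cmp : Cmp
  rhs : ℝ

/-- Symbolic interval configurations: a term, the number of sample variables used so far, the
constraints of the current path, and the values scored on it, listed with multiplicity. -/
structure SymConf (F : Signature.{u}) where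
  tm : SymTm F
  n : ℕ
  constraints : List (Constraint F)
  scores : List (SymTm F)

/-- Symbolic reduction of redexes (the components are those of a `SymConf`). -/
inductive SymRedex :
    SymTm F → ℕ → List (Constraint F) → List (SymTm F) →
    SymTm F → ℕ → List (Constraint F) → List (SymTm F) → Prop
  | beta (M V : SymTm F) (n : ℕ) (Δ : List (Constraint F)) (Ξ : List (SymTm F))
      (hV : V.IsSymVal) : SymRedex (.app (.lam M) V) n Δ Ξ (M.inst1 V) n Δ Ξ
  | fix (M V : SymTm F) (n : ℕ) (Δ : List (Constraint F)) (Ξ : List (SymTm F))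
      (hV : V.IsSymVal) : SymRedex (.app (.fix M) V) n Δ Ξ (M.inst2 V (.fix M)) n Δ Ξ
  | sample (n : ℕ) (Δ : List (Constraint F)) (Ξ : List (SymTm F)) :
      SymRedex .sample n Δ Ξ (.lit (.svar n)) (n + 1) Δ Ξ
  | iteLe (V N P : SymTm F) (n : ℕ) (Δ : List (Constraint F)) (Ξ : List (SymTm F))
      (hV : V.IsSymVal) : SymRedex (.ite V N P) n Δ Ξ N n (⟨V, .le, 0⟩ :: Δ) Ξ
  | iteGt (V N P : SymTm F) (n : ℕ) (Δ : List (Constraint F)) (Ξ : List (SymTm F))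
      (hV : V.IsSymVal) : SymRedex (.ite V N P) n Δ Ξ P n (⟨V, .gt, 0⟩ :: Δ) Ξ
  | score (V : SymTm F) (n : ℕ) (Δ : List (Constraint F)) (Ξ : List (SymTm F))
      (hV : V.IsSymVal) : SymRedex (.score V) n Δ Ξ V n (⟨V, .ge, 0⟩ :: Δ) (V :: Ξ)

/-- One step of the symbolic reduction. -/
def SymStep (φ ψ : SymConf F) : Prop :=
  Tm.InCtx Tm.IsSymVal
    (fun M M₁ => SymRedex M φ.n φ.constraints φ.scores M₁ ψ.n ψ.constraints ψ.scores)
    φ.tm ψ.tm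

/-- The set of values of a symbolic interval value of real type when the sample variables take
the values `s`: every occurrence of an interval is replaced by some number in it, and postponed
primitive operations are evaluated. -/
def vals (s : ℕ → ℝ) : SymTm F → Set ℝ
  | .lit (.itv I) => I.carrier
  | .lit (.svar i) => {s i}
  | .prim o args => {y | ∃ x : Fin (F.arity o) → ℝ, (∀ i, x i ∈ vals s (args i)) ∧ y = F.fn o x}
  | _ => ∅

/-- The values `s` for the first `n` sample variables (the others do not occur). -/
def sampleEnv {n : ℕ} (s : Fin n → unitInterval) (i : ℕ) : ℝ :=
  if h : i < n then (s ⟨i, h⟩ : ℝ) else 0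

open Classical in
/-- The lower-bound denotation of a symbolic interval path. -/
def lb (ψ : SymConf F) (U : Set ℝ) : ℝ≥0∞ :=
  ∫⁻ s : Fin ψ.n → unitInterval,
    if vals (sampleEnv s) ψ.tm ⊆ U ∧
        ∀ C ∈ ψ.constraints, ∀ t ∈ vals (sampleEnv s) C.lhs, C.cmp.Holds t C.rhs
    then (ψ.scores.map fun W => ⨅ t ∈ vals (sampleEnv s) W, ENNReal.ofReal t).prod
    else 0

open Classical in
/-- The upper-bound denotation of a symbolic interval path. -/
def ub (ψ : SymConf F) (U : Set ℝ) : ℝ≥0∞ :=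
  ∫⁻ s : Fin ψ.n → unitInterval,
    if (vals (sampleEnv s) ψ.tm ∩ U).Nonempty ∧
        ∀ C ∈ ψ.constraints, ∃ t ∈ vals (sampleEnv s) C.lhs, C.cmp.Holds t C.rhs
    then (ψ.scores.map fun W => ⨆ t ∈ vals (sampleEnv s) W, ENNReal.ofReal t).prod
    else 0

/-! ## The weight-aware interval type system -/

/-- Weightless interval types: `base I`, and `arr σ τ J` for the function type from `σ` to the
weighted type with value type `τ` and weight bound `J`. -/
inductive ITy : Type
  | base (I : Itv) : ITy
  | arr (σ τ : ITy) (J : Itv) : ITy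

/-- Subtyping of weightless types. -/
inductive SubTy : ITy → ITy → Prop
  | base {I J : Itv} (h : I.Le J) : SubTy (.base I) (.base J)
  | arr {σ₁ σ₂ τ₁ τ₂ : ITy} {J₁ J₂ : Itv} (hσ : SubTy σ₂ σ₁) (hτ : SubTy τ₁ τ₂)
      (hJ : J₁.Le J₂) : SubTy (.arr σ₁ τ₁ J₁) (.arr σ₂ τ₂ J₂)

/-- Interval typing: `HasITy Γ M σ J` says that `M` has the weighted type with value type `σ` and
weight bound `J`. -/
inductive HasITy : List ITy → SymTm F → ITy → Itv → Prop
  | var {Γ : List ITy} {i : ℕ} {σ : ITy} (h : Γ[i]? = some σ) : HasITy Γ (.var i) σ .one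
  | sub {Γ : List ITy} {M : SymTm F} {σ τ : ITy} {I J : Itv} (h : HasITy Γ M σ I)
      (hσ : SubTy σ τ) (hI : I.Le J) : HasITy Γ M τ J
  | itv {Γ : List ITy} (I : Itv) : HasITy Γ (.lit (.itv I)) (.base I) .one
  | svar {Γ : List ITy} (i : ℕ) : HasITy Γ (.lit (.svar i)) (.base (.mk2 0 1)) .one
  | lam {Γ : List ITy} {M : SymTm F} {σ τ : ITy} {J : Itv} (h : HasITy (σ :: Γ) M τ J) :
      HasITy Γ (.lam M) (.arr σ τ J) .one
  | fix {Γ : List ITy} {M : SymTm F} {σ τ : ITy} {J : Itv}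
      (h : HasITy (σ :: .arr σ τ J :: Γ) M τ J) : HasITy Γ (.fix M) (.arr σ τ J) .one
  | app {Γ : List ITy} {M N : SymTm F} {σ τ : ITy} {I J K : Itv}
      (hM : HasITy Γ M (.arr σ τ K) I) (hN : HasITy Γ N σ J) :
      HasITy Γ (.app M N) τ ((I.mul J).mul K)
  | ite {Γ : List ITy} {M N P : SymTm F} {A I J : Itv} {σ : ITy}
      (hM : HasITy Γ M (.base A) I) (hN : HasITy Γ N σ J) (hP : HasITy Γ P σ J) :
      HasITy Γ (.ite M N P) σ (I.mul J)
  | prim {Γ : List ITy} (o : F.Op) (args : Fin (F.arity o) → SymTm F)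
      (I J : Fin (F.arity o) → Itv) (h : ∀ i, HasITy Γ (args i) (.base (I i)) (J i)) :
      HasITy Γ (.prim o args) (.base (Itv.lift (F.fn o) I)) (Itv.prod J)
  | sample {Γ : List ITy} : HasITy Γ .sample (.base (.mk2 0 1)) .one
  | score {Γ : List ITy} {M : SymTm F} {I J : Itv} (h : HasITy Γ M (.base I) J) :
      HasITy Γ (.score M) (.base (I.meet (.mk2 0 ⊤))) (J.mul (I.meet (.mk2 0 ⊤)))

/-- The fixpoint-free closed value that stands for an unknown value of a given type: an interval
at base type, and `λ _. (score(J); V)` at a function type with weight bound `J`, where `V` stands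
for the result. Here `M; N` is `(λ _. N) M`. -/
def approxVal : ITy → SymTm F
  | .base I => .lit (.itv I)
  | .arr _ τ J => .lam (.app (.lam (approxVal τ)) (.score (.lit (.itv J))))

/-- Replacement of fixpoints along a typing derivation: `ApproxTm Γ M σ J N` says that there is a
derivation of the typing `HasITy Γ M σ J` such that `N` arises from `M` by replacing every
outermost fixpoint by the approximating value of the type that the derivation gives it. -/
inductive ApproxTm : List ITy → SymTm F → ITy → Itv → SymTm F → Prop
  | var {Γ : List ITy} {i : ℕ} {σ : ITy} (h : Γ[i]? = some σ) :
      ApproxTm Γ (.var i) σ .one (.var i)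
  | sub {Γ : List ITy} {M M₁ : SymTm F} {σ τ : ITy} {I J : Itv} (h : ApproxTm Γ M σ I M₁)
      (hσ : SubTy σ τ) (hI : I.Le J) : ApproxTm Γ M τ J M₁
  | itv {Γ : List ITy} (I : Itv) :
      ApproxTm Γ (.lit (.itv I)) (.base I) .one (.lit (.itv I))
  | svar {Γ : List ITy} (i : ℕ) :
      ApproxTm Γ (.lit (.svar i)) (.base (.mk2 0 1)) .one (.lit (.svar i))
  | lam {Γ : List ITy} {M M₁ : SymTm F} {σ τ : ITy} {J : Itv}
      (h : ApproxTm (σ :: Γ) M τ J M₁) : ApproxTm Γ (.lam M) (.arr σ τ J) .one (.lam M₁)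
  | fix {Γ : List ITy} {M : SymTm F} {σ τ : ITy} {J : Itv}
      (h : HasITy Γ (.fix M) (.arr σ τ J) .one) :
      ApproxTm Γ (.fix M) (.arr σ τ J) .one (approxVal (.arr σ τ J))
  | app {Γ : List ITy} {M M₁ N N₁ : SymTm F} {σ τ : ITy} {I J K : Itv}
      (hM : ApproxTm Γ M (.arr σ τ K) I M₁) (hN : ApproxTm Γ N σ J N₁) :
      ApproxTm Γ (.app M N) τ ((I.mul J).mul K) (.app M₁ N₁)
  | ite {Γ : List ITy} {M M₁ N N₁ P P₁ : SymTm F} {A I J : Itv} {σ : ITy}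
      (hM : ApproxTm Γ M (.base A) I M₁) (hN : ApproxTm Γ N σ J N₁)
      (hP : ApproxTm Γ P σ J P₁) : ApproxTm Γ (.ite M N P) σ (I.mul J) (.ite M₁ N₁ P₁)
  | prim {Γ : List ITy} (o : F.Op) (args args₁ : Fin (F.arity o) → SymTm F)
      (I J : Fin (F.arity o) → Itv)
      (h : ∀ i, ApproxTm Γ (args i) (.base (I i)) (J i) (args₁ i)) :
      ApproxTm Γ (.prim o args) (.base (Itv.lift (F.fn o) I)) (Itv.prod J) (.prim o args₁)
  | sample {Γ : List ITy} : ApproxTm Γ .sample (.base (.mk2 0 1)) .one .sample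
  | score {Γ : List ITy} {M M₁ : SymTm F} {I J : Itv} (h : ApproxTm Γ M (.base I) J M₁) :
      ApproxTm Γ (.score M) (.base (I.meet (.mk2 0 ⊤))) (J.mul (I.meet (.mk2 0 ⊤)))
        (.score M₁)

/-- `ψ` is a possible result of `approxFix` on `φ`. It depends on the typing derivation that the
type inference finds for the term of `φ`, which is left open. -/
def ApproxFix (φ ψ : SymConf F) : Prop :=
  ∃ (I J : Itv) (N : SymTm F), ApproxTm [] φ.tm (.base I) J N ∧ ψ = { φ with tm := N }

/-! ## The algorithm -/

/-- The state of the algorithm: the set `S` of pairs of a configuration and its depth that are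
still to be processed, and the set `T` of the symbolic interval paths found so far. -/
structure AlgState (F : Signature.{u}) where
  S : Set (SymConf F × ℕ)
  T : Set (SymConf F)

/-- One iteration of the loop, with depth limit `D`. -/
inductive AlgStep (D : ℕ) : AlgState F → AlgState F → Prop
  | terminated (S : Set (SymConf F × ℕ)) (T : Set (SymConf F)) (ψ : SymConf F) (d : ℕ)
      (hS : (ψ, d) ∈ S) (hV : ψ.tm.IsSymVal) :
      AlgStep D ⟨S, T⟩ ⟨S \ {(ψ, d)}, T ∪ {ψ}⟩
  | step (S : Set (SymConf F × ℕ)) (T : Set (SymConf F)) (ψ : SymConf F) (d : ℕ)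
      (hS : (ψ, d) ∈ S) (hV : ¬ ψ.tm.IsSymVal) (hD : ¬ ψ.tm.HasFix ∨ d ≤ D) :
      AlgStep D ⟨S, T⟩ ⟨S \ {(ψ, d)} ∪ {p | SymStep ψ p.1 ∧ p.2 = d + 1}, T⟩
  | approx (S : Set (SymConf F × ℕ)) (T : Set (SymConf F)) (ψ ψ₁ : SymConf F) (d : ℕ)
      (hS : (ψ, d) ∈ S) (hV : ¬ ψ.tm.IsSymVal) (hD : ¬ (¬ ψ.tm.HasFix ∨ d ≤ D))
      (hA : ApproxFix ψ ψ₁) :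
      AlgStep D ⟨S, T⟩ ⟨S \ {(ψ, d)} ∪ {(ψ₁, d)}, T⟩

/-- `T` is the set of symbolic interval paths computed by some run of the algorithm on the program
`P` with depth limit `D`, at the end of the loop. -/
def AlgComputes (P : Tm F ℝ) (D : ℕ) (T : Set (SymConf F)) : Prop :=
  Relation.ReflTransGen (AlgStep D) ⟨{(⟨toSym P, 0, [], []⟩, 0)}, ∅⟩ ⟨∅, T⟩

end GuBPI

end

/-! The denotation `den` of a closed term, an integral over all traces that it may still consume,
obeys a recursion along reduction. A deterministic step multiplies it by the factor scored, and at
`sample` it is the integral over the number drawn (`den_dStep`, `den_sample`). With every weight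
replaced by 1 the same construction yields the probability of termination, `term`.

Symbolic terms are compared with their concrete instances by the relation `Rel`, which also carries
an interval typing of the instance. Once the fixpoints have been replaced, `approxVal σ` is related
to every value of type `σ`, and `(λ _. approxVal τ) (score J)` to every term `X` of weighted type
`(τ, J)`. Every instance of a symbolic non-value matches its next symbolic step (`Rel.step`). The
two sides are roughly in lockstep except at a call of an approximated function: while the symbolic
term performs `score J`, the concrete term runs `X` to a value and consumes samples that the
symbolic trace does not contain. Therefore integrals are compared, and not single traces. Subject
reduction with weights (`CTy.step`) puts the weight of each terminating run of `X` into `J`. So in a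
context `E` the denotation of `E[X]` is at most `sup J` times any common bound for the denotations
of the `E[V]`, with `V` a value of type `τ` (`den_plug_le`). The dual estimate with `inf J`
(`le_den_plug`) fails if probability is lost to divergence; this is where almost sure termination
matters.

A configuration contributes two numbers. `Gub` is the upper integral, over the samples drawn so far,
of the upper path weight times the supremum of the denotations of the instances. `Glb` is built in
the same way from the lower path weight and an infimum over almost surely terminating instances.
Replacing a configuration by its symbolic successors, or by its `approxFix`, does not decrease the
total of `Gub` and does not increase that of `Glb` (`SymSucc.Gub_le`, `SymSucc.le_Glb`,
`Gub_le_of_approxFix`, `Glb_le_of_approxFix`). Initially these numbers bound the denotation of the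
program, and at a path they compare with `ub` and `lb`. Hence the estimates summed over the worklist
and the finished paths form a loop invariant, `AlgInv`, which gives the claim when the worklist is
empty.

Two technical points remain. Suprema and infima over all instances need not be measurable, so the
upper bounds use upper integrals, and the lower bounds use `lintegral`, which is a lower integral.
Only the last comparison with `ub` needs measurability; it holds almost everywhere because the
conditions on values define analytic sets. Moreover, paths are collected in a set, so different
branches must give different paths; their constraint lists tell them apart (`Div`). -/

noncomputable section

namespace GuBPI

section

variable {F : Signature.{u}} {L L₁ : Type}
/-! ## Evaluation contexts -/

/-- Call-by-value evaluation contexts, as data. -/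
inductive ECtx (F : Signature.{u}) (L : Type) : Type u
  | hole : ECtx F L
  | appL (E : ECtx F L) (N : Tm F L) : ECtx F L
  | appR (V : Tm F L) (E : ECtx F L) : ECtx F L
  | ite (E : ECtx F L) (N P : Tm F L) : ECtx F L
  | prim (o : F.Op) (args : Fin (F.arity o) → Tm F L) (i : Fin (F.arity o)) (E : ECtx F L) :
      ECtx F L
  | score (E : ECtx F L) : ECtx F L

namespace ECtx

/-- Fill the hole. -/
def plug : ECtx F L → Tm F L → Tm F L
  | hole, X => X
  | appL E N, X => .app (E.plug X) N
  | appR V E, X => .app V (E.plug X)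
  | ite E N P, X => .ite (E.plug X) N P
  | prim o args i E, X => .prim o (Function.update args i (E.plug X))
  | score E, X => .score (E.plug X)

/-- The terms that the hole has to wait for are values. -/
def Ok (Val : Tm F L → Prop) : ECtx F L → Prop
  | hole => True
  | appL E _ => E.Ok Val
  | appR V E => Val V ∧ E.Ok Val
  | ite E _ _ => E.Ok Val
  | prim _ args i E => (∀ j < i, Val (args j)) ∧ E.Ok Val
  | score E => E.Ok Val

/-- Composition of contexts. -/
def comp : ECtx F L → ECtx F L → ECtx F L
  | hole, E' => E'
  | appL E N, E' => appL (E.comp E') N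
  | appR V E, E' => appR V (E.comp E')
  | ite E N P, E' => ite (E.comp E') N P
  | prim o args i E, E' => prim o args i (E.comp E')
  | score E, E' => score (E.comp E')

theorem plug_comp (E E' : ECtx F L) (X : Tm F L) : (E.comp E').plug X = E.plug (E'.plug X) := by
  induction E <;> simp_all [comp, plug]

theorem Ok.comp {Val : Tm F L → Prop} {E E' : ECtx F L} (h : E.Ok Val) (h' : E'.Ok Val) :
    (E.comp E').Ok Val := by
  induction E <;> simp_all [ECtx.comp, Ok]

/-- Apply a function to all literals. -/
def map (g : L → L₁) : ECtx F L → ECtx F L₁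
  | hole => hole
  | appL E N => appL (E.map g) (N.map g)
  | appR V E => appR (V.map g) (E.map g)
  | ite E N P => ite (E.map g) (N.map g) (P.map g)
  | prim o args i E => prim o (fun j => (args j).map g) i (E.map g)
  | score E => score (E.map g)

theorem map_plug (g : L → L₁) (E : ECtx F L) (X : Tm F L) :
    (E.plug X).map g = (E.map g).plug (X.map g) := by
  induction E with
  | prim o args i E ih =>
    simp only [plug, map, Tm.map, Tm.prim.injEq, heq_eq_eq, true_and]
    funext j
    by_cases h : j = i
    · subst h; simp [ih]
    · simp [h]
  | _ => simp_all [plug, map, Tm.map]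

end ECtx

/-- The properties of a notion of value that make evaluation contexts unique. -/
structure ValLike (Val : Tm F L → Prop) : Prop where
  app : ∀ M N, ¬ Val (.app M N)
  ite : ∀ M N P, ¬ Val (.ite M N P)
  score : ∀ M, ¬ Val (.score M)
  sample : ¬ Val .sample
  prim : ∀ o args, Val (.prim o args) → ∀ i, Val (args i)

theorem valLike_isVal : ValLike (Tm.IsVal : Tm F L → Prop) where
  app _ _ h := nomatch h
  ite _ _ _ h := nomatch h
  score _ h := nomatch h
  sample h := nomatch h
  prim _ _ h := nomatch h

theorem valLike_isSymVal : ValLike (Tm.IsSymVal : Tm F L → Prop) where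
  app _ _ h := nomatch h
  ite _ _ _ h := nomatch h
  score _ h := nomatch h
  sample h := nomatch h
  prim _ _ h := by cases h; assumption

theorem ValLike.plug {Val : Tm F L → Prop} (hV : ValLike Val) {E : ECtx F L} {X : Tm F L}
    (hX : ¬ Val X) : ¬ Val (E.plug X) := by
  induction E with
  | hole => exact hX
  | appL => exact hV.app _ _
  | appR => exact hV.app _ _
  | ite => exact hV.ite _ _ _
  | score => exact hV.score _
  | prim o args i E ih =>
    intro h
    have := hV.prim _ _ h i
    simp only [Function.update_self] at this
    exact ih this

/-- Non-values all of whose immediate subterms in evaluation position are values. -/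
inductive HeadForm (Val : Tm F L → Prop) : Tm F L → Prop
  | app {U V : Tm F L} (hU : Val U) (hV : Val V) : HeadForm Val (.app U V)
  | ite {V : Tm F L} (hV : Val V) (N P : Tm F L) : HeadForm Val (.ite V N P)
  | prim (o : F.Op) (args : Fin (F.arity o) → Tm F L) (h : ∀ i, Val (args i))
      (hn : ¬ Val (.prim o args)) : HeadForm Val (.prim o args)
  | sample : HeadForm Val .sample
  | score {V : Tm F L} (hV : Val V) : HeadForm Val (.score V)

theorem HeadForm.not_val {Val : Tm F L → Prop} (hV : ValLike Val) {a : Tm F L}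
    (h : HeadForm Val a) : ¬ Val a := by
  cases h with
  | app => exact hV.app _ _
  | ite => exact hV.ite _ _ _
  | prim _ _ _ hn => exact hn
  | sample => exact hV.sample
  | score => exact hV.score _

theorem HeadForm.eq_hole {Val : Tm F L → Prop} (hV : ValLike Val) {a b : Tm F L}
    (h : HeadForm Val a) {E : ECtx F L} (he : a = E.plug b) (hb : ¬ Val b) : E = .hole := by
  have key (E : ECtx F L) : ¬ Val (E.plug b) := hV.plug hb
  cases E with
  | hole => rfl
  | appL E N => subst he; cases h with | app hU _ => exact absurd hU (key _)
  | appR V E => subst he; cases h with | app _ hU => exact absurd hU (key _)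
  | ite E N P => subst he; cases h with | ite hU => exact absurd hU (key _)
  | score E => subst he; cases h with | score hU => exact absurd hU (key _)
  | prim o args i E =>
    subst he
    cases h with
    | prim _ _ hU =>
      have := hU i
      simp only [Function.update_self] at this
      exact absurd this (key _)

/-- If the contexts took different directions, one of the two non-values would sit where the other
context demands a value. So one context is a prefix of the other, and `E'` cannot end strictly above
the non-value `X`, because the proper evaluation positions of the head `a` hold values. -/
theorem ECtx.factor {Val : Tm F L → Prop} (hV : ValLike Val) {X a : Tm F L} (hX : ¬ Val X)
    (ha : HeadForm Val a) {E E' : ECtx F L} (hE : E.Ok Val) (hE' : E'.Ok Val)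
    (h : E.plug X = E'.plug a) :
    ∃ E'' : ECtx F L, E''.Ok Val ∧ X = E''.plug a ∧ ∀ Y, E'.plug Y = E.plug (E''.plug Y) := by
  have hav := ha.not_val hV
  induction E generalizing E' with
  | hole => exact ⟨E', hE', h, fun _ => rfl⟩
  | appL E N ih =>
    cases E' with
    | hole => exact absurd (ha.eq_hole hV h.symm hX) (by simp)
    | appL E' N' =>
      simp only [ECtx.plug, Tm.app.injEq] at h
      obtain ⟨E'', h1, h2, h3⟩ := ih (E' := E') hE hE' h.1
      exact ⟨E'', h1, h2, fun Y => by simp [ECtx.plug, h3, h.2]⟩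
    | appR V E' =>
      simp only [ECtx.plug, Tm.app.injEq] at h
      exact absurd (h.1 ▸ hE'.1) (hV.plug hX)
    | _ => simp [ECtx.plug] at h
  | appR V E ih =>
    cases E' with
    | hole => exact absurd (ha.eq_hole hV h.symm hX) (by simp)
    | appR V' E' =>
      simp only [ECtx.plug, Tm.app.injEq] at h
      obtain ⟨E'', h1, h2, h3⟩ := ih hE.2 hE'.2 h.2
      exact ⟨E'', h1, h2, fun Y => by simp [ECtx.plug, h3, h.1]⟩
    | appL E' N =>
      simp only [ECtx.plug, Tm.app.injEq] at h
      exact absurd (h.1 ▸ hE.1) (hV.plug hav)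
    | _ => simp [ECtx.plug] at h
  | ite E N P ih =>
    cases E' with
    | hole => exact absurd (ha.eq_hole hV h.symm hX) (by simp)
    | ite E' N' P' =>
      simp only [ECtx.plug, Tm.ite.injEq] at h
      obtain ⟨E'', h1, h2, h3⟩ := ih (E' := E') hE hE' h.1
      exact ⟨E'', h1, h2, fun Y => by simp [ECtx.plug, h3, h.2]⟩
    | _ => simp [ECtx.plug] at h
  | score E ih =>
    cases E' with
    | hole => exact absurd (ha.eq_hole hV h.symm hX) (by simp)
    | score E' =>
      simp only [ECtx.plug, Tm.score.injEq] at h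
      obtain ⟨E'', h1, h2, h3⟩ := ih (E' := E') hE hE' h
      exact ⟨E'', h1, h2, fun Y => by simp [ECtx.plug, h3]⟩
    | _ => simp [ECtx.plug] at h
  | prim o args i E ih =>
    cases E' with
    | hole => exact absurd (ha.eq_hole hV h.symm hX) (by simp)
    | prim o' args' i' E' =>
      simp only [ECtx.plug, Tm.prim.injEq] at h
      obtain ⟨rfl, h⟩ := h
      have h := congrFun (eq_of_heq h)
      have hi := h i
      have hi' := h i'
      rcases lt_trichotomy i i' with hlt | rfl | hlt
      · rw [Function.update_self, Function.update_of_ne hlt.ne] at hi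
        exact absurd (hi ▸ hE'.1 i hlt) (hV.plug hX)
      · simp only [Function.update_self] at hi
        obtain ⟨E'', h1, h2, h3⟩ := ih hE.2 hE'.2 hi
        refine ⟨E'', h1, h2, fun Y => ?_⟩
        simp only [ECtx.plug, Tm.prim.injEq, heq_eq_eq, true_and, h3]
        funext j
        by_cases hj : j = i
        · subst hj; simp
        · have := h j
          simp_all
      · rw [Function.update_self, Function.update_of_ne hlt.ne] at hi'
        exact absurd (hi' ▸ hE.1 i' hlt) (hV.plug hav)
    | _ => simp [ECtx.plug] at h

/-- Uniqueness of the decomposition into an evaluation context and a head. -/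
theorem ECtx.unique {Val : Tm F L → Prop} (hV : ValLike Val) {a a' : Tm F L}
    (ha : HeadForm Val a) (ha' : HeadForm Val a') {E E' : ECtx F L} (hE : E.Ok Val)
    (hE' : E'.Ok Val) (h : E.plug a = E'.plug a') : a = a' ∧ ∀ Y, E.plug Y = E'.plug Y := by
  obtain ⟨E'', -, h2, h3⟩ := ECtx.factor hV (ha.not_val hV) ha' hE hE' h
  have := ha.eq_hole hV h2 (ha'.not_val hV)
  subst this
  exact ⟨h2, fun Y => (h3 Y).symm⟩

theorem inCtx_iff {Val : Tm F L → Prop} {R : Tm F L → Tm F L → Prop} {M M₁ : Tm F L} :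
    Tm.InCtx Val R M M₁ ↔
      ∃ (E : ECtx F L) (a b : Tm F L), E.Ok Val ∧ R a b ∧ M = E.plug a ∧ M₁ = E.plug b := by
  constructor
  · intro h
    induction h with
    | here h => exact ⟨.hole, _, _, trivial, h, rfl, rfl⟩
    | appL N _ ih =>
      obtain ⟨E, a, b, h1, h2, rfl, rfl⟩ := ih
      exact ⟨.appL E N, a, b, h1, h2, rfl, rfl⟩
    | appR hV _ ih =>
      obtain ⟨E, a, b, h1, h2, rfl, rfl⟩ := ih
      exact ⟨.appR _ E, a, b, ⟨hV, h1⟩, h2, rfl, rfl⟩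
    | ite N P _ ih =>
      obtain ⟨E, a, b, h1, h2, rfl, rfl⟩ := ih
      exact ⟨.ite E N P, a, b, h1, h2, rfl, rfl⟩
    | prim o args i hV _ ih =>
      obtain ⟨E, a, b, h1, h2, h3, rfl⟩ := ih
      exact ⟨.prim o args i E, a, b, ⟨hV, h1⟩, h2, by simp [ECtx.plug, ← h3], rfl⟩
    | score _ ih =>
      obtain ⟨E, a, b, h1, h2, rfl, rfl⟩ := ih
      exact ⟨.score E, a, b, h1, h2, rfl, rfl⟩
  · rintro ⟨E, a, b, h1, h2, rfl, rfl⟩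
    induction E with
    | hole => exact .here h2
    | appL E N ih => exact .appL _ (ih h1)
    | appR V E ih => exact .appR h1.1 (ih h1.2)
    | ite E N P ih => exact .ite _ _ (ih h1)
    | score E ih => exact .score (ih h1)
    | prim o args i E ih =>
      have := Tm.InCtx.prim (Val := Val) (R := R) o (Function.update args i (E.plug a)) i
        (N := E.plug b) (fun j hj => by simpa [Function.update_of_ne hj.ne] using h1.1 j hj)
        (by simpa using ih h1.2)
      simpa [ECtx.plug] using this

/-- Every term is a value or an evaluation context around a head. -/
theorem exists_plug_head {Val : Tm F L → Prop}
    (hvar : ∀ i, Val (.var i)) (hlit : ∀ c, Val (.lit c)) (hlam : ∀ M, Val (.lam M))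
    (hfix : ∀ M, Val (.fix M)) (N : Tm F L) :
    Val N ∨ ∃ (E : ECtx F L) (a : Tm F L), E.Ok Val ∧ HeadForm Val a ∧ N = E.plug a := by
  induction N with
  | var i => exact .inl (hvar i)
  | lit c => exact .inl (hlit c)
  | lam M => exact .inl (hlam M)
  | fix M => exact .inl (hfix M)
  | sample => exact .inr ⟨.hole, _, trivial, .sample, rfl⟩
  | app M N ihM ihN =>
    right
    rcases ihM with hM | ⟨E, a, h1, h2, rfl⟩
    · rcases ihN with hN | ⟨E, a, h1, h2, rfl⟩
      · exact ⟨.hole, _, trivial, .app hM hN, rfl⟩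
      · exact ⟨.appR M E, a, ⟨hM, h1⟩, h2, rfl⟩
    · exact ⟨.appL E N, a, h1, h2, rfl⟩
  | ite M N P ihM =>
    right
    rcases ihM with hM | ⟨E, a, h1, h2, rfl⟩
    · exact ⟨.hole, _, trivial, .ite hM _ _, rfl⟩
    · exact ⟨.ite E N P, a, h1, h2, rfl⟩
  | score M ihM =>
    right
    rcases ihM with hM | ⟨E, a, h1, h2, rfl⟩
    · exact ⟨.hole, _, trivial, .score hM, rfl⟩
    · exact ⟨.score E, a, h1, h2, rfl⟩
  | prim o args ih =>
    by_cases hp : Val (.prim o args)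
    · exact .inl hp
    right
    by_cases h : ∀ i, Val (args i)
    · exact ⟨.hole, _, trivial, .prim o args h hp, rfl⟩
    · push Not at h
      -- The leftmost argument that is not a value: all arguments before it are values, as the
      -- context requires.
      obtain ⟨i, hi, hmin⟩ := WellFounded.has_min (wellFounded_lt (α := Fin (F.arity o)))
        {i | ¬ Val (args i)} h
      rcases ih i with hv | ⟨E, a, h1, h2, h3⟩
      · exact absurd hv hi
      · refine ⟨.prim o args i E, a, ⟨fun j hj => ?_, h1⟩, h2, by simp [ECtx.plug, ← h3]⟩
        by_contra hc
        exact hmin j hc hj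

theorem Tm.exists_plug_head (N : Tm F L) :
    N.IsVal ∨ ∃ (E : ECtx F L) (a : Tm F L),
      E.Ok Tm.IsVal ∧ HeadForm Tm.IsVal a ∧ N = E.plug a :=
  GuBPI.exists_plug_head .var .lit .lam .fix N

/-! ## Substitution and literals -/

namespace Tm

theorem map_rename (g : L → L₁) (ρ : ℕ → ℕ) (M : Tm F L) :
    (M.rename ρ).map g = (M.map g).rename ρ := by
  induction M generalizing ρ <;> simp_all [rename, map]

theorem map_upSubst (g : L → L₁) (θ : ℕ → Tm F L) :
    (fun i => (upSubst θ i).map g) = upSubst fun i => (θ i).map g := by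
  funext i
  cases i <;> simp [upSubst, map, map_rename]

theorem map_subst (g : L → L₁) (θ : ℕ → Tm F L) (M : Tm F L) :
    (M.subst θ).map g = (M.map g).subst fun i => (θ i).map g := by
  induction M generalizing θ <;> simp_all [subst, map, map_upSubst]

theorem map_inst1 (g : L → L₁) (M V : Tm F L) :
    (M.inst1 V).map g = (M.map g).inst1 (V.map g) := by
  rw [inst1, inst1, map_subst]
  congr 1
  funext i
  rcases i with _ | i <;> rfl

theorem map_inst2 (g : L → L₁) (M V W : Tm F L) :
    (M.inst2 V W).map g = (M.map g).inst2 (V.map g) (W.map g) := by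
  rw [inst2, inst2, map_subst]
  congr 1
  funext i
  rcases i with _ | _ | i <;> rfl

theorem map_map {L₂ : Type} (g : L → L₁) (h : L₁ → L₂) (M : Tm F L) :
    (M.map g).map h = M.map (h ∘ g) := by
  induction M <;> simp_all [map]

theorem IsVal.map {M : Tm F L} (h : M.IsVal) (g : L → L₁) : (M.map g).IsVal := by
  cases h <;> constructor

end Tm

theorem ECtx.map_map {L₂ : Type} (g : L → L₁) (h : L₁ → L₂) (E : ECtx F L) :
    (E.map g).map h = E.map (h ∘ g) := by
  induction E <;> simp_all [ECtx.map, Tm.map_map]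

theorem ECtx.Ok.map {E : ECtx F L} (hE : E.Ok Tm.IsVal) (g : L → L₁) :
    (E.map g).Ok Tm.IsVal := by
  induction E with
  | appR V E ih => exact ⟨hE.1.map g, ih hE.2⟩
  | prim o args i E ih => exact ⟨fun j hj => (hE.1 j hj).map g, ih hE.2⟩
  | hole => trivial
  | _ => simp_all [ECtx.Ok, ECtx.map]

theorem HeadForm.map {a : Tm F L} (h : HeadForm Tm.IsVal a) (g : L → L₁) :
    HeadForm Tm.IsVal (a.map g) := by
  cases h with
  | app hU hV => exact .app (hU.map g) (hV.map g)
  | ite hV => exact .ite (hV.map g) _ _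
  | prim o args h => exact .prim _ _ (fun i => (h i).map g) (fun h => nomatch h)
  | sample => exact .sample
  | score hV => exact .score (hV.map g)

end

section

variable {F : Signature.{u}} {L L₁ : Type}
/-! ## Deterministic reduction -/

/-- Redexes whose reduction does not consume randomness, with the factor on the weight. -/
inductive DRed : Tm F ℝ → ℝ → Tm F ℝ → Prop
  | beta (M V : Tm F ℝ) (hV : V.IsVal) : DRed (.app (.lam M) V) 1 (M.inst1 V)
  | fix (M V : Tm F ℝ) (hV : V.IsVal) : DRed (.app (.fix M) V) 1 (M.inst2 V (.fix M))
  | prim (o : F.Op) (r : Fin (F.arity o) → ℝ) :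
      DRed (.prim o fun i => .lit (r i)) 1 (.lit (F.fn o r))
  | iteLe (r : ℝ) (N P : Tm F ℝ) (h : r ≤ 0) : DRed (.ite (.lit r) N P) 1 N
  | iteGt (r : ℝ) (N P : Tm F ℝ) (h : 0 < r) : DRed (.ite (.lit r) N P) 1 P
  | score (r : ℝ) (h : 0 ≤ r) : DRed (.score (.lit r)) r (.lit r)

theorem DRed.nonneg {a b : Tm F ℝ} {f : ℝ} (h : DRed a f b) : 0 ≤ f := by
  cases h <;> first | assumption | exact zero_le_one

theorem redex_iff {a b : Tm F ℝ} {s s' : List unitInterval} {w w' : ℝ} :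
    Redex a s w b s' w' ↔ (s' = s ∧ ∃ f, DRed a f b ∧ w' = w * f) ∨
      ∃ r : unitInterval, a = .sample ∧ b = .lit r ∧ s = r :: s' ∧ w' = w := by
  constructor
  · intro h
    cases h with
    | beta _ _ _ _ hV => exact .inl ⟨rfl, 1, .beta _ _ hV, (mul_one _).symm⟩
    | fix _ _ _ _ hV => exact .inl ⟨rfl, 1, .fix _ _ hV, (mul_one _).symm⟩
    | sample r => exact .inr ⟨r, rfl, rfl, rfl, rfl⟩
    | prim o r => exact .inl ⟨rfl, 1, .prim _ _, (mul_one _).symm⟩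
    | iteLe r _ _ _ _ h => exact .inl ⟨rfl, 1, .iteLe _ _ _ h, (mul_one _).symm⟩
    | iteGt r _ _ _ _ h => exact .inl ⟨rfl, 1, .iteGt _ _ _ h, (mul_one _).symm⟩
    | score r _ _ h => exact .inl ⟨rfl, r, .score _ h, rfl⟩
  · rintro (⟨rfl, f, h, rfl⟩ | ⟨r, rfl, rfl, rfl, rfl⟩)
    · cases h with
      | beta _ _ hV => rw [mul_one]; exact .beta _ _ _ _ hV
      | fix _ _ hV => rw [mul_one]; exact .fix _ _ _ _ hV
      | prim o r => rw [mul_one]; exact .prim _ _ _ _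
      | iteLe r _ _ h => rw [mul_one]; exact .iteLe _ _ _ _ _ h
      | iteGt r _ _ h => rw [mul_one]; exact .iteGt _ _ _ _ _ h
      | score r h => exact .score _ _ _ h
    · exact .sample _ _ _

theorem DRed.head {a b : Tm F ℝ} {f : ℝ} (h : DRed a f b) : HeadForm Tm.IsVal a := by
  cases h with
  | beta _ _ hV => exact .app (.lam _) hV
  | fix _ _ hV => exact .app (.fix _) hV
  | prim o r => exact .prim _ _ (fun _ => .lit _) (fun h => nomatch h)
  | iteLe => exact .ite (.lit _) _ _
  | iteGt => exact .ite (.lit _) _ _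
  | score => exact .score (.lit _)

theorem DRed.det {a b b' : Tm F ℝ} {f f' : ℝ} (h : DRed a f b) (h' : DRed a f' b') :
    f = f' ∧ b = b' := by
  cases h with
  | prim o r =>
    generalize he : (Tm.prim o fun i => Tm.lit (r i)) = a at h'
    cases h' with
    | prim o' r' =>
      simp only [Tm.prim.injEq] at he
      obtain ⟨rfl, he⟩ := he
      have : r = r' := by
        funext i
        simpa using congrFun (eq_of_heq he) i
      subst this
      exact ⟨rfl, rfl⟩
    | _ => cases he
  | iteLe r N P h => cases h' with
    | iteLe => exact ⟨rfl, rfl⟩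
    | iteGt _ _ _ h' => exact absurd h h'.not_ge
  | iteGt r N P h => cases h' with
    | iteGt => exact ⟨rfl, rfl⟩
    | iteLe _ _ _ h' => exact absurd h h'.not_gt
  | _ => cases h'; exact ⟨rfl, rfl⟩

theorem not_dRed_sample {b : Tm F ℝ} {f : ℝ} : ¬ DRed .sample f b := fun h => nomatch h

theorem Redex.head {a b : Tm F ℝ} {s s' : List unitInterval} {w w' : ℝ}
    (h : Redex a s w b s' w') : HeadForm Tm.IsVal a := by
  rcases redex_iff.1 h with ⟨-, f, h, -⟩ | ⟨r, rfl, -⟩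
  · exact h.head
  · exact .sample

theorem step_plug_iff {E : ECtx F ℝ} (hE : E.Ok Tm.IsVal) {a : Tm F ℝ}
    (ha : HeadForm Tm.IsVal a) {s : List unitInterval} {w : ℝ} {d : Conf F} :
    Step ⟨E.plug a, s, w⟩ d ↔ ∃ b, Redex a s w b d.trace d.weight ∧ d.tm = E.plug b := by
  rw [Step, inCtx_iff]
  constructor
  · rintro ⟨E', a', b, hE', hr, h1, h2⟩
    obtain ⟨rfl, h⟩ := ECtx.unique valLike_isVal ha hr.head hE hE' h1
    exact ⟨b, hr, by rw [h2, h]⟩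
  · rintro ⟨b, hr, h⟩
    exact ⟨E, a, b, hE, hr, rfl, h⟩

/-- One step of reduction that does not consume randomness, with the factor on the weight. -/
def DStep (N : Tm F ℝ) (f : ℝ) (N' : Tm F ℝ) : Prop :=
  ∃ (E : ECtx F ℝ) (a b : Tm F ℝ), E.Ok Tm.IsVal ∧ DRed a f b ∧ N = E.plug a ∧ N' = E.plug b

theorem DRed.dStep {a b : Tm F ℝ} {f : ℝ} (h : DRed a f b) : DStep a f b :=
  ⟨.hole, a, b, trivial, h, rfl, rfl⟩

theorem DStep.plug {N N' : Tm F ℝ} {f : ℝ} (h : DStep N f N') {E : ECtx F ℝ}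
    (hE : E.Ok Tm.IsVal) : DStep (E.plug N) f (E.plug N') := by
  obtain ⟨E', a, b, hE', hr, rfl, rfl⟩ := h
  exact ⟨E.comp E', a, b, hE.comp hE', hr, (ECtx.plug_comp ..).symm, (ECtx.plug_comp ..).symm⟩

theorem DStep.nonneg {N N' : Tm F ℝ} {f : ℝ} (h : DStep N f N') : 0 ≤ f := by
  obtain ⟨E', a, b, hE', hr, rfl, rfl⟩ := h
  exact hr.nonneg

theorem DStep.not_isVal {N N' : Tm F ℝ} {f : ℝ} (h : DStep N f N') : ¬ N.IsVal := by
  obtain ⟨E', a, b, hE', hr, rfl, rfl⟩ := h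
  exact valLike_isVal.plug (hr.head.not_val valLike_isVal)

theorem DStep.step_iff {N N' : Tm F ℝ} {f w : ℝ} {s : List unitInterval} {d : Conf F}
    (h : DStep N f N') : Step ⟨N, s, w⟩ d ↔ d = ⟨N', s, w * f⟩ := by
  obtain ⟨E, a, b, hE, hr, rfl, rfl⟩ := h
  rw [step_plug_iff hE hr.head]
  constructor
  · rintro ⟨b', hb, hd⟩
    rcases redex_iff.1 hb with ⟨h1, f', h2, h3⟩ | ⟨r, rfl, -⟩
    · obtain ⟨rfl, rfl⟩ := hr.det h2
      obtain ⟨t, s', w'⟩ := d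
      simp_all
    · exact absurd hr not_dRed_sample
  · rintro rfl
    exact ⟨b, redex_iff.2 (.inl ⟨rfl, f, hr, rfl⟩), rfl⟩

theorem step_sample_iff {E : ECtx F ℝ} (hE : E.Ok Tm.IsVal) {w : ℝ} {s : List unitInterval}
    {d : Conf F} : Step ⟨E.plug .sample, s, w⟩ d ↔
      ∃ (r : unitInterval) (s' : List unitInterval), s = r :: s' ∧
        d = ⟨E.plug (.lit r), s', w⟩ := by
  rw [step_plug_iff hE .sample]
  constructor
  · rintro ⟨b', hb, hd⟩
    rcases redex_iff.1 hb with ⟨h1, f', h2, h3⟩ | ⟨r, -, rfl, h1, h2⟩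
    · exact absurd h2 not_dRed_sample
    · obtain ⟨t, s', w'⟩ := d
      exact ⟨r, s', h1, by simp_all⟩
  · rintro ⟨r, s', rfl, rfl⟩
    exact ⟨.lit r, .sample _ _ _, rfl⟩

/-- A term that has no step at all, in the sense of both kinds of redexes. -/
def Stuck (N : Tm F ℝ) : Prop := ∀ s w d, ¬ Step ⟨N, s, w⟩ d

theorem stuck_of_isVal {N : Tm F ℝ} (hN : N.IsVal) : Stuck N := by
  intro s w d h
  rw [Step, inCtx_iff] at h
  obtain ⟨E, a, b, -, hr, h, -⟩ := h
  simp only at h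
  exact valLike_isVal.plug (hr.head.not_val valLike_isVal) (h ▸ hN)

theorem stuck_plug_of_head {E : ECtx F ℝ} (hE : E.Ok Tm.IsVal) {a : Tm F ℝ}
    (ha : HeadForm Tm.IsVal a) (h1 : ∀ f b, ¬ DRed a f b) (h2 : a ≠ .sample) :
    Stuck (E.plug a) := by
  intro s w d h
  rw [step_plug_iff hE ha] at h
  obtain ⟨b, hb, -⟩ := h
  rcases redex_iff.1 hb with ⟨-, f', h, -⟩ | ⟨r, h, -⟩
  · exact h1 _ _ h
  · exact h2 h

/-- The case distinction behind the inductions on the number of steps. Its last case speaks of all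
contexts because a stuck non-value also blocks every evaluation context around it, whereas a value
does not. -/
theorem Tm.step_cases (N : Tm F ℝ) :
    N.IsVal ∨ (∃ f N', DStep N f N') ∨
      (∃ E : ECtx F ℝ, E.Ok Tm.IsVal ∧ N = E.plug .sample) ∨
      (¬ N.IsVal ∧ ∀ E : ECtx F ℝ, E.Ok Tm.IsVal → Stuck (E.plug N)) := by
  rcases N.exists_plug_head with h | ⟨E, a, hE, ha, rfl⟩
  · exact .inl h
  right
  by_cases h1 : ∃ f b, DRed a f b
  · obtain ⟨f, b, h⟩ := h1
    exact .inl ⟨f, _, h.dStep.plug hE⟩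
  right
  by_cases h2 : a = .sample
  · subst h2
    exact .inl ⟨E, hE, rfl⟩
  right
  refine ⟨valLike_isVal.plug (ha.not_val valLike_isVal), fun E' hE' => ?_⟩
  rw [← ECtx.plug_comp]
  exact stuck_plug_of_head (hE'.comp hE) ha (by simpa using h1) h2

theorem Step.det {c d d' : Conf F} (h : Step c d) (h' : Step c d') : d = d' := by
  obtain ⟨N, s, w⟩ := c
  rcases N.step_cases with hN | ⟨f, N', hN⟩ | ⟨E, hE, rfl⟩ | ⟨-, hN⟩
  · exact absurd h (stuck_of_isVal hN _ _ _)
  · rw [hN.step_iff.1 h, hN.step_iff.1 h']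
  · obtain ⟨r, s', rfl, rfl⟩ := (step_sample_iff hE).1 h
    obtain ⟨r, s', h1, rfl⟩ := (step_sample_iff hE).1 h'
    cases h1
    rfl
  · exact absurd h (hN .hole trivial _ _ _)

/-! ## Terminating runs -/

/-- The run from `c` ends within `k` steps, with the trace used up, in the value `r` and with the
weight `w`. -/
inductive RunsIn : ℕ → Conf F → ℝ → ℝ → Prop
  | done (k : ℕ) (r w : ℝ) : RunsIn k ⟨.lit r, [], w⟩ r w
  | step {k : ℕ} {c d : Conf F} {r w : ℝ} (h : Step c d) (h' : RunsIn k d r w) :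
      RunsIn (k + 1) c r w

theorem RunsIn.mono {k l : ℕ} (hkl : k ≤ l) {c : Conf F} {r w : ℝ} (h : RunsIn k c r w) :
    RunsIn l c r w := by
  induction h generalizing l with
  | done => exact .done _ _ _
  | step h _ ih =>
    obtain ⟨l, rfl⟩ : ∃ m, l = m + 1 := ⟨l - 1, by omega⟩
    exact .step h (ih (by omega))

theorem RunsIn.unique {k l : ℕ} {c : Conf F} {r w r' w' : ℝ} (h : RunsIn k c r w)
    (h' : RunsIn l c r' w') : r = r' ∧ w = w' := by
  induction h generalizing l with
  | done =>
    cases h' with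
    | done => exact ⟨rfl, rfl⟩
    | step h => exact absurd h (stuck_of_isVal (.lit _) _ _ _)
  | step h _ ih =>
    cases h' with
    | done => exact absurd h (stuck_of_isVal (.lit _) _ _ _)
    | step h1 h2 =>
      obtain rfl := h.det h1
      exact ih h2

theorem evaluates_iff {P : Tm F ℝ} {s : Trace} {r w : ℝ} :
    Evaluates P s r w ↔ ∃ k, RunsIn k ⟨P, List.ofFn s.2, 1⟩ r w := by
  rw [Evaluates]
  generalize (⟨P, List.ofFn s.2, 1⟩ : Conf F) = c
  constructor
  · intro h
    induction h using Relation.ReflTransGen.head_induction_on with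
    | refl => exact ⟨0, .done _ _ _⟩
    | head h _ ih =>
      obtain ⟨k, hk⟩ := ih
      exact ⟨k + 1, .step h hk⟩
  · rintro ⟨k, h⟩
    generalize hr : r = r' at h
    induction h with
    | done => subst hr; exact .refl
    | step h _ ih => exact .head h (ih hr)

theorem Step.scale {N N' : Tm F ℝ} {s s' : List unitInterval} {w w' : ℝ}
    (h : Step ⟨N, s, w⟩ ⟨N', s', w'⟩) :
    ∃ f, 0 ≤ f ∧ w' = w * f ∧ ∀ c, Step ⟨N, s, c⟩ ⟨N', s', c * f⟩ := by
  rw [Step, inCtx_iff] at h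
  obtain ⟨E, a, b, hE, hr, h1, h2⟩ := h
  simp only at h1 h2 hr
  subst h1 h2
  rcases redex_iff.1 hr with ⟨rfl, f, hf, rfl⟩ | ⟨r, rfl, rfl, rfl, rfl⟩
  · exact ⟨f, hf.nonneg, rfl, fun c => ((hf.dStep.plug hE).step_iff).2 rfl⟩
  · exact ⟨1, zero_le_one, (mul_one _).symm, fun c =>
      (step_sample_iff hE).2 ⟨r, _, rfl, by rw [mul_one]⟩⟩

/-- Runs are linear in the initial weight, so the tail of a run can be restarted with weight 1. This
gives the multiplicative recursion `dk_dStep`. -/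
theorem RunsIn.scale {k : ℕ} {N : Tm F ℝ} {s : List unitInterval} {w₀ r w : ℝ}
    (h : RunsIn k ⟨N, s, w₀⟩ r w) :
    ∃ f, 0 ≤ f ∧ w = w₀ * f ∧ ∀ c, RunsIn k ⟨N, s, c⟩ r (c * f) := by
  generalize hc : (⟨N, s, w₀⟩ : Conf F) = c at h
  induction h generalizing N s w₀ with
  | done =>
    cases hc
    exact ⟨1, zero_le_one, (mul_one _).symm, fun c => by rw [mul_one]; exact .done _ _ _⟩
  | @step k c d r w h _ ih =>
    subst hc
    obtain ⟨N', s', w'⟩ := d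
    obtain ⟨f, hf, rfl, h3⟩ := h.scale
    obtain ⟨f', hf', h4, h5⟩ := ih rfl
    exact ⟨f * f', mul_nonneg hf hf', by rw [h4, mul_assoc],
      fun c => .step (h3 c) (by rw [← mul_assoc]; exact h5 _)⟩

/-! ## Bounded-step evaluation -/

/-- Weight functionals: `ENNReal.ofReal`, or the constant `1` that forgets the weight. -/
structure WF (φ : ℝ → ℝ≥0∞) : Prop where
  one : φ 1 = 1
  mul : ∀ a b, 0 ≤ a → φ (a * b) = φ a * φ b
  meas : Measurable φ

theorem wf_ofReal : WF ENNReal.ofReal where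
  one := ENNReal.ofReal_one
  mul _ _ h := ENNReal.ofReal_mul h
  meas := ENNReal.measurable_ofReal

theorem wf_one : WF fun _ => 1 where
  one := rfl
  mul _ _ _ := (mul_one _).symm
  meas := measurable_const

/-- The weight of the run of `N` on `s` if it ends within `k` steps in a value in `U`, and `0`
otherwise. -/
def dk (φ : ℝ → ℝ≥0∞) (U : Set ℝ) (k : ℕ) (N : Tm F ℝ) (s : List unitInterval) : ℝ≥0∞ :=
  -- Reduction is deterministic, so at most one pair `(r, w)` qualifies; the supremum only supplies
  -- the value 0 if there is none.
  ⨆ (r : ℝ) (w : ℝ) (_ : r ∈ U ∧ RunsIn k ⟨N, s, 1⟩ r w), φ w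

variable {φ : ℝ → ℝ≥0∞} {U : Set ℝ}

theorem dk_mono {k l : ℕ} (h : k ≤ l) (N : Tm F ℝ) (s : List unitInterval) :
    dk φ U k N s ≤ dk φ U l N s := by
  refine iSup_mono fun r => iSup_mono fun w => iSup_mono' fun hr => ⟨⟨hr.1, hr.2.mono h⟩, le_rfl⟩

theorem dk_eq {k : ℕ} {N : Tm F ℝ} {s : List unitInterval} {r w : ℝ} (hr : r ∈ U)
    (h : RunsIn k ⟨N, s, 1⟩ r w) : dk φ U k N s = φ w := by
  refine le_antisymm (iSup_le fun r' => iSup_le fun w' => iSup_le fun h' => ?_) ?_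
  · rw [(h.unique h'.2).2]
  · exact le_iSup_of_le r (le_iSup_of_le w (le_iSup_of_le ⟨hr, h⟩ le_rfl))

theorem dk_eq_zero {k : ℕ} {N : Tm F ℝ} {s : List unitInterval}
    (h : ∀ r ∈ U, ∀ w, ¬ RunsIn k ⟨N, s, 1⟩ r w) : dk φ U k N s = 0 := by
  simp only [dk, ENNReal.iSup_eq_zero]
  rintro r w ⟨h1, h2⟩
  exact absurd h2 (h r h1 w)

theorem dk_dStep (hφ : WF φ) {N N' : Tm F ℝ} {f : ℝ} (h : DStep N f N') (k : ℕ)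
    (s : List unitInterval) : dk φ U (k + 1) N s = φ f * dk φ U k N' s := by
  by_cases hr : ∃ r ∈ U, ∃ w, RunsIn k ⟨N', s, 1⟩ r w
  · obtain ⟨r, hr, w, hw⟩ := hr
    have h1 : RunsIn (k + 1) ⟨N, s, 1⟩ r (f * w) := by
      refine .step (h.step_iff.2 rfl) ?_
      obtain ⟨f', -, h1, h2⟩ := hw.scale
      rw [h1, one_mul, one_mul]
      exact h2 _
    rw [dk_eq hr hw, dk_eq hr h1, hφ.mul _ _ h.nonneg]
  · push Not at hr
    rw [dk_eq_zero hr, mul_zero]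
    refine dk_eq_zero fun r hrU w hw => ?_
    cases hw with
    | done => exact h.not_isVal (.lit _)
    | step h1 h2 =>
      rw [h.step_iff] at h1
      subst h1
      obtain ⟨f', -, h1, h2⟩ := h2.scale
      exact hr r hrU _ (h2 1)

theorem dk_sample_cons {E : ECtx F ℝ} (hE : E.Ok Tm.IsVal) (k : ℕ) (r : unitInterval)
    (s : List unitInterval) :
    dk φ U (k + 1) (E.plug .sample) (r :: s) = dk φ U k (E.plug (.lit r)) s := by
  have hs : Step ⟨E.plug .sample, r :: s, 1⟩ ⟨E.plug (.lit r), s, 1⟩ :=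
    (step_sample_iff hE).2 ⟨r, s, rfl, rfl⟩
  simp only [dk]
  congr! 5 with r' w
  refine and_congr_right fun _ => ⟨fun h => ?_, .step hs⟩
  generalize hc : (⟨E.plug .sample, r :: s, 1⟩ : Conf F) = c at h hs
  cases h with
  | done => injection hc with _ h2; cases h2
  | step h1 h2 => rwa [hs.det h1]

theorem dk_sample_nil {E : ECtx F ℝ} (hE : E.Ok Tm.IsVal) (k : ℕ) :
    dk φ U k (E.plug .sample) [] = 0 := by
  refine dk_eq_zero fun r hrU w hw => ?_
  generalize hc : (⟨E.plug .sample, [], 1⟩ : Conf F) = c at hw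
  cases hw with
  | done =>
    injection hc with h1
    exact valLike_isVal.plug valLike_isVal.sample (h1 ▸ Tm.IsVal.lit (F := F) _)
  | step h1 h2 =>
    subst hc
    obtain ⟨r, s, h, -⟩ := (step_sample_iff hE).1 h1
    cases h

theorem dk_lit_nil (hφ : WF φ) (k : ℕ) (r : ℝ) :
    dk φ U k (.lit r : Tm F ℝ) [] = U.indicator 1 r := by
  by_cases hr : r ∈ U
  · rw [dk_eq hr (.done _ _ _), hφ.one, indicator_of_mem hr, Pi.one_apply]
  · rw [indicator_of_notMem hr]
    refine dk_eq_zero fun r' hr' w hw => hr ?_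
    rwa [((RunsIn.done k r 1).unique hw).1]

theorem dk_lit_cons (k : ℕ) (r : ℝ) (x : unitInterval) (s : List unitInterval) :
    dk φ U k (.lit r : Tm F ℝ) (x :: s) = 0 := by
  refine dk_eq_zero fun r' hr' w hw => ?_
  cases hw with
  | step h => exact stuck_of_isVal (.lit _) _ _ _ h

theorem dk_stuck {N : Tm F ℝ} (hN : Stuck N) (hl : ∀ r, N ≠ .lit r) (k : ℕ)
    (s : List unitInterval) : dk φ U k N s = 0 := by
  refine dk_eq_zero fun r' hr' w hw => ?_
  cases hw with
  | done => exact hl _ rfl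
  | step h => exact hN _ _ _ h

theorem dk_zero {N : Tm F ℝ} (hl : ∀ r, N ≠ .lit r) (s : List unitInterval) :
    dk φ U 0 N s = 0 := by
  refine dk_eq_zero fun r' hr' w hw => ?_
  cases hw with
  | done => exact hl _ rfl

end

section

variable {F : Signature.{u}} {L L₁ : Type}
variable {φ : ℝ → ℝ≥0∞} {U : Set ℝ}

/-! ## Measurability -/

/-- Measurable real functions, as literals. -/
abbrev MF (X : Type) [MeasurableSpace X] : Type := {f : X → ℝ // Measurable f}

/-- Evaluate all literals at `x`. -/
def Tm.at {X : Type} [MeasurableSpace X] (N : Tm F (MF X)) (x : X) : Tm F ℝ :=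
  N.map fun f => f.1 x

/-- Change of the parameter space of the literals. -/
def MF.comp {X Y : Type} [MeasurableSpace X] [MeasurableSpace Y] {g : Y → X} (hg : Measurable g)
    (f : MF X) : MF Y := ⟨f.1 ∘ g, f.2.comp hg⟩

theorem Tm.at_lit {X : Type} [MeasurableSpace X] {N : Tm F (MF X)} {x : X} {r : ℝ}
    (h : N.at x = .lit r) : ∃ f : MF X, N = .lit f := by
  cases N <;> simp_all [Tm.at, Tm.map]

theorem measurable_ofFn_of_dk {X : Type} [MeasurableSpace X] {n : ℕ}
    {a : X → List unitInterval → ℝ≥0∞}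
    (h0 : n = 0 → Measurable fun x => a x []) (hs : ∀ m, n = m + 1 →
      Measurable fun p : X × (Fin (m + 1) → unitInterval) =>
        a p.1 (p.2 0 :: List.ofFn (Fin.tail p.2))) :
    Measurable fun p : X × (Fin n → unitInterval) => a p.1 (List.ofFn p.2) := by
  cases n with
  | zero =>
    simp only [List.ofFn_zero]
    exact (h0 rfl).comp measurable_fst
  | succ m =>
    simp only [List.ofFn_succ]
    exact hs m rfl

/-- Bounded-step evaluation is jointly measurable in the literals and the trace. -/
theorem measurable_dk (hφ : WF φ) (hU : MeasurableSet U) (k n : ℕ) {X : Type}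
    [MeasurableSpace X] (N : Tm F (MF X)) :
    Measurable fun p : X × (Fin n → unitInterval) => dk φ U k (N.at p.1) (List.ofFn p.2) := by
  have lit_case : ∀ (k n : ℕ) {X : Type} [MeasurableSpace X] (f : MF X),
      Measurable fun p : X × (Fin n → unitInterval) =>
        dk φ U k ((Tm.lit f : Tm F (MF X)).at p.1) (List.ofFn p.2) := by
    intro k n X _ f
    refine measurable_ofFn_of_dk (a := fun x s => dk φ U k ((Tm.lit f : Tm F (MF X)).at x) s)
      (fun _ => ?_) (fun m _ => ?_)
    · simp only [Tm.at, Tm.map, dk_lit_nil hφ]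
      exact (measurable_one.indicator hU).comp f.2
    · simp only [Tm.at, Tm.map, dk_lit_cons]
      exact measurable_const
  have stuck_case : ∀ (k n : ℕ) {X : Type} [MeasurableSpace X] (N : Tm F (MF X)),
      (∀ f, N ≠ .lit f) → (∀ x, Stuck (N.at x)) →
      Measurable fun p : X × (Fin n → unitInterval) =>
        dk φ U k (N.at p.1) (List.ofFn p.2) := by
    intro k n X _ N h h'
    have : ∀ x s, dk φ U k (N.at x) s = 0 := fun x s => dk_stuck (h' x) (fun r hr => by
      obtain ⟨f, hf⟩ := Tm.at_lit hr
      exact h f hf) k s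
    simp only [this]
    exact measurable_const
  -- All terms `N.at x` have the same shape and hence the same head, so one step can be taken for
  -- all parameters at once, with literals remaining measurable functions. Conditionals and scores
  -- split the parameter space along a measurable set, and `sample` enlarges the space by a factor
  -- `[0, 1]`.
  induction k generalizing n X with
  | zero =>
    by_cases hl : ∃ f, N = .lit f
    · obtain ⟨f, rfl⟩ := hl
      exact lit_case 0 n f
    · have : ∀ x s, dk φ U 0 (N.at x) s = 0 := fun x s => dk_zero (fun r hr => hl (Tm.at_lit hr)) s
      simp only [this]
      exact measurable_const
  | succ k ih =>
    rcases N.exists_plug_head with hN | ⟨E, a, hE, ha, rfl⟩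
    · by_cases hl : ∃ f, N = .lit f
      · obtain ⟨f, rfl⟩ := hl
        exact lit_case _ n f
      · exact stuck_case _ _ _ (by simpa using hl) fun x => stuck_of_isVal (hN.map _)
    have hEx : ∀ x, (E.map fun f => f.1 x).Ok Tm.IsVal := fun x => hE.map _
    have hplug : ∀ (b : Tm F (MF X)) x, (E.plug b).at x = (E.map fun f => f.1 x).plug (b.at x) :=
      fun b x => ECtx.map_plug _ _ _
    have stuck : (∀ x f b, ¬ DRed (a.at x) f b) → a ≠ .sample →
        Measurable fun p : X × (Fin n → unitInterval) =>
          dk φ U (k + 1) ((E.plug a).at p.1) (List.ofFn p.2) := by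
      intro h1 h2
      refine stuck_case _ _ _ (fun f hf => ?_) fun x => ?_
      · exact valLike_isVal.plug (ha.not_val valLike_isVal) (hf ▸ Tm.IsVal.lit (F := F) f)
      · rw [hplug]
        refine stuck_plug_of_head (hEx x) (ha.map _) (h1 x) ?_
        cases a <;> simp_all [Tm.at, Tm.map]
    have det : ∀ b : Tm F (MF X), (∀ x, DRed (a.at x) 1 (b.at x)) →
        Measurable fun p : X × (Fin n → unitInterval) =>
          dk φ U (k + 1) ((E.plug a).at p.1) (List.ofFn p.2) := by
      intro b hb
      have : ∀ x s, dk φ U (k + 1) ((E.plug a).at x) s = dk φ U k ((E.plug b).at x) s := by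
        intro x s
        rw [hplug, hplug, dk_dStep hφ ((hb x).dStep.plug (hEx x)), hφ.one, one_mul]
      simp only [this]
      exact ih n _
    cases ha with
    | app hU' hV =>
      rename_i V₁ V₂
      cases hU' with
      | lam M =>
        refine det (M.inst1 V₂) fun x => ?_
        rw [Tm.at, Tm.at, Tm.map_inst1]
        exact .beta _ _ (hV.map _)
      | fix M =>
        refine det (M.inst2 V₂ (.fix M)) fun x => ?_
        rw [Tm.at, Tm.at, Tm.map_inst2]
        exact .fix _ _ (hV.map _)
      | var i => exact stuck (fun x f b h => by simp [Tm.at, Tm.map] at h; cases h) (by simp)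
      | lit c => exact stuck (fun x f b h => by simp [Tm.at, Tm.map] at h; cases h) (by simp)
    | ite hV N P =>
      cases hV with
      | lit c =>
        have : ∀ x s, dk φ U (k + 1) ((E.plug (.ite (.lit c) N P)).at x) s =
            if c.1 x ≤ 0 then dk φ U k ((E.plug N).at x) s else dk φ U k ((E.plug P).at x) s := by
          intro x s
          rw [hplug, hplug, hplug]
          split_ifs with h
          · refine (dk_dStep hφ ((DRed.iteLe (c.1 x) _ _ h).dStep.plug (hEx x)) k s).trans ?_
            rw [hφ.one, one_mul]
            rfl
          · refine (dk_dStep hφ ((DRed.iteGt (c.1 x) _ _ (not_le.1 h)).dStep.plug (hEx x)) k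
              s).trans ?_
            rw [hφ.one, one_mul]
            rfl
        simp only [this]
        exact Measurable.ite (measurableSet_le (c.2.comp measurable_fst) measurable_const)
          (ih n _) (ih n _)
      | _ => exact stuck (fun x f b h => by simp [Tm.at, Tm.map] at h; cases h) (by simp)
    | prim o args h hn =>
      by_cases hl : ∀ i, ∃ c, args i = .lit c
      · choose c hc using hl
        obtain rfl : args = fun i => .lit (c i) := funext hc
        refine det (.lit ⟨fun x => F.fn o fun i => (c i).1 x,
          (F.measurable_fn o).comp (measurable_pi_lambda _ fun i => (c i).2)⟩) fun x => ?_
        exact .prim o fun i => (c i).1 x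
      · refine stuck (fun x f b h => hl fun i => ?_) (by simp)
        simp only [Tm.at, Tm.map] at h
        generalize he : (Tm.prim o fun i => (args i).map fun f : MF X => f.1 x) = t at h
        cases h with
        | prim o' r =>
          simp only [Tm.prim.injEq] at he
          obtain ⟨rfl, he⟩ := he
          exact Tm.at_lit (congrFun (eq_of_heq he) i)
        | _ => cases he
    | score hV =>
      cases hV with
      | lit c =>
        have : ∀ x s, dk φ U (k + 1) ((E.plug (.score (.lit c))).at x) s =
            if 0 ≤ c.1 x then φ (c.1 x) * dk φ U k ((E.plug (.lit c)).at x) s else 0 := by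
          intro x s
          rw [hplug, hplug]
          split_ifs with h
          · exact dk_dStep hφ ((DRed.score (c.1 x) h).dStep.plug (hEx x)) k s
          · refine dk_stuck (stuck_plug_of_head (hEx x) (.score (.lit _)) (fun f b hb => ?_)
              (by simp)) (fun r hr => ?_) _ _
            · simp only at hb
              cases hb
              contradiction
            · exact valLike_isVal.plug (valLike_isVal.score _) (hr ▸ Tm.IsVal.lit (F := F) r)
        simp only [this]
        exact Measurable.ite (measurableSet_le measurable_const (c.2.comp measurable_fst))
          ((hφ.meas.comp (c.2.comp measurable_fst)).mul (ih n _)) measurable_const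
      | _ => exact stuck (fun x f b h => by simp [Tm.at, Tm.map] at h; cases h) (by simp)
    | sample =>
      refine measurable_ofFn_of_dk (a := fun x s => dk φ U (k + 1) ((E.plug .sample).at x) s)
        (fun _ => ?_) (fun m _ => ?_)
      · have : ∀ x, dk φ U (k + 1) ((E.plug .sample).at x) [] = 0 := fun x => by
          rw [hplug]; exact dk_sample_nil (hEx x) _
        simp only [this]
        exact measurable_const
      -- The number drawn becomes a new coordinate of the parameter, and the hole is filled with the
      -- projection onto it.
      · obtain ⟨N', this⟩ : ∃ N' : Tm F (MF (X × unitInterval)), ∀ x (r : unitInterval) s,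
            dk φ U (k + 1) ((E.plug .sample).at x) (r :: s) = dk φ U k (N'.at (x, r)) s := by
          refine ⟨(E.map (MF.comp measurable_fst)).plug
            (.lit ⟨fun p => (p.2 : ℝ), measurable_subtype_coe.comp measurable_snd⟩),
            fun x r s => ?_⟩
          rw [hplug]
          refine (dk_sample_cons (hEx x) _ _ _).trans ?_
          rw [Tm.at, ECtx.map_plug, ECtx.map_map]
          rfl
        simp only [this]
        have hm : Measurable fun p : X × (Fin (m + 1) → unitInterval) =>
            ((p.1, p.2 0), Fin.tail p.2) := by
          refine (measurable_fst.prodMk ?_).prodMk ?_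
          · exact (measurable_pi_apply 0).comp measurable_snd
          · exact measurable_pi_lambda _ fun i => (measurable_pi_apply i.succ).comp measurable_snd
        have h2 := (ih m N').comp hm
        simp only [Function.comp_def] at h2
        exact h2

/-- Constant functions as literals. -/
def MF.const (X : Type) [MeasurableSpace X] (r : ℝ) : MF X := ⟨fun _ => r, measurable_const⟩

theorem Tm.map_const_at {X : Type} [MeasurableSpace X] (N : Tm F ℝ) (x : X) :
    (N.map (MF.const X)).at x = N := by
  rw [Tm.at, Tm.map_map]
  induction N <;> simp_all [Tm.map, MF.const]

theorem ECtx.map_const_at {X : Type} [MeasurableSpace X] (E : ECtx F ℝ) (x : X) :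
    ((E.map (MF.const X)).map fun f => f.1 x) = E := by
  have h := fun N : Tm F ℝ => N.map_const_at x
  simp only [Tm.at] at h
  induction E <;> simp_all [ECtx.map]

theorem measurable_dk_const (hφ : WF φ) (hU : MeasurableSet U) (k n : ℕ) (N : Tm F ℝ) :
    Measurable fun s : Fin n → unitInterval => dk φ U k N (List.ofFn s) := by
  have h := measurable_dk hφ hU k n (N.map (MF.const Unit))
  simp only [Tm.map_const_at] at h
  have hm : Measurable fun s : Fin n → unitInterval => ((), s) :=
    measurable_const.prodMk measurable_id
  have h2 := h.comp hm
  simp only [Function.comp_def] at h2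
  exact h2

theorem measurable_dk_lit (hφ : WF φ) (hU : MeasurableSet U) (k n : ℕ) (E : ECtx F ℝ) :
    Measurable fun p : unitInterval × (Fin n → unitInterval) =>
      dk φ U k (E.plug (.lit p.1)) (List.ofFn p.2) := by
  have h := measurable_dk hφ hU k n (X := unitInterval)
    ((E.map (MF.const _)).plug (.lit ⟨_, measurable_subtype_coe⟩))
  simp only [Tm.at, ECtx.map_plug, ECtx.map_const_at] at h
  exact h

end

section

variable {F : Signature.{u}} {L L₁ : Type}
variable {φ : ℝ → ℝ≥0∞} {U : Set ℝ}

/-! ## Denotations of closed terms -/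

/-- The integral over all traces of the bounded-step evaluation. -/
def denk (φ : ℝ → ℝ≥0∞) (U : Set ℝ) (k : ℕ) (N : Tm F ℝ) : ℝ≥0∞ :=
  ∑' n, ∫⁻ s : Fin n → unitInterval, dk φ U k N (List.ofFn s)

/-- The integral over all traces of the evaluation. -/
def den (φ : ℝ → ℝ≥0∞) (U : Set ℝ) (N : Tm F ℝ) : ℝ≥0∞ := ⨆ k, denk φ U k N

/-- The probability of termination. -/
def term (N : Tm F ℝ) : ℝ≥0∞ := den (fun _ => 1) univ N

theorem denk_monotone (N : Tm F ℝ) : Monotone fun k => denk φ U k N :=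
  fun _ _ h => ENNReal.tsum_le_tsum fun _ => lintegral_mono fun _ => dk_mono h _ _

theorem denk_dStep (hφ : WF φ) (hU : MeasurableSet U) {N N' : Tm F ℝ} {f : ℝ}
    (h : DStep N f N') (k : ℕ) : denk φ U (k + 1) N = φ f * denk φ U k N' := by
  simp only [denk, dk_dStep hφ h]
  rw [← ENNReal.tsum_mul_left]
  congr 1
  funext n
  exact lintegral_const_mul _ (measurable_dk_const hφ hU k n N')

theorem denk_lit (hφ : WF φ) (k : ℕ) (r : ℝ) :
    denk φ U k (.lit r : Tm F ℝ) = U.indicator 1 r := by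
  rw [denk, tsum_eq_single 0]
  · simp only [List.ofFn_zero, dk_lit_nil hφ]
    simp
  · intro n hn
    obtain ⟨m, rfl⟩ := Nat.exists_eq_succ_of_ne_zero hn
    simp [List.ofFn_succ, dk_lit_cons]

theorem denk_stuck {N : Tm F ℝ} (hN : Stuck N) (hl : ∀ r, N ≠ .lit r) (k : ℕ) :
    denk φ U k N = 0 := by
  simp [denk, dk_stuck hN hl]

theorem denk_zero {N : Tm F ℝ} (hl : ∀ r, N ≠ .lit r) : denk φ U 0 N = 0 := by
  simp [denk, dk_zero hl]

theorem measurable_denk_lit (hφ : WF φ) (hU : MeasurableSet U) (k : ℕ) (E : ECtx F ℝ) :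
    Measurable fun r : unitInterval => denk φ U k (E.plug (.lit r)) :=
  Measurable.tsum fun n => (measurable_dk_lit hφ hU k n E).lintegral_prod_right'

theorem lintegral_fin_succ {n : ℕ} {g : unitInterval → (Fin n → unitInterval) → ℝ≥0∞}
    (hg : Measurable fun p : unitInterval × (Fin n → unitInterval) => g p.1 p.2) :
    ∫⁻ s : Fin (n + 1) → unitInterval, g (s 0) (fun i => s i.succ) =
      ∫⁻ r, ∫⁻ s, g r s := by
  have h := (volume_preserving_piFinSuccAbove (fun _ : Fin (n + 1) => unitInterval) 0)
  have h2 := h.lintegral_comp hg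
  rw [Measure.volume_eq_prod, lintegral_prod _ hg.aemeasurable] at h2
  rw [← h2]
  rfl

/-- The empty trace contributes nothing, and a trace of length `n + 1` splits into the number drawn
and a trace of length `n`, to which Tonelli's theorem applies. -/
theorem denk_sample (hφ : WF φ) (hU : MeasurableSet U) {E : ECtx F ℝ} (hE : E.Ok Tm.IsVal)
    (k : ℕ) : denk φ U (k + 1) (E.plug .sample) =
      ∫⁻ r : unitInterval, denk φ U k (E.plug (.lit r)) := by
  simp only [denk]
  rw [lintegral_tsum fun n =>
    (measurable_dk_lit hφ hU k n E).lintegral_prod_right'.aemeasurable]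
  rw [tsum_eq_zero_add' ENNReal.summable]
  simp only [List.ofFn_zero, dk_sample_nil hE, lintegral_zero, zero_add]
  congr 1
  funext n
  simp only [List.ofFn_succ, dk_sample_cons hE]
  exact lintegral_fin_succ (g := fun r s => dk φ U k (E.plug (.lit r)) (List.ofFn s))
    (measurable_dk_lit hφ hU k n E)

theorem den_eq_succ (N : Tm F ℝ) : den φ U N = ⨆ k, denk φ U (k + 1) N :=
  ((denk_monotone N).iSup_nat_add 1).symm

theorem den_dStep (hφ : WF φ) (hU : MeasurableSet U) {N N' : Tm F ℝ} {f : ℝ}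
    (h : DStep N f N') : den φ U N = φ f * den φ U N' := by
  rw [den_eq_succ, den, ENNReal.mul_iSup]
  simp only [denk_dStep hφ hU h]

theorem den_lit (hφ : WF φ) (r : ℝ) : den φ U (.lit r : Tm F ℝ) = U.indicator 1 r := by
  simp only [den, denk_lit hφ, iSup_const]

theorem den_stuck {N : Tm F ℝ} (hN : Stuck N) (hl : ∀ r, N ≠ .lit r) : den φ U N = 0 := by
  simp only [den, denk_stuck hN hl, iSup_const]

theorem measurable_den_lit (hφ : WF φ) (hU : MeasurableSet U) (E : ECtx F ℝ) :
    Measurable fun r : unitInterval => den φ U (E.plug (.lit r)) :=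
  Measurable.iSup fun k => measurable_denk_lit hφ hU k E

theorem den_sample (hφ : WF φ) (hU : MeasurableSet U) {E : ECtx F ℝ} (hE : E.Ok Tm.IsVal) :
    den φ U (E.plug .sample) = ∫⁻ r : unitInterval, den φ U (E.plug (.lit r)) := by
  rw [den_eq_succ]
  simp only [denk_sample hφ hU hE, den]
  rw [lintegral_iSup (fun k => measurable_denk_lit hφ hU k E)
    fun k l h r => denk_monotone (E.plug (.lit r)) h]

theorem plug_ne_lit {E : ECtx F ℝ} {X : Tm F ℝ} (hX : ¬ X.IsVal) (r : ℝ) : E.plug X ≠ .lit r :=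
  fun h => valLike_isVal.plug hX (h ▸ Tm.IsVal.lit (F := F) r)

theorem denk_term_le_one (k : ℕ) (N : Tm F ℝ) : denk (fun _ => 1) univ k N ≤ 1 := by
  induction k generalizing N with
  | zero =>
    by_cases hl : ∃ r, N = .lit r
    · obtain ⟨r, rfl⟩ := hl
      simp [denk_lit wf_one]
    · rw [denk_zero (by simpa using hl)]
      exact zero_le_one
  | succ k ih =>
    rcases N.step_cases with hN | ⟨f, N', hN⟩ | ⟨E, hE, rfl⟩ | ⟨h1, h2⟩
    · by_cases hl : ∃ r, N = .lit r
      · obtain ⟨r, rfl⟩ := hl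
        simp [denk_lit wf_one]
      · rw [denk_stuck (stuck_of_isVal hN) (by simpa using hl)]
        exact zero_le_one
    · rw [denk_dStep wf_one .univ hN, one_mul]
      exact ih _
    · rw [denk_sample wf_one .univ hE]
      calc _ ≤ ∫⁻ _ : unitInterval, 1 := lintegral_mono fun r => ih _
        _ = 1 := by simp
    · exact (denk_stuck (h2 .hole trivial) (plug_ne_lit (E := .hole) h1) _).trans_le zero_le_one

theorem term_le_one (N : Tm F ℝ) : term N ≤ 1 := iSup_le fun k => denk_term_le_one k N

theorem term_dStep {N N' : Tm F ℝ} {f : ℝ} (h : DStep N f N') : term N = term N' := by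
  rw [term, den_dStep wf_one .univ h, one_mul, term]

/-- A function bounded by 1 has integral 1 over a probability space only if it equals 1 almost
everywhere. This passes almost sure termination on to almost all continuations. -/
theorem ae_term_eq_one {E : ECtx F ℝ} (hE : E.Ok Tm.IsVal) (h : term (E.plug .sample) = 1) :
    ∀ᵐ r : unitInterval, term (E.plug (.lit r)) = 1 := by
  have hm := measurable_den_lit (F := F) wf_one .univ E
  rw [term, den_sample wf_one .univ hE] at h
  have h' : (∫⁻ r : unitInterval, term (E.plug (.lit r))) = 1 := h
  exact ae_eq_of_ae_le_of_lintegral_le (μ := (volume : Measure unitInterval))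
    (f := fun r => term (E.plug (.lit r))) (g := 1)
    (.of_forall fun r => term_le_one _) (by rw [h']; exact ENNReal.one_ne_top) aemeasurable_one
    (by simp [h'])

/-! ## Comparison with the trace semantics -/

theorem measurable_trace {g : Trace → ℝ≥0∞}
    (hg : ∀ n, Measurable fun s : Fin n → unitInterval => g ⟨n, s⟩) : Measurable g := by
  intro t ht
  exact MeasurableSpace.measurableSet_iInf.2 fun n => hg n ht

theorem lintegral_trace {g : Trace → ℝ≥0∞}
    (hg : ∀ n, Measurable fun s : Fin n → unitInterval => g ⟨n, s⟩) :
    ∫⁻ s, g s ∂traceMeasure = ∑' n, ∫⁻ s : Fin n → unitInterval, g ⟨n, s⟩ := by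
  rw [traceMeasure, lintegral_sum_measure]
  congr 1
  funext n
  exact lintegral_map (measurable_trace hg) fun t ht =>
    MeasurableSpace.measurableSet_iInf.1 ht n

theorem lintegral_trace_dk (hφ : WF φ) (hU : MeasurableSet U) (P : Tm F ℝ) :
    ∫⁻ s, (⨆ k, dk φ U k P (List.ofFn s.2)) ∂(traceMeasure : Measure Trace) = den φ U P := by
  have hm := fun k n => measurable_dk_const (F := F) hφ hU k n P
  rw [lintegral_trace fun n => Measurable.iSup fun k => hm k n]
  have : ∀ n, ∫⁻ s : Fin n → unitInterval, (⨆ k, dk φ U k P (List.ofFn s)) =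
      ⨆ k, ∫⁻ s : Fin n → unitInterval, dk φ U k P (List.ofFn s) := fun n =>
    lintegral_iSup (fun k => hm k n) fun k l h s => dk_mono h _ _
  simp only [this, den, denk, ENNReal.tsum_eq_iSup_sum]
  rw [iSup_comm]
  congr 1
  funext s
  rw [ENNReal.finsetSum_iSup_of_monotone]
  exact fun n k l h => lintegral_mono fun s => dk_mono h _ _

theorem mem_valuePreimage_iff {P : Tm F ℝ} {s : Trace} :
    s ∈ valuePreimage P U ↔ (⨆ k, dk (fun _ => 1) U k P (List.ofFn s.2)) ≠ 0 := by
  constructor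
  · rintro ⟨r, hr, w, h⟩
    obtain ⟨k, h⟩ := evaluates_iff.1 h
    intro h0
    have := ENNReal.iSup_eq_zero.1 h0 k
    rw [dk_eq hr h] at this
    exact one_ne_zero this
  · intro h0
    by_contra hc
    refine h0 (ENNReal.iSup_eq_zero.2 fun k => dk_eq_zero fun r hr w h => hc ?_)
    exact ⟨r, hr, w, evaluates_iff.2 ⟨k, h⟩⟩

theorem iSup_dk_of_evaluates {P : Tm F ℝ} {s : Trace} {r w : ℝ} (hr : r ∈ U)
    (h : Evaluates P s r w) : (⨆ k, dk φ U k P (List.ofFn s.2)) = φ w := by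
  obtain ⟨k, h⟩ := evaluates_iff.1 h
  refine le_antisymm (iSup_le fun l => ?_) (le_iSup_of_le k (dk_eq hr h).ge)
  rw [← dk_eq (φ := φ) hr (h.mono (le_max_left k l))]
  exact dk_mono (le_max_right k l) _ _

theorem iSup_dk_eq (P : Tm F ℝ) (s : Trace) : (⨆ k, dk φ U k P (List.ofFn s.2)) =
    (valuePreimage P U).indicator (fun s => φ (weight P s)) s := by
  by_cases h : s ∈ valuePreimage P U
  · rw [indicator_of_mem h]
    obtain ⟨r, hr, w, h⟩ := h
    have hex : ∃ w r, Evaluates P s r w := ⟨w, r, h⟩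
    rw [iSup_dk_of_evaluates hr h, weight, dif_pos hex]
    obtain ⟨r', h'⟩ := hex.choose_spec
    obtain ⟨k, h1⟩ := evaluates_iff.1 h
    obtain ⟨l, h2⟩ := evaluates_iff.1 h'
    rw [(h1.unique h2).2]
  · rw [indicator_of_notMem h]
    refine ENNReal.iSup_eq_zero.2 fun k => dk_eq_zero fun r hr w hw => h ?_
    exact ⟨r, hr, w, evaluates_iff.2 ⟨k, hw⟩⟩

theorem measurableSet_valuePreimage (hU : MeasurableSet U) (P : Tm F ℝ) :
    MeasurableSet (valuePreimage P U) := by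
  have : valuePreimage P U =
      (fun s : Trace => ⨆ k, dk (fun _ => 1) U k P (List.ofFn s.2)) ⁻¹' {0}ᶜ := by
    ext s
    exact mem_valuePreimage_iff
  rw [this]
  exact (measurable_trace fun n => Measurable.iSup fun k =>
    measurable_dk_const wf_one hU k n P) (MeasurableSet.singleton 0).compl

theorem denotation_eq_den (hU : MeasurableSet U) (P : Tm F ℝ) :
    denotation P U = den ENNReal.ofReal U P := by
  rw [denotation, ← lintegral_indicator (measurableSet_valuePreimage hU P),
    ← lintegral_trace_dk wf_ofReal hU]
  simp only [iSup_dk_eq]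

theorem AlmostSurelyTerminating.term_eq_one {P : Tm F ℝ} (h : AlmostSurelyTerminating P) :
    term P = 1 := by
  rw [term, ← lintegral_trace_dk wf_one .univ]
  simp only [iSup_dk_eq]
  rw [lintegral_indicator (measurableSet_valuePreimage .univ P)]
  simpa using (show traceMeasure (valuePreimage P univ) = 1 from h)

end

section

variable {F : Signature.{u}} {L L₁ : Type}
/-! ## Intervals -/

namespace Itv

theorem isClosed (I : Itv) : IsClosed I.carrier := by
  obtain ⟨a, b, h⟩ := I.isItv
  rw [h]
  exact isClosed_Icc.preimage continuous_coe_real_ereal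

theorem ordConnected (I : Itv) : I.carrier.OrdConnected := by
  obtain ⟨a, b, h⟩ := I.isItv
  rw [h]
  exact ⟨fun x hx y hy z hz => ⟨hx.1.trans (EReal.coe_le_coe_iff.2 hz.1),
    (EReal.coe_le_coe_iff.2 hz.2).trans hy.2⟩⟩

theorem subset_hull (A : Set ℝ) : A ⊆ (hull A).carrier :=
  fun _ hx => ⟨sInf_le (mem_image_of_mem _ hx), le_sSup (mem_image_of_mem _ hx)⟩

/-- The infimum and supremum of `A` need not be attained, so a point of the hull need not lie
between two points of `A`. But it does so up to any `e > 0`, hence has distance less than `e` from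
`B`, and `B` is closed. -/
theorem hull_subset {A B : Set ℝ} (hAB : A ⊆ B) (hc : IsClosed B) (ho : B.OrdConnected) :
    (hull A).carrier ⊆ B := by
  rintro x ⟨h1, h2⟩
  have approx : ∀ e > 0, ∃ a ∈ A, a < x + e := by
    intro e he
    by_contra! hcon
    have : ((x + e : ℝ) : EReal) ≤ sInf ((fun x : ℝ => (x : EReal)) '' A) := by
      refine le_sInf ?_
      rintro _ ⟨a, ha, rfl⟩
      exact EReal.coe_le_coe_iff.2 (hcon a ha)
    have := EReal.coe_le_coe_iff.1 (this.trans h1)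
    linarith
  have approx' : ∀ e > 0, ∃ a ∈ A, x - e < a := by
    intro e he
    by_contra! hcon
    have : sSup ((fun x : ℝ => (x : EReal)) '' A) ≤ ((x - e : ℝ) : EReal) := by
      refine sSup_le ?_
      rintro _ ⟨a, ha, rfl⟩
      exact EReal.coe_le_coe_iff.2 (hcon a ha)
    have := EReal.coe_le_coe_iff.1 (h2.trans this)
    linarith
  rw [← hc.closure_eq, Metric.mem_closure_iff]
  intro e he
  obtain ⟨a, ha, hax⟩ := approx e he
  obtain ⟨b, hb, hbx⟩ := approx' e he
  rcases le_total a x with hle | hle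
  · rcases le_total x b with hle' | hle'
    · exact ⟨x, ho.out (hAB ha) (hAB hb) ⟨hle, hle'⟩, by simpa using he⟩
    · exact ⟨b, hAB hb, by rw [Real.dist_eq, abs_lt]; constructor <;> linarith⟩
  · exact ⟨a, hAB ha, by rw [Real.dist_eq, abs_lt]; constructor <;> linarith⟩

theorem hull_le {A : Set ℝ} {I : Itv} (h : A ⊆ I.carrier) : (hull A).Le I :=
  hull_subset h I.isClosed I.ordConnected

/-- For `w ≥ 0` the set of `t` with `w * t ∈ I` is closed and order connected, so `hull_subset`
applies to it. This lets a scored factor pass through the interval products in the typing rules. -/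
theorem hull_scale {A : Set ℝ} {I : Itv} {w : ℝ} (hw : 0 ≤ w) (h : ∀ t ∈ A, w * t ∈ I.carrier) :
    ∀ t ∈ (hull A).carrier, w * t ∈ I.carrier := by
  refine hull_subset (B := (fun t => w * t) ⁻¹' I.carrier) h
    (I.isClosed.preimage (continuous_const_mul w)) ?_
  exact ⟨fun x hx y hy z hz => I.ordConnected.out hx hy
    ⟨mul_le_mul_of_nonneg_left hz.1 hw, mul_le_mul_of_nonneg_left hz.2 hw⟩⟩

theorem mem_point {x r : ℝ} : x ∈ (point r).carrier ↔ x = r := by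
  simp only [point, mk2, mem_ofPred_eq, EReal.coe_le_coe_iff]
  exact ⟨fun h => le_antisymm h.2 h.1, fun h => ⟨h.ge, h.le⟩⟩

theorem mem_one {x : ℝ} : x ∈ one.carrier ↔ x = 1 := mem_point

theorem one_mem_one : (1 : ℝ) ∈ one.carrier := mem_one.2 rfl

theorem Le.refl (I : Itv) : I.Le I := Subset.refl _

theorem one_le {I : Itv} (h : (1 : ℝ) ∈ I.carrier) : one.Le I := by
  intro x hx
  rwa [mem_one.1 hx]

theorem mem_mk2_top {x : ℝ} : x ∈ (mk2 0 ⊤).carrier ↔ 0 ≤ x := by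
  simp [mk2]

theorem mem_unit {x : ℝ} : x ∈ (mk2 0 1).carrier ↔ 0 ≤ x ∧ x ≤ 1 := by
  simp only [mk2, mem_ofPred_eq]
  norm_cast

theorem mul_mem {I J : Itv} {x y : ℝ} (hx : x ∈ I.carrier) (hy : y ∈ J.carrier) :
    x * y ∈ (I.mul J).carrier :=
  subset_hull _ ⟨x, hx, y, hy, rfl⟩

theorem mul_scale_left {I I' J : Itv} {w : ℝ} (hw : 0 ≤ w)
    (h : ∀ t ∈ I'.carrier, w * t ∈ I.carrier) :
    ∀ t ∈ (I'.mul J).carrier, w * t ∈ (I.mul J).carrier := by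
  refine hull_scale hw ?_
  rintro _ ⟨x, hx, y, hy, rfl⟩
  rw [← mul_assoc]
  exact mul_mem (h x hx) hy

theorem mul_scale_right {I J J' : Itv} {w : ℝ} (hw : 0 ≤ w)
    (h : ∀ t ∈ J'.carrier, w * t ∈ J.carrier) :
    ∀ t ∈ (I.mul J').carrier, w * t ∈ (I.mul J).carrier := by
  refine hull_scale hw ?_
  rintro _ ⟨x, hx, y, hy, rfl⟩
  rw [mul_left_comm]
  exact mul_mem hx (h y hy)

theorem lift_mem {n : ℕ} {f : (Fin n → ℝ) → ℝ} {I : Fin n → Itv} {x : Fin n → ℝ}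
    (h : ∀ i, x i ∈ (I i).carrier) : f x ∈ (lift f I).carrier :=
  subset_hull _ ⟨x, h, rfl⟩

theorem one_mem_prod {n : ℕ} {J : Fin n → Itv} (h : ∀ i, (1 : ℝ) ∈ (J i).carrier) :
    (1 : ℝ) ∈ (prod J).carrier := by
  have := lift_mem (f := fun x : Fin n → ℝ => ∏ i, x i) (x := fun _ => 1) h
  simp only [Finset.prod_const_one] at this
  exact this

theorem prod_scale {n : ℕ} {J : Fin n → Itv} {i : Fin n} {J' : Itv} {w : ℝ} (hw : 0 ≤ w)
    (h : ∀ t ∈ J'.carrier, w * t ∈ (J i).carrier) :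
    ∀ t ∈ (prod (Function.update J i J')).carrier, w * t ∈ (prod J).carrier := by
  refine hull_scale hw ?_
  rintro _ ⟨x, hx, rfl⟩
  -- The factor `w` is absorbed by the `i`-th coordinate, the only one whose interval changes.
  have h1 : w * ∏ j, x j = ∏ j, Function.update x i (w * x i) j := by
    rw [← Finset.mul_prod_erase _ _ (Finset.mem_univ i), ← Finset.mul_prod_erase _ _
      (Finset.mem_univ i), Function.update_self, mul_assoc]
    congr 2
    exact Finset.prod_congr rfl fun j hj => by
      rw [Function.update_of_ne (Finset.ne_of_mem_erase hj)]
  rw [h1]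
  refine lift_mem (f := fun x : Fin n → ℝ => ∏ i, x i) fun j => ?_
  by_cases hj : j = i
  · subst hj
    have := hx j
    rw [Function.update_self] at this ⊢
    exact h _ this
  · have := hx j
    rwa [Function.update_of_ne hj] at this ⊢

theorem one_mul_one_mul_le (K : Itv) : ((one.mul one).mul K).Le K := by
  refine hull_le ?_
  rintro _ ⟨x, hx, y, hy, rfl⟩
  have : x ∈ one.carrier := by
    refine hull_le ?_ hx
    rintro _ ⟨a, ha, b, hb, rfl⟩
    rw [mem_one.1 ha, mem_one.1 hb, mul_one]
    exact one_mem_one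
  rwa [mem_one.1 this, one_mul]

end Itv

theorem SubTy.refl (σ : ITy) : SubTy σ σ := by
  induction σ with
  | base I => exact .base (Itv.Le.refl I)
  | arr σ τ J h1 h2 => exact .arr h1 h2 (Itv.Le.refl J)

theorem SubTy.trans {σ₁ σ₂ σ₃ : ITy} (h : SubTy σ₁ σ₂) (h' : SubTy σ₂ σ₃) : SubTy σ₁ σ₃ := by
  induction σ₂ generalizing σ₁ σ₃ with
  | base I =>
    cases h with | base h => cases h' with | base h' => exact .base (h.trans h')
  | arr σ τ J ih1 ih2 =>
    cases h with
    | arr a b c => cases h' with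
      | arr a' b' c' => exact .arr (ih1 a' a) (ih2 b b') (c.trans c')

/-! ## Interval typing of concrete terms -/

/-- Interval typing of concrete terms. -/
inductive CTy : List ITy → Tm F ℝ → ITy → Itv → Prop
  | var {Γ : List ITy} {i : ℕ} {σ : ITy} (h : Γ[i]? = some σ) : CTy Γ (.var i) σ .one
  | sub {Γ : List ITy} {M : Tm F ℝ} {σ τ : ITy} {I J : Itv} (h : CTy Γ M σ I)
      (hσ : SubTy σ τ) (hI : I.Le J) : CTy Γ M τ J
  | lit {Γ : List ITy} {r : ℝ} {I : Itv} (h : r ∈ I.carrier) : CTy Γ (.lit r) (.base I) .one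
  | lam {Γ : List ITy} {M : Tm F ℝ} {σ τ : ITy} {J : Itv} (h : CTy (σ :: Γ) M τ J) :
      CTy Γ (.lam M) (.arr σ τ J) .one
  | fix {Γ : List ITy} {M : Tm F ℝ} {σ τ : ITy} {J : Itv}
      (h : CTy (σ :: .arr σ τ J :: Γ) M τ J) : CTy Γ (.fix M) (.arr σ τ J) .one
  | app {Γ : List ITy} {M N : Tm F ℝ} {σ τ : ITy} {I J K : Itv}
      (hM : CTy Γ M (.arr σ τ K) I) (hN : CTy Γ N σ J) :
      CTy Γ (.app M N) τ ((I.mul J).mul K)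
  | ite {Γ : List ITy} {M N P : Tm F ℝ} {A I J : Itv} {σ : ITy}
      (hM : CTy Γ M (.base A) I) (hN : CTy Γ N σ J) (hP : CTy Γ P σ J) :
      CTy Γ (.ite M N P) σ (I.mul J)
  | prim {Γ : List ITy} (o : F.Op) (args : Fin (F.arity o) → Tm F ℝ)
      (I J : Fin (F.arity o) → Itv) (h : ∀ i, CTy Γ (args i) (.base (I i)) (J i)) :
      CTy Γ (.prim o args) (.base (Itv.lift (F.fn o) I)) (Itv.prod J)
  | sample {Γ : List ITy} : CTy Γ .sample (.base (.mk2 0 1)) .one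
  | score {Γ : List ITy} {M : Tm F ℝ} {I J : Itv} (h : CTy Γ M (.base I) J) :
      CTy Γ (.score M) (.base (I.meet (.mk2 0 ⊤))) (J.mul (I.meet (.mk2 0 ⊤)))

/-- `ρ` is a renaming from `Γ` to `Γ'`. -/
def RenOk (Γ Γ' : List ITy) (ρ : ℕ → ℕ) : Prop :=
  ∀ i τ, Γ[i]? = some τ → Γ'[ρ i]? = some τ

theorem RenOk.up {Γ Γ' : List ITy} {ρ : ℕ → ℕ} (h : RenOk Γ Γ' ρ) (σ : ITy) :
    RenOk (σ :: Γ) (σ :: Γ') (Tm.upRen ρ) := by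
  intro i τ hi
  cases i with
  | zero => simpa [Tm.upRen] using hi
  | succ i => simpa [Tm.upRen] using h i τ (by simpa using hi)

theorem RenOk.succ (Γ : List ITy) (σ : ITy) : RenOk Γ (σ :: Γ) Nat.succ := by
  intro i τ hi
  simpa using hi

theorem CTy.rename {Γ Γ' : List ITy} {M : Tm F ℝ} {σ : ITy} {J : Itv} {ρ : ℕ → ℕ}
    (h : CTy Γ M σ J) (hρ : RenOk Γ Γ' ρ) : CTy Γ' (M.rename ρ) σ J := by
  induction h generalizing Γ' ρ with
  | var h => exact .var (hρ _ _ h)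
  | sub _ hσ hI ih => exact .sub (ih hρ) hσ hI
  | lit h => exact .lit h
  | lam _ ih => exact .lam (ih (hρ.up _))
  | fix _ ih => exact .fix (ih ((hρ.up _).up _))
  | app _ _ ih1 ih2 => exact .app (ih1 hρ) (ih2 hρ)
  | ite _ _ _ ih1 ih2 ih3 => exact .ite (ih1 hρ) (ih2 hρ) (ih3 hρ)
  | prim o args I J _ ih => exact .prim o _ I J fun i => ih i hρ
  | sample => exact .sample
  | score _ ih => exact .score (ih hρ)

/-- `θ` is a well-typed substitution from `Γ` to `Γ'`. -/
def SubstOk (Γ Γ' : List ITy) (θ : ℕ → Tm F ℝ) : Prop :=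
  ∀ i τ, Γ[i]? = some τ → CTy Γ' (θ i) τ .one

theorem SubstOk.up {Γ Γ' : List ITy} {θ : ℕ → Tm F ℝ} (h : SubstOk Γ Γ' θ) (σ : ITy) :
    SubstOk (σ :: Γ) (σ :: Γ') (Tm.upSubst θ) := by
  intro i τ hi
  cases i with
  | zero => exact .var (by simpa using hi)
  | succ i => exact (h i τ (by simpa using hi)).rename (.succ _ _)

theorem CTy.subst {Γ Γ' : List ITy} {M : Tm F ℝ} {σ : ITy} {J : Itv} {θ : ℕ → Tm F ℝ}
    (h : CTy Γ M σ J) (hθ : SubstOk Γ Γ' θ) : CTy Γ' (M.subst θ) σ J := by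
  induction h generalizing Γ' θ with
  | var h => exact hθ _ _ h
  | sub _ hσ hI ih => exact .sub (ih hθ) hσ hI
  | lit h => exact .lit h
  | lam _ ih => exact .lam (ih (hθ.up _))
  | fix _ ih => exact .fix (ih ((hθ.up _).up _))
  | app _ _ ih1 ih2 => exact .app (ih1 hθ) (ih2 hθ)
  | ite _ _ _ ih1 ih2 ih3 => exact .ite (ih1 hθ) (ih2 hθ) (ih3 hθ)
  | prim o args I J _ ih => exact .prim o _ I J fun i => ih i hθ
  | sample => exact .sample
  | score _ ih => exact .score (ih hθ)

theorem CTy.inst1 {Γ : List ITy} {M V : Tm F ℝ} {σ τ : ITy} {J : Itv}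
    (h : CTy (σ :: Γ) M τ J) (hV : CTy Γ V σ .one) : CTy Γ (M.inst1 V) τ J := by
  refine h.subst fun i τ hi => ?_
  rcases i with _ | i
  · simp only [List.getElem?_cons_zero, Option.some.injEq] at hi
    exact hi ▸ hV
  · exact .var (by simpa using hi)

theorem CTy.inst2 {Γ : List ITy} {M V W : Tm F ℝ} {σ σ' τ : ITy} {J : Itv}
    (h : CTy (σ :: σ' :: Γ) M τ J) (hV : CTy Γ V σ .one) (hW : CTy Γ W σ' .one) :
    CTy Γ (M.inst2 V W) τ J := by
  refine h.subst fun i τ hi => ?_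
  rcases i with _ | _ | i
  · simp only [List.getElem?_cons_zero, Option.some.injEq] at hi
    exact hi ▸ hV
  · simp only [zero_add, List.getElem?_cons_succ, List.getElem?_cons_zero,
      Option.some.injEq] at hi
    exact hi ▸ hW
  · exact .var (by simpa using hi)

/-- Values score nothing, so their weight bound is `[1, 1]` up to subsumption. -/
theorem CTy.val {Γ : List ITy} {V : Tm F ℝ} {σ : ITy} {J : Itv} (h : CTy Γ V σ J)
    (hV : V.IsVal) : (1 : ℝ) ∈ J.carrier ∧ CTy Γ V σ .one := by
  induction h with
  | var h => exact ⟨Itv.one_mem_one, .var h⟩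
  | sub _ hσ hI ih => exact ⟨hI (ih hV).1, .sub (ih hV).2 hσ (Itv.Le.refl _)⟩
  | lit h => exact ⟨Itv.one_mem_one, .lit h⟩
  | lam h => exact ⟨Itv.one_mem_one, .lam h⟩
  | fix h => exact ⟨Itv.one_mem_one, .fix h⟩
  | _ => cases hV

theorem CTy.lit_inv {Γ : List ITy} {r : ℝ} {σ : ITy} {J : Itv}
    (h : CTy Γ (.lit r : Tm F ℝ) σ J) : ∃ I, σ = .base I ∧ r ∈ I.carrier := by
  generalize hM : (Tm.lit r : Tm F ℝ) = M at h
  induction h with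
  | sub _ hσ _ ih =>
    obtain ⟨I, rfl, h⟩ := ih hM
    cases hσ with
    | base h' => exact ⟨_, rfl, h' h⟩
  | lit h => cases hM; exact ⟨_, rfl, h⟩
  | _ => cases hM

theorem CTy.lam_inv {Γ : List ITy} {M : Tm F ℝ} {σ τ : ITy} {K J : Itv}
    (h : CTy Γ (.lam M) (.arr σ τ K) J) :
    ∃ σ' τ' K', SubTy σ σ' ∧ SubTy τ' τ ∧ K'.Le K ∧ CTy (σ' :: Γ) M τ' K' := by
  generalize hM : Tm.lam M = M' at h
  generalize hA : ITy.arr σ τ K = A at h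
  induction h generalizing σ τ K with
  | sub _ hσ _ ih =>
    subst hA
    cases hσ with
    | arr a b c =>
      obtain ⟨σ', τ', K', h1, h2, h3, h4⟩ := ih hM rfl
      exact ⟨σ', τ', K', a.trans h1, h2.trans b, h3.trans c, h4⟩
  | lam h => cases hM; cases hA; exact ⟨_, _, _, .refl _, .refl _, .refl _, h⟩
  | _ => cases hM

theorem CTy.fix_inv {Γ : List ITy} {M : Tm F ℝ} {σ τ : ITy} {K J : Itv}
    (h : CTy Γ (.fix M) (.arr σ τ K) J) :
    ∃ σ' τ' K', SubTy σ σ' ∧ SubTy τ' τ ∧ K'.Le K ∧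
      CTy (σ' :: .arr σ' τ' K' :: Γ) M τ' K' := by
  generalize hM : Tm.fix M = M' at h
  generalize hA : ITy.arr σ τ K = A at h
  induction h generalizing σ τ K with
  | sub _ hσ _ ih =>
    subst hA
    cases hσ with
    | arr a b c =>
      obtain ⟨σ', τ', K', h1, h2, h3, h4⟩ := ih hM rfl
      exact ⟨σ', τ', K', a.trans h1, h2.trans b, h3.trans c, h4⟩
  | fix h => cases hM; cases hA; exact ⟨_, _, _, .refl _, .refl _, .refl _, h⟩
  | _ => cases hM

/-- Redexes with the factor on the weight; `sample` may give any number in `[0, 1]`. -/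
def TRed (a : Tm F ℝ) (f : ℝ) (b : Tm F ℝ) : Prop :=
  DRed a f b ∨ ∃ r : unitInterval, a = .sample ∧ f = 1 ∧ b = .lit r

theorem TRed.nonneg {a b : Tm F ℝ} {f : ℝ} (h : TRed a f b) : 0 ≤ f := by
  rcases h with h | ⟨r, -, rfl, -⟩
  · exact h.nonneg
  · exact zero_le_one

theorem TRed.not_val {a b : Tm F ℝ} {f : ℝ} (h : TRed a f b) : ¬ a.IsVal := by
  rcases h with h | ⟨r, rfl, -, -⟩
  · exact h.head.not_val valLike_isVal
  · exact valLike_isVal.sample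

/-- Subject reduction for the interval type system. -/
theorem CTy.step {X : Tm F ℝ} {τ : ITy} {J : Itv} (h : CTy [] X τ J) {E : ECtx F ℝ}
    {a b : Tm F ℝ} {f : ℝ} (hX : X = E.plug a) (hr : TRed a f b) :
    -- `J'` bounds the weight of the rest of the run; multiplied by the factor `f` of this step, it
    -- must still fall within the bound `J` of the whole run.
    ∃ J', CTy [] (E.plug b) τ J' ∧ ∀ t ∈ J'.carrier, f * t ∈ J.carrier := by
  generalize hΓ : ([] : List ITy) = Γ at h
  have val_absurd : ∀ {V : Tm F ℝ} {E : ECtx F ℝ}, V.IsVal → V = E.plug a → False :=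
    fun hV he => valLike_isVal.plug hr.not_val (he ▸ hV)
  induction h generalizing E with
  | var => exact (val_absurd (.var _) hX).elim
  | lit => exact (val_absurd (.lit _) hX).elim
  | lam => exact (val_absurd (.lam _) hX).elim
  | fix => exact (val_absurd (.fix _) hX).elim
  | sub _ hσ hI ih =>
    obtain ⟨J', h1, h2⟩ := ih hX hΓ
    exact ⟨J', .sub h1 hσ (.refl _), fun t ht => hI (h2 t ht)⟩
  | @app Γ M N σ τ I J K hM hN ihM ihN =>
    subst hΓ
    cases E with
    | hole =>
      obtain rfl : a = .app M N := hX.symm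
      rcases hr with hr | ⟨r, h, -⟩
      · cases hr with
        | beta M N hV =>
          obtain ⟨σ', τ', K', h1, h2, h3, h4⟩ := hM.lam_inv
          obtain ⟨hJ, hN'⟩ := hN.val hV
          -- Function and argument are values, so their bounds contain 1, and `K` lies in the
          -- product of the three bounds.
          refine ⟨K, .sub (h4.inst1 (.sub hN' h1 (.refl _))) h2 h3, fun t ht => ?_⟩
          have := Itv.mul_mem (Itv.mul_mem (hM.val (.lam _)).1 hJ) ht
          rwa [one_mul] at this
        | fix M N hV =>
          obtain ⟨σ', τ', K', h1, h2, h3, h4⟩ := hM.fix_inv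
          obtain ⟨hJ, hN'⟩ := hN.val hV
          refine ⟨K, .sub (h4.inst2 (.sub hN' h1 (.refl _)) (.fix h4)) h2 h3, fun t ht => ?_⟩
          have := Itv.mul_mem (Itv.mul_mem (hM.val (.fix _)).1 hJ) ht
          rwa [one_mul] at this
      · cases h
    | appL E N' =>
      simp only [ECtx.plug, Tm.app.injEq] at hX
      obtain ⟨J', h1, h2⟩ := ihM hX.1 rfl
      exact ⟨_, .app h1 (hX.2 ▸ hN),
        Itv.mul_scale_left hr.nonneg (Itv.mul_scale_left hr.nonneg h2)⟩
    | appR V E =>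
      simp only [ECtx.plug, Tm.app.injEq] at hX
      obtain ⟨J', h1, h2⟩ := ihN hX.2 rfl
      exact ⟨_, .app (hX.1 ▸ hM) h1,
        Itv.mul_scale_left hr.nonneg (Itv.mul_scale_right hr.nonneg h2)⟩
    | _ => simp [ECtx.plug] at hX
  | @ite Γ M N P A I J σ hM hN hP ihM =>
    subst hΓ
    cases E with
    | hole =>
      obtain rfl : a = .ite M N P := hX.symm
      have key : ∀ t ∈ J.carrier, M.IsVal → 1 * t ∈ (I.mul J).carrier := fun t ht hv =>
        Itv.mul_mem (hM.val hv).1 ht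
      rcases hr with hr | ⟨r, h, -⟩
      · cases hr with
        | iteLe r => exact ⟨J, hN, fun t ht => key t ht (.lit _)⟩
        | iteGt r => exact ⟨J, hP, fun t ht => key t ht (.lit _)⟩
      · cases h
    | ite E N' P' =>
      simp only [ECtx.plug, Tm.ite.injEq] at hX
      obtain ⟨J', h1, h2⟩ := ihM hX.1 rfl
      exact ⟨_, .ite h1 (hX.2.1 ▸ hN) (hX.2.2 ▸ hP), Itv.mul_scale_left hr.nonneg h2⟩
    | _ => simp [ECtx.plug] at hX
  | sample =>
    cases E with
    | hole =>
      obtain rfl : a = .sample := hX.symm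
      rcases hr with hr | ⟨r, -, rfl, rfl⟩
      · cases hr
      · refine ⟨.one, .lit (Itv.mem_unit.2 r.2), fun t ht => by rwa [one_mul]⟩
    | _ => simp [ECtx.plug] at hX
  | @score Γ M I J hM ihM =>
    subst hΓ
    cases E with
    | hole =>
      obtain rfl : a = .score M := hX.symm
      rcases hr with hr | ⟨r, h, -⟩
      · cases hr with
        | score _ hr =>
          obtain ⟨I', h1, h2⟩ := hM.lit_inv
          cases h1
          have hm : f ∈ (I.meet (.mk2 0 ⊤)).carrier := ⟨h2, Itv.mem_mk2_top.2 hr⟩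
          refine ⟨.one, .lit hm, fun t ht => ?_⟩
          rw [Itv.mem_one.1 ht, mul_comm]
          exact Itv.mul_mem (hM.val (.lit _)).1 hm
      · cases h
    | score E =>
      simp only [ECtx.plug, Tm.score.injEq] at hX
      obtain ⟨J', h1, h2⟩ := ihM hX rfl
      exact ⟨_, .score h1, Itv.mul_scale_left hr.nonneg h2⟩
    | _ => simp [ECtx.plug] at hX
  | @prim Γ o args I J h ih =>
    subst hΓ
    cases E with
    | hole =>
      obtain rfl : a = .prim o args := hX.symm
      rcases hr with hr | ⟨r, h, -⟩
      · generalize ha : Tm.prim o args = a at hr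
        cases hr with
        | prim o' r =>
          simp only [Tm.prim.injEq] at ha
          obtain ⟨rfl, ha⟩ := ha
          obtain rfl := eq_of_heq ha
          refine ⟨.one, .lit (Itv.lift_mem fun i => ?_), fun t ht => ?_⟩
          · obtain ⟨I', h1, h2⟩ := (h i).lit_inv
            cases h1
            exact h2
          · rw [Itv.mem_one.1 ht, one_mul]
            exact Itv.one_mem_prod fun i => ((h i).val (.lit _)).1
        | _ => cases ha
      · cases h
    | prim o' args' i E =>
      simp only [ECtx.plug, Tm.prim.injEq] at hX
      obtain ⟨rfl, hX⟩ := hX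
      obtain rfl := eq_of_heq hX
      obtain ⟨J', h1, h2⟩ := ih i (E := E) (Function.update_self ..) rfl
      refine ⟨_, .prim o _ I (Function.update J i J') fun j => ?_, Itv.prod_scale hr.nonneg h2⟩
      by_cases hj : j = i
      · subst hj
        simpa using h1
      · have := h j
        simpa [Function.update_of_ne hj] using this
    | _ => simp [ECtx.plug] at hX

/-! ## Evaluation of a typed term in a context -/

section Call

variable {U : Set ℝ} {E : ECtx F ℝ} {τ : ITy} {J : Itv}

/-- Upper bound on the denotation of a context around a typed term. -/
theorem denk_plug_le (hU : MeasurableSet U) (hE : E.Ok Tm.IsVal) {C : ℝ≥0∞}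
    (hC : ∀ V : Tm F ℝ, V.IsVal → CTy [] V τ .one → den .ofReal U (E.plug V) ≤ C)
    (k : ℕ) {X : Tm F ℝ} {J' : Itv} {w : ℝ} (hX : CTy [] X τ J') (hw : 0 ≤ w)
    (hJ : ∀ t ∈ J'.carrier, w * t ∈ J.carrier) :
    ENNReal.ofReal w * denk .ofReal U k (E.plug X) ≤
      (⨆ t ∈ J.carrier, ENNReal.ofReal t) * C := by
  -- Here `w` is the weight accumulated so far. The inclusion of `w * J'` in `J` survives every step
  -- by `CTy.step`; at a value `1 ∈ J'`, so that `w ∈ J`.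
  have val_case : ∀ k {X : Tm F ℝ} {J' : Itv} {w : ℝ}, X.IsVal → CTy [] X τ J' →
      (∀ t ∈ J'.carrier, w * t ∈ J.carrier) →
      ENNReal.ofReal w * denk .ofReal U k (E.plug X) ≤
        (⨆ t ∈ J.carrier, ENNReal.ofReal t) * C := by
    intro k X J' w hv hX hJ
    obtain ⟨h1, h2⟩ := hX.val hv
    have := hJ 1 h1
    rw [mul_one] at this
    exact mul_le_mul' (le_iSup₂_of_le w this le_rfl)
      ((le_iSup (fun k => denk .ofReal U k (E.plug X)) k).trans (hC X hv h2))
  induction k generalizing X J' w with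
  | zero =>
    by_cases hv : X.IsVal
    · exact val_case 0 hv hX hJ
    · rw [denk_zero (plug_ne_lit hv), mul_zero]
      exact zero_le
  | succ k ih =>
    rcases X.step_cases with hv | ⟨f, X', hs⟩ | ⟨E', hE', rfl⟩ | ⟨h1, h2⟩
    · exact val_case _ hv hX hJ
    · rw [denk_dStep wf_ofReal hU (hs.plug hE), ← mul_assoc, ← ENNReal.ofReal_mul hw]
      have hf := hs.nonneg
      obtain ⟨E', a, b, -, hr, rfl, rfl⟩ := hs
      obtain ⟨J'', h1, h2⟩ := hX.step rfl (.inl hr)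
      refine ih h1 (mul_nonneg hw hf) fun t ht => ?_
      rw [mul_assoc]
      exact hJ _ (h2 t ht)
    · rw [← ECtx.plug_comp, denk_sample wf_ofReal hU (hE.comp hE'),
        ← lintegral_const_mul _ (measurable_denk_lit wf_ofReal hU k _)]
      refine (lintegral_mono (g := fun _ => (⨆ t ∈ J.carrier, ENNReal.ofReal t) * C)
        fun r => ?_).trans_eq (by simp)
      obtain ⟨J'', h1, h2⟩ := hX.step rfl (.inr ⟨r, rfl, rfl, rfl⟩)
      rw [ECtx.plug_comp]
      exact ih h1 hw fun t ht => hJ _ (by simpa using h2 t ht)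
    · rw [denk_stuck (h2 E hE) (plug_ne_lit h1), mul_zero]
      exact zero_le

theorem den_plug_le (hU : MeasurableSet U) (hE : E.Ok Tm.IsVal) {C : ℝ≥0∞}
    (hC : ∀ V : Tm F ℝ, V.IsVal → CTy [] V τ .one → den .ofReal U (E.plug V) ≤ C)
    {X : Tm F ℝ} (hX : CTy [] X τ J) :
    den .ofReal U (E.plug X) ≤ (⨆ t ∈ J.carrier, ENNReal.ofReal t) * C :=
  iSup_le fun k => by
    simpa using denk_plug_le hU hE hC k hX zero_le_one (J := J) (by simp)

/-- Lower bound on the denotation of a context around a typed term. -/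
theorem le_denk_plug (hU : MeasurableSet U) (hE : E.Ok Tm.IsVal) {c : ℝ≥0∞}
    (hc : ∀ V : Tm F ℝ, V.IsVal → CTy [] V τ .one → term (E.plug V) = 1 →
      c ≤ den .ofReal U (E.plug V))
    (k : ℕ) {X : Tm F ℝ} {J' : Itv} {w : ℝ} (hX : CTy [] X τ J') (ht : term (E.plug X) = 1)
    (hw : 0 ≤ w) (hJ : ∀ t ∈ J'.carrier, w * t ∈ J.carrier) :
    (⨅ t ∈ J.carrier, ENNReal.ofReal t) * c * denk (fun _ => 1) univ k (E.plug X) ≤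
      ENNReal.ofReal w * den .ofReal U (E.plug X) := by
  have val_case : ∀ k {X : Tm F ℝ} {J' : Itv} {w : ℝ}, X.IsVal → CTy [] X τ J' →
      term (E.plug X) = 1 → (∀ t ∈ J'.carrier, w * t ∈ J.carrier) →
      (⨅ t ∈ J.carrier, ENNReal.ofReal t) * c * denk (fun _ => 1) univ k (E.plug X) ≤
        ENNReal.ofReal w * den .ofReal U (E.plug X) := by
    intro k X J' w hv hX ht hJ
    obtain ⟨h1, h2⟩ := hX.val hv
    have := hJ 1 h1
    rw [mul_one] at this
    calc _ ≤ (⨅ t ∈ J.carrier, ENNReal.ofReal t) * c * 1 := by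
          gcongr
          exact denk_term_le_one k _
      _ ≤ _ := by
          rw [mul_one]
          exact mul_le_mul' (iInf₂_le w this) (hc X hv h2 ht)
  -- The left side carries the probability of termination within `k` steps. It vanishes for stuck
  -- and for unfinished runs, which makes these cases trivial, and its supremum over `k` is 1.
  induction k generalizing X J' w with
  | zero =>
    by_cases hv : X.IsVal
    · exact val_case 0 hv hX ht hJ
    · rw [denk_zero (plug_ne_lit hv), mul_zero]
      exact zero_le
  | succ k ih =>
    rcases X.step_cases with hv | ⟨f, X', hs⟩ | ⟨E', hE', rfl⟩ | ⟨h1, h2⟩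
    · exact val_case _ hv hX ht hJ
    · rw [denk_dStep wf_one .univ (hs.plug hE), one_mul, den_dStep wf_ofReal hU (hs.plug hE),
        ← mul_assoc, ← ENNReal.ofReal_mul hw]
      have hf := hs.nonneg
      rw [term_dStep (hs.plug hE)] at ht
      obtain ⟨E', a, b, -, hr, rfl, rfl⟩ := hs
      obtain ⟨J'', h1, h2⟩ := hX.step rfl (.inl hr)
      refine ih h1 ht (mul_nonneg hw hf) fun t ht => ?_
      rw [mul_assoc]
      exact hJ _ (h2 t ht)
    · rw [← ECtx.plug_comp] at ht ⊢
      rw [denk_sample wf_one .univ (hE.comp hE'), den_sample wf_ofReal hU (hE.comp hE'),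
        ← lintegral_const_mul _ (measurable_den_lit wf_ofReal hU _),
        ← lintegral_const_mul _ (measurable_denk_lit wf_one .univ _ _)]
      refine lintegral_mono_ae ?_
      filter_upwards [ae_term_eq_one (hE.comp hE') ht] with r hr
      obtain ⟨J'', h1, h2⟩ := hX.step rfl (.inr ⟨r, rfl, rfl, rfl⟩)
      rw [ECtx.plug_comp] at hr ⊢
      exact ih h1 hr hw fun t ht => hJ _ (by simpa using h2 t ht)
    · rw [denk_stuck (h2 E hE) (plug_ne_lit h1), mul_zero]
      exact zero_le

theorem le_den_plug (hU : MeasurableSet U) (hE : E.Ok Tm.IsVal) {c : ℝ≥0∞}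
    (hc : ∀ V : Tm F ℝ, V.IsVal → CTy [] V τ .one → term (E.plug V) = 1 →
      c ≤ den .ofReal U (E.plug V))
    {X : Tm F ℝ} (hX : CTy [] X τ J) (ht : term (E.plug X) = 1) :
    (⨅ t ∈ J.carrier, ENNReal.ofReal t) * c ≤ den .ofReal U (E.plug X) := by
  have h : ∀ k, (⨅ t ∈ J.carrier, ENNReal.ofReal t) * c *
      denk (fun _ => 1) univ k (E.plug X) ≤ den .ofReal U (E.plug X) := fun k => by
    simpa using le_denk_plug hU hE hc k hX ht zero_le_one (J := J) (by simp)
  have h2 := iSup_le h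
  rw [← ENNReal.mul_iSup] at h2
  rwa [show (⨆ k, denk (fun _ => 1) univ k (E.plug X)) = 1 from ht, mul_one] at h2

/-- The weight bound of a term that may terminate is not empty. -/
theorem CTy.nonempty_of_denk (hE : E.Ok Tm.IsVal) (k : ℕ) {X : Tm F ℝ} (hX : CTy [] X τ J)
    (hk : denk (fun _ => 1) univ k (E.plug X) ≠ 0) : J.carrier.Nonempty := by
  induction k generalizing X J with
  | zero =>
    by_cases hv : X.IsVal
    · exact ⟨1, (hX.val hv).1⟩
    · exact absurd (denk_zero (plug_ne_lit hv)) hk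
  | succ k ih =>
    rcases X.step_cases with hv | ⟨f, X', hs⟩ | ⟨E', hE', rfl⟩ | ⟨h1, h2⟩
    · exact ⟨1, (hX.val hv).1⟩
    · rw [denk_dStep wf_one .univ (hs.plug hE), one_mul] at hk
      obtain ⟨E', a, b, -, hr, rfl, rfl⟩ := hs
      obtain ⟨J'', h1, h2⟩ := hX.step rfl (.inl hr)
      obtain ⟨t, ht⟩ := ih h1 hk
      exact ⟨_, h2 t ht⟩
    · rw [← ECtx.plug_comp, denk_sample wf_one .univ (hE.comp hE')] at hk
      by_contra hJ
      refine hk ((lintegral_congr fun r => ?_).trans lintegral_zero)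
      obtain ⟨J'', h1, h2⟩ := hX.step rfl (.inr ⟨r, rfl, rfl, rfl⟩)
      rw [ECtx.plug_comp]
      by_contra hr
      obtain ⟨t, ht⟩ := ih h1 hr
      exact hJ ⟨_, h2 t ht⟩
    · exact absurd (denk_stuck (h2 E hE) (plug_ne_lit h1) _) hk

/-- A run of `X` that reaches a value has a weight in `J`. The lower bounds use this to rule out an
infinite infimum over an empty `J`. -/
theorem CTy.nonempty (hE : E.Ok Tm.IsVal) {X : Tm F ℝ} (hX : CTy [] X τ J)
    (ht : term (E.plug X) = 1) : J.carrier.Nonempty := by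
  by_contra hJ
  have : term (E.plug X) = 0 := ENNReal.iSup_eq_zero.2 fun k => by
    by_contra hk
    exact hJ (hX.nonempty_of_denk hE k hk)
  rw [this] at ht
  exact zero_ne_one ht

end Call

end

section

variable {F : Signature.{u}} {L L₁ : Type}
/-! ## Facts on symbolic values -/

theorem vals_nonempty_isSymVal {s : ℕ → ℝ} {V : SymTm F} (h : (vals s V).Nonempty) :
    V.IsSymVal := by
  induction V with
  | lit c => exact .lit c
  | prim o args ih =>
    obtain ⟨y, x, hx, rfl⟩ := h
    exact .prim o args fun i => ih i ⟨_, hx i⟩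
  | _ => simp [vals] at h

/-- Variables have no values, so a symbolic term with a nonempty set of values is closed. -/
theorem vals_nonempty_rename {s : ℕ → ℝ} {V : SymTm F} (h : (vals s V).Nonempty) (ρ : ℕ → ℕ) :
    V.rename ρ = V := by
  induction V with
  | lit c => rfl
  | prim o args ih =>
    obtain ⟨y, x, hx, rfl⟩ := h
    simp only [Tm.rename]
    congr 1
    funext i
    exact ih i ⟨_, hx i⟩
  | _ => simp [vals] at h

theorem vals_nonempty_subst {s : ℕ → ℝ} {V : SymTm F} (h : (vals s V).Nonempty)
    (θ : ℕ → SymTm F) : V.subst θ = V := by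
  induction V with
  | lit c => rfl
  | prim o args ih =>
    obtain ⟨y, x, hx, rfl⟩ := h
    simp only [Tm.subst]
    congr 1
    funext i
    exact ih i ⟨_, hx i⟩
  | _ => simp [vals] at h

theorem approxVal_rename (σ : ITy) (ρ : ℕ → ℕ) :
    (approxVal σ : SymTm F).rename ρ = approxVal σ := by
  induction σ generalizing ρ <;> simp_all [approxVal, Tm.rename]

theorem approxVal_subst (σ : ITy) (θ : ℕ → SymTm F) :
    (approxVal σ : SymTm F).subst θ = approxVal σ := by
  induction σ generalizing θ <;> simp_all [approxVal, Tm.subst]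

theorem approxVal_isSymVal (σ : ITy) : (approxVal σ : SymTm F).IsSymVal := by
  cases σ
  · exact .lit _
  · exact .lam _

/-! ## Concrete terms approximated by symbolic terms -/

/-- `Rel b A Γ N σ J M`: the concrete term `N` is an instance of the symbolic term `M`, for all
assignments in `A` of values to the sample variables, and has the weighted type `(σ, J)`. If `b`
holds, then the approximating values of a type may stand for any value of this type. -/
inductive Rel (b : Prop) (A : Set (ℕ → ℝ)) : List ITy → Tm F ℝ → ITy → Itv → SymTm F → Prop
  | var {Γ : List ITy} {i : ℕ} {σ : ITy} (h : Γ[i]? = some σ) :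
      Rel b A Γ (.var i) σ .one (.var i)
  | sub {Γ : List ITy} {N : Tm F ℝ} {M : SymTm F} {σ τ : ITy} {I J : Itv}
      (h : Rel b A Γ N σ I M) (hσ : SubTy σ τ) (hI : I.Le J) : Rel b A Γ N τ J M
  -- `V` may be an interval, a sample variable or a postponed operation whose result the concrete
  -- term has already computed.
  | lit {Γ : List ITy} {r : ℝ} {I : Itv} {V : SymTm F} (h : r ∈ I.carrier)
      (hV : ∀ s ∈ A, r ∈ vals s V) : Rel b A Γ (.lit r) (.base I) .one V
  | lam {Γ : List ITy} {N : Tm F ℝ} {M : SymTm F} {σ τ : ITy} {J : Itv}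
      (h : Rel b A (σ :: Γ) N τ J M) : Rel b A Γ (.lam N) (.arr σ τ J) .one (.lam M)
  | fix {Γ : List ITy} {N : Tm F ℝ} {M : SymTm F} {σ τ : ITy} {J : Itv}
      (h : Rel b A (σ :: .arr σ τ J :: Γ) N τ J M) :
      Rel b A Γ (.fix N) (.arr σ τ J) .one (.fix M)
  | app {Γ : List ITy} {N N₁ : Tm F ℝ} {M M₁ : SymTm F} {σ τ : ITy} {I J K : Itv}
      (hM : Rel b A Γ N (.arr σ τ K) I M) (hN : Rel b A Γ N₁ σ J M₁) :
      Rel b A Γ (.app N N₁) τ ((I.mul J).mul K) (.app M M₁)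
  | ite {Γ : List ITy} {N N₁ N₂ : Tm F ℝ} {M M₁ M₂ : SymTm F} {B I J : Itv} {σ : ITy}
      (hM : Rel b A Γ N (.base B) I M) (hN : Rel b A Γ N₁ σ J M₁) (hP : Rel b A Γ N₂ σ J M₂) :
      Rel b A Γ (.ite N N₁ N₂) σ (I.mul J) (.ite M M₁ M₂)
  | prim {Γ : List ITy} (o : F.Op) (args : Fin (F.arity o) → Tm F ℝ)
      (args₁ : Fin (F.arity o) → SymTm F) (I J : Fin (F.arity o) → Itv)
      (h : ∀ i, Rel b A Γ (args i) (.base (I i)) (J i) (args₁ i)) :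
      Rel b A Γ (.prim o args) (.base (Itv.lift (F.fn o) I)) (Itv.prod J) (.prim o args₁)
  | sample {Γ : List ITy} : Rel b A Γ .sample (.base (.mk2 0 1)) .one .sample
  | score {Γ : List ITy} {N : Tm F ℝ} {M : SymTm F} {I J : Itv}
      (h : Rel b A Γ N (.base I) J M) :
      Rel b A Γ (.score N) (.base (I.meet (.mk2 0 ⊤))) (J.mul (I.meet (.mk2 0 ⊤))) (.score M)
  | val {Γ : List ITy} {V : Tm F ℝ} {σ : ITy} (hb : b) (hV : V.IsVal) (h : CTy Γ V σ .one) :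
      Rel b A Γ V σ .one (approxVal σ)
  -- `X` has not been evaluated yet; on the symbolic side its whole run is condensed into the
  -- pending `score`.
  | call {Γ : List ITy} {X : Tm F ℝ} {τ : ITy} {J : Itv} (hb : b) (h : CTy Γ X τ J) :
      Rel b A Γ X τ J (.app (.lam (approxVal τ)) (.score (.lit (.itv J))))
  -- The state just after that `score`: `X` has become the value `V`, while the beta step that
  -- discards the scored interval is still to come.
  | ret {Γ : List ITy} {V : Tm F ℝ} {τ : ITy} (J : Itv) (hb : b) (hV : V.IsVal)
      (h : CTy Γ V τ .one) :
      Rel b A Γ V τ .one (.app (.lam (approxVal τ)) (.lit (.itv J)))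

variable {b : Prop} {A A' : Set (ℕ → ℝ)}

theorem Rel.cTy {Γ : List ITy} {N : Tm F ℝ} {σ : ITy} {J : Itv} {M : SymTm F}
    (h : Rel b A Γ N σ J M) : CTy Γ N σ J := by
  induction h with
  | var h => exact .var h
  | sub _ h1 h2 ih => exact .sub ih h1 h2
  | lit h => exact .lit h
  | lam _ ih => exact .lam ih
  | fix _ ih => exact .fix ih
  | app _ _ ih1 ih2 => exact .app ih1 ih2
  | ite _ _ _ ih1 ih2 ih3 => exact .ite ih1 ih2 ih3
  | prim o args _ I J _ ih => exact .prim o _ I J ih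
  | sample => exact .sample
  | score _ ih => exact .score ih
  | val _ _ h => exact h
  | call _ h => exact h
  | ret _ _ _ h => exact h

theorem Rel.mono {b' : Prop} {Γ : List ITy} {N : Tm F ℝ} {σ : ITy} {J : Itv} {M : SymTm F}
    (h : Rel b A Γ N σ J M) (hb : b → b') (hA : A' ⊆ A) : Rel b' A' Γ N σ J M := by
  induction h with
  | var h => exact .var h
  | sub _ h1 h2 ih => exact .sub ih h1 h2
  | lit h hV => exact .lit h fun s hs => hV s (hA hs)
  | lam _ ih => exact .lam ih
  | fix _ ih => exact .fix ih
  | app _ _ ih1 ih2 => exact .app ih1 ih2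
  | ite _ _ _ ih1 ih2 ih3 => exact .ite ih1 ih2 ih3
  | prim o args _ I J _ ih => exact .prim o _ _ I J ih
  | sample => exact .sample
  | score _ ih => exact .score ih
  | val h1 h2 h3 => exact .val (hb h1) h2 h3
  | call h1 h2 => exact .call (hb h1) h2
  | ret J h1 h2 h3 => exact .ret J (hb h1) h2 h3

theorem Tm.IsVal.rename {V : Tm F L} (h : V.IsVal) (ρ : ℕ → ℕ) : (V.rename ρ).IsVal := by
  cases h <;> constructor

theorem Tm.IsVal.subst {V : Tm F L} (h : V.IsVal) {θ : ℕ → Tm F L} (hθ : ∀ i, (θ i).IsVal) :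
    (V.subst θ).IsVal := by
  cases h with
  | var i => exact hθ i
  | _ => constructor

/-- If `A` were empty, `Rel.lit` would relate a number to arbitrary open symbolic terms, which
renaming may change. -/
theorem Rel.rename (hA : A.Nonempty) {Γ Γ' : List ITy} {N : Tm F ℝ} {σ : ITy} {J : Itv}
    {M : SymTm F} {ρ : ℕ → ℕ} (h : Rel b A Γ N σ J M) (hρ : RenOk Γ Γ' ρ) :
    Rel b A Γ' (N.rename ρ) σ J (M.rename ρ) := by
  induction h generalizing Γ' ρ with
  | var h => exact .var (hρ _ _ h)
  | sub _ hσ hI ih => exact .sub (ih hρ) hσ hI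
  | lit h hV =>
    obtain ⟨s, hs⟩ := hA
    rw [vals_nonempty_rename ⟨_, hV s hs⟩]
    exact .lit h hV
  | lam _ ih => exact .lam (ih (hρ.up _))
  | fix _ ih => exact .fix (ih ((hρ.up _).up _))
  | app _ _ ih1 ih2 => exact .app (ih1 hρ) (ih2 hρ)
  | ite _ _ _ ih1 ih2 ih3 => exact .ite (ih1 hρ) (ih2 hρ) (ih3 hρ)
  | prim o args _ I J _ ih => exact .prim o _ _ I J fun i => ih i hρ
  | sample => exact .sample
  | score _ ih => exact .score (ih hρ)
  | val hb hV h => rw [approxVal_rename]; exact .val hb (hV.rename ρ) (h.rename hρ)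
  | call hb h =>
    simp only [Tm.rename, approxVal_rename]
    exact .call hb (h.rename hρ)
  | ret J hb hV h =>
    simp only [Tm.rename, approxVal_rename]
    exact .ret J hb (hV.rename ρ) (h.rename hρ)

/-- Related well-typed substitutions by values. -/
def RelSubst (b : Prop) (A : Set (ℕ → ℝ)) (Γ Γ' : List ITy) (θ : ℕ → Tm F ℝ)
    (η : ℕ → SymTm F) : Prop :=
  (∀ i, (θ i).IsVal) ∧ ∀ i τ, Γ[i]? = some τ → Rel b A Γ' (θ i) τ .one (η i)

theorem RelSubst.up (hA : A.Nonempty) {Γ Γ' : List ITy} {θ : ℕ → Tm F ℝ} {η : ℕ → SymTm F}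
    (h : RelSubst b A Γ Γ' θ η) (σ : ITy) :
    RelSubst b A (σ :: Γ) (σ :: Γ') (Tm.upSubst θ) (Tm.upSubst η) := by
  refine ⟨fun i => ?_, fun i τ hi => ?_⟩
  · cases i with
    | zero => exact .var _
    | succ i => exact (h.1 i).rename _
  · cases i with
    | zero => exact .var (by simpa using hi)
    | succ i => exact (h.2 i τ (by simpa using hi)).rename hA (.succ _ _)

theorem Rel.subst (hA : A.Nonempty) {Γ Γ' : List ITy} {N : Tm F ℝ} {σ : ITy} {J : Itv}
    {M : SymTm F} {θ : ℕ → Tm F ℝ} {η : ℕ → SymTm F} (h : Rel b A Γ N σ J M)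
    (hθ : RelSubst b A Γ Γ' θ η) : Rel b A Γ' (N.subst θ) σ J (M.subst η) := by
  have ok : ∀ {Γ Γ' : List ITy} {θ : ℕ → Tm F ℝ} {η : ℕ → SymTm F},
      RelSubst b A Γ Γ' θ η → SubstOk Γ Γ' θ := fun h i τ hi => (h.2 i τ hi).cTy
  induction h generalizing Γ' θ η with
  | var h => exact hθ.2 _ _ h
  | sub _ hσ hI ih => exact .sub (ih hθ) hσ hI
  | lit h hV =>
    obtain ⟨s, hs⟩ := hA
    rw [vals_nonempty_subst ⟨_, hV s hs⟩]
    exact .lit h hV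
  | lam _ ih => exact .lam (ih (hθ.up hA _))
  | fix _ ih => exact .fix (ih ((hθ.up hA _).up hA _))
  | app _ _ ih1 ih2 => exact .app (ih1 hθ) (ih2 hθ)
  | ite _ _ _ ih1 ih2 ih3 => exact .ite (ih1 hθ) (ih2 hθ) (ih3 hθ)
  | prim o args _ I J _ ih => exact .prim o _ _ I J fun i => ih i hθ
  | sample => exact .sample
  | score _ ih => exact .score (ih hθ)
  | val hb hV h => rw [approxVal_subst]; exact .val hb (hV.subst hθ.1) (h.subst (ok hθ))
  | call hb h =>
    simp only [Tm.subst, approxVal_subst]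
    exact .call hb (h.subst (ok hθ))
  | ret J hb hV h =>
    simp only [Tm.subst, approxVal_subst]
    exact .ret J hb (hV.subst hθ.1) (h.subst (ok hθ))

theorem Rel.inst1 (hA : A.Nonempty) {Γ : List ITy} {N V : Tm F ℝ} {M W : SymTm F} {σ τ : ITy}
    {J : Itv} (h : Rel b A (σ :: Γ) N τ J M) (hv : V.IsVal) (hV : Rel b A Γ V σ .one W) :
    Rel b A Γ (N.inst1 V) τ J (M.inst1 W) := by
  refine h.subst hA ⟨fun i => ?_, fun i τ hi => ?_⟩
  · rcases i with _ | i
    · exact hv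
    · exact .var _
  · rcases i with _ | i
    · simp only [List.getElem?_cons_zero, Option.some.injEq] at hi
      exact hi ▸ hV
    · exact .var (by simpa using hi)

theorem Rel.inst2 (hA : A.Nonempty) {Γ : List ITy} {N V V' : Tm F ℝ} {M W W' : SymTm F}
    {σ σ' τ : ITy} {J : Itv} (h : Rel b A (σ :: σ' :: Γ) N τ J M) (hv : V.IsVal)
    (hV : Rel b A Γ V σ .one W) (hv' : V'.IsVal) (hV' : Rel b A Γ V' σ' .one W') :
    Rel b A Γ (N.inst2 V V') τ J (M.inst2 W W') := by
  refine h.subst hA ⟨fun i => ?_, fun i τ hi => ?_⟩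
  · rcases i with _ | _ | i
    · exact hv
    · exact hv'
    · exact .var _
  · rcases i with _ | _ | i
    · simp only [List.getElem?_cons_zero, Option.some.injEq] at hi
      exact hi ▸ hV
    · simp only [zero_add, List.getElem?_cons_succ, List.getElem?_cons_zero,
        Option.some.injEq] at hi
      exact hi ▸ hV'
    · exact .var (by simpa using hi)

/-! ## Normalisation of postponed operations -/

/-- Deterministic reduction without effect on the weight. -/
def DSteps : Tm F ℝ → Tm F ℝ → Prop := Relation.ReflTransGen fun N N' => DStep N 1 N'

theorem DSteps.refl (N : Tm F ℝ) : DSteps N N := Relation.ReflTransGen.refl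

theorem DSteps.plug {N N' : Tm F ℝ} (h : DSteps N N') {E : ECtx F ℝ} (hE : E.Ok Tm.IsVal) :
    DSteps (E.plug N) (E.plug N') := by
  induction h with
  | refl => exact .refl _
  | tail _ h ih => exact ih.tail (h.plug hE)

theorem DSteps.trans {N N' N'' : Tm F ℝ} (h : DSteps N N') (h' : DSteps N' N'') :
    DSteps N N'' :=
  Relation.ReflTransGen.trans h h'

theorem DSteps.den {φ : ℝ → ℝ≥0∞} {U : Set ℝ} (hφ : WF φ) (hU : MeasurableSet U)
    {N N' : Tm F ℝ} (h : DSteps N N') : den φ U N = den φ U N' := by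
  induction h with
  | refl => rfl
  | tail _ h ih => rw [ih, den_dStep hφ hU h, hφ.one, one_mul]

theorem DSteps.term {N N' : Tm F ℝ} (h : DSteps N N') : term N = term N' := h.den wf_one .univ

/-- The first `k` arguments are evaluated from left to right, the order that evaluation contexts
impose. -/
theorem dSteps_prim (o : F.Op) {args args' : Fin (F.arity o) → Tm F ℝ} (k : ℕ)
    (h : ∀ j : Fin (F.arity o), j.val < k → DSteps (args j) (args' j) ∧ (args' j).IsVal) :
    DSteps (.prim o args) (.prim o fun j => if j.val < k then args' j else args j) := by
  induction k with
  | zero => simpa using DSteps.refl _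
  | succ k ih =>
    have ih := ih fun j hj => h j (by omega)
    refine DSteps.trans ih ?_
    by_cases hk : k < F.arity o
    · let i : Fin (F.arity o) := ⟨k, hk⟩
      obtain ⟨h1, -⟩ := h i (Nat.lt_succ_self k)
      have := h1.plug (E := .prim o (fun j => if j.val < k then args' j else args j) i .hole)
        ⟨fun j hj => by
          have hj' : j.val < k := hj
          simp only [if_pos hj']
          exact (h j (by omega)).2, trivial⟩
      simp only [ECtx.plug] at this
      convert this using 2
      · funext j
        by_cases hj : j = i
        · subst hj; simp [i]
        · rw [Function.update_of_ne hj]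
      · funext j
        by_cases hj : j = i
        · subst hj; simp [i]
        · have : j.val ≠ k := fun h => hj (Fin.ext h)
          rw [Function.update_of_ne hj]
          by_cases h1 : j.val < k
          · rw [if_pos h1, if_pos (by omega)]
          · rw [if_neg h1, if_neg (by omega)]
    · have : (fun j : Fin (F.arity o) => if j.val < k + 1 then args' j else args j) =
          fun j => if j.val < k then args' j else args j := by
        funext j
        rw [if_pos (by omega), if_pos (by omega)]
      rw [this]
      exact .refl _

theorem CTy.base_val {V : Tm F ℝ} {I J : Itv} (h : CTy [] V (.base I) J) (hV : V.IsVal) :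
    ∃ r ∈ I.carrier, V = .lit r := by
  generalize hΓ : ([] : List ITy) = Γ at h
  generalize hσ : ITy.base I = σ at h
  induction h generalizing I with
  | var h => subst hΓ; simp at h
  | sub _ hs _ ih =>
    subst hσ
    cases hs with
    | base hle =>
      obtain ⟨r, h1, h2⟩ := ih hV hΓ rfl
      exact ⟨r, hle h1, h2⟩
  | lit h => cases hσ; exact ⟨_, h, rfl⟩
  | lam => cases hσ
  | fix => cases hσ
  | _ => cases hV

/-- A symbolic value may contain postponed operations that the concrete term still has to perform.
The concrete side catches up by steps of factor 1. -/
theorem Rel.normalize {X : Tm F ℝ} {σ : ITy} {J : Itv} {W : SymTm F}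
    (h : Rel b A [] X σ J W) (hW : W.IsSymVal) :
    ∃ V, DSteps X V ∧ V.IsVal ∧ Rel b A [] V σ .one W ∧ (1 : ℝ) ∈ J.carrier ∧
      ∀ I, σ = .base I → ∃ r ∈ I.carrier, V = .lit r ∧ ∀ s ∈ A, r ∈ vals s W := by
  generalize hΓ : ([] : List ITy) = Γ at h
  induction h with
  | var h => subst hΓ; simp at h
  | sub _ hσ hI ih =>
    obtain ⟨V, h1, h2, h3, h4, h5⟩ := ih hW hΓ
    refine ⟨V, h1, h2, .sub h3 hσ (.refl _), hI h4, ?_⟩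
    rintro I rfl
    cases hσ with
    | base hle =>
      obtain ⟨r, h6, h7⟩ := h5 _ rfl
      exact ⟨r, hle h6, h7⟩
  | lit h hV =>
    refine ⟨_, .refl _, .lit _, .lit h hV, Itv.one_mem_one, ?_⟩
    rintro I ⟨⟩
    exact ⟨_, h, rfl, hV⟩
  | lam h => subst hΓ; exact ⟨_, .refl _, .lam _, .lam h, Itv.one_mem_one, fun _ h => nomatch h⟩
  | fix h => subst hΓ; exact ⟨_, .refl _, .fix _, .fix h, Itv.one_mem_one, fun _ h => nomatch h⟩
  | val hb hV h =>
    subst hΓ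
    refine ⟨_, .refl _, hV, .val hb hV h, Itv.one_mem_one, ?_⟩
    rintro I rfl
    obtain ⟨r, h1, rfl⟩ := h.base_val hV
    exact ⟨r, h1, rfl, fun s _ => h1⟩
  | prim o args args₁ I J h ih =>
    subst hΓ
    choose V h1 h2 h3 h4 h5 using fun i => ih i (valLike_isSymVal.prim _ _ hW i) rfl
    choose r hr h6 h7 using fun i => h5 i _ rfl
    obtain rfl : V = fun i => .lit (r i) := funext h6
    have hd := dSteps_prim o (args := args) (F.arity o) fun j _ => ⟨h1 j, h2 j⟩
    simp only [Fin.is_lt, if_true] at hd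
    have hv : ∀ s ∈ A, F.fn o r ∈ vals s (.prim o args₁) := fun s hs =>
      ⟨r, fun i => h7 i s hs, rfl⟩
    refine ⟨.lit (F.fn o r), hd.tail (DRed.prim o r).dStep, .lit _,
      .lit (Itv.lift_mem hr) hv, Itv.one_mem_prod h4, ?_⟩
    rintro I' ⟨⟩
    exact ⟨_, Itv.lift_mem hr, rfl, hv⟩
  | _ => cases hW

theorem Rel.arr_inv {V : Tm F ℝ} {σ τ : ITy} {K J : Itv} {W : SymTm F}
    (h : Rel b A [] V (.arr σ τ K) J W) (hW : W.IsSymVal) :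
    ∃ σ' τ' K', SubTy σ σ' ∧ SubTy τ' τ ∧ K'.Le K ∧
      ((∃ N M, V = .lam N ∧ W = .lam M ∧ Rel b A [σ'] N τ' K' M) ∨
        (∃ N M, V = .fix N ∧ W = .fix M ∧ Rel b A [σ', .arr σ' τ' K'] N τ' K' M) ∨
        (b ∧ W = approxVal (.arr σ' τ' K') ∧ CTy [] V (.arr σ' τ' K') .one)) := by
  generalize hΓ : ([] : List ITy) = Γ at h
  generalize hB : ITy.arr σ τ K = B at h
  induction h generalizing σ τ K with
  | var h => subst hΓ; simp at h
  | sub _ hσ _ ih =>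
    subst hB
    cases hσ with
    | arr a b c =>
      obtain ⟨σ', τ', K', h1, h2, h3, h4⟩ := ih hW hΓ rfl
      exact ⟨σ', τ', K', a.trans h1, h2.trans b, h3.trans c, h4⟩
  | lit => cases hB
  | lam h =>
    cases hB; subst hΓ
    exact ⟨_, _, _, .refl _, .refl _, .refl _, .inl ⟨_, _, rfl, rfl, h⟩⟩
  | fix h =>
    cases hB; subst hΓ
    exact ⟨_, _, _, .refl _, .refl _, .refl _, .inr (.inl ⟨_, _, rfl, rfl, h⟩)⟩
  | val hb hV h =>
    subst hB; subst hΓ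
    exact ⟨_, _, _, .refl _, .refl _, .refl _, .inr (.inr ⟨hb, rfl, h⟩)⟩
  | prim => cases hB
  | _ => cases hW

/-! ## Simulation -/

/-- Related evaluation contexts: `τ` is the type of the hole and `σ` that of the result. -/
def CtxRel (b : Prop) (A : Set (ℕ → ℝ)) (σ τ : ITy) (E : ECtx F ℝ) (E₁ : ECtx F SymLit) : Prop :=
  -- Smaller sets `A'` are included because drawing a sample narrows the assignments while the
  -- contexts stay the same.
  E.Ok Tm.IsVal ∧ E₁.Ok Tm.IsSymVal ∧ ∀ A' ⊆ A, ∀ X K X₁, Rel b A' [] X τ K X₁ →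
    ∃ J, Rel b A' [] (E.plug X) σ J (E₁.plug X₁)

theorem CtxRel.hole (b : Prop) (A : Set (ℕ → ℝ)) (σ : ITy) :
    CtxRel b A σ σ (.hole : ECtx F ℝ) .hole :=
  ⟨trivial, trivial, fun _ _ _ K _ h => ⟨K, h⟩⟩

/-- A concrete term `X` of type `τ` that is related to a symbolic redex. -/
inductive HeadRel (b : Prop) (A : Set (ℕ → ℝ)) : Tm F ℝ → ITy → SymTm F → Prop
  | det {X X' : Tm F ℝ} {τ : ITy} {K : Itv} {R R' : SymTm F} (h : DSteps X X')
      (hR : ∀ n Δ Ξ, SymRedex R n Δ Ξ R' n Δ Ξ) (hrel : Rel b A [] X' τ K R') :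
      HeadRel b A X τ R
  | sample : HeadRel b A .sample (.base (.mk2 0 1)) .sample
  | ite {X N P : Tm F ℝ} {τ : ITy} {J : Itv} {r : ℝ} {V N₁ P₁ : SymTm F} (hV : V.IsSymVal)
      (hr : ∀ s ∈ A, r ∈ vals s V) (hN : r ≤ 0 → DSteps X N) (hP : 0 < r → DSteps X P)
      (hN' : Rel b A [] N τ J N₁) (hP' : Rel b A [] P τ J P₁) : HeadRel b A X τ (.ite V N₁ P₁)
  | score {X : Tm F ℝ} {r : ℝ} {I : Itv} {V : SymTm F} (hV : V.IsSymVal)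
      (hr : ∀ s ∈ A, r ∈ vals s V) (h : DSteps X (.score (.lit r)))
      (hrel : 0 ≤ r → r ∈ I.carrier) : HeadRel b A X (.base I) (.score V)
  | call {X : Tm F ℝ} {τ : ITy} {J : Itv} (hb : b) (h : CTy [] X τ J) :
      HeadRel b A X τ (.app (.lam (approxVal τ)) (.score (.lit (.itv J))))

/-- A term related to a symbolic term that is not a value reduces to a related head in related
evaluation contexts. -/
theorem Rel.decompose (hA : A.Nonempty) {N : Tm F ℝ} {σ : ITy} {J : Itv} {M : SymTm F}
    (h : Rel b A [] N σ J M) (hM : ¬ M.IsSymVal) :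
    ∃ (E : ECtx F ℝ) (E₁ : ECtx F SymLit) (τ : ITy) (X : Tm F ℝ) (R : SymTm F),
      CtxRel b A σ τ E E₁ ∧ DSteps N (E.plug X) ∧ M = E₁.plug R ∧ HeadRel b A X τ R := by
  generalize hΓ : ([] : List ITy) = Γ at h
  induction h with
  | var => exact absurd (.var _) hM
  | lam => exact absurd (.lam _) hM
  | fix => exact absurd (.fix _) hM
  | val => exact absurd (approxVal_isSymVal _) hM
  | lit h hV =>
    obtain ⟨s, hs⟩ := hA
    exact absurd (vals_nonempty_isSymVal ⟨_, hV s hs⟩) hM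
  | sub _ hσ hI ih =>
    obtain ⟨E, E₁, τ, X, R, ⟨h1, h2, h3⟩, h4, h5, h6⟩ := ih hM hΓ
    refine ⟨E, E₁, τ, X, R, ⟨h1, h2, fun A' hA' X K X₁ hX => ?_⟩, h4, h5, h6⟩
    obtain ⟨J, hJ⟩ := h3 A' hA' X K X₁ hX
    exact ⟨J, .sub hJ hσ (.refl _)⟩
  | sample => exact ⟨.hole, .hole, _, _, _, .hole _ _ _, .refl _, rfl, .sample⟩
  | call hb h =>
    subst hΓ
    exact ⟨.hole, .hole, _, _, _, .hole _ _ _, .refl _, rfl, .call hb h⟩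
  | @ret Γ V τ J hb hV h =>
    subst hΓ
    refine ⟨.hole, .hole, _, _, _, .hole _ _ _, .refl _, rfl,
      .det (.refl _) (fun n Δ Ξ => .beta _ _ n Δ Ξ (.lit _)) (K := .one) ?_⟩
    rw [Tm.inst1, approxVal_subst]
    exact .val hb hV h
  | @app Γ N N₁ M M₁ σ τ I J K hM' hN' ihM ihN =>
    subst hΓ
    by_cases hv : M.IsSymVal
    · obtain ⟨V, a1, a2, a3, -, -⟩ := hM'.normalize hv
      have hd := a1.plug (E := .appL .hole N₁) trivial
      simp only [ECtx.plug] at hd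
      by_cases hv' : M₁.IsSymVal
      · obtain ⟨V', b1, b2, b3, -, -⟩ := hN'.normalize hv'
        have hd' := b1.plug (E := .appR V .hole) ⟨a2, trivial⟩
        simp only [ECtx.plug] at hd'
        have hd := hd.trans hd'
        obtain ⟨σ', τ', K', h1, h2, h3, h4⟩ := a3.arr_inv hv
        have hN'' := Rel.sub b3 h1 (.refl _)
        rcases h4 with ⟨B, B₁, rfl, rfl, h5⟩ | ⟨B, B₁, rfl, rfl, h5⟩ | ⟨hb, rfl, h5⟩
        · exact ⟨.hole, .hole, _, _, _, .hole _ _ _, .refl _, rfl,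
            .det (hd.tail (DRed.beta _ _ b2).dStep) (fun n Δ Ξ => .beta _ _ n Δ Ξ hv')
            (.sub (h5.inst1 hA b2 hN'') h2 h3)⟩
        · exact ⟨.hole, .hole, _, _, _, .hole _ _ _, .refl _, rfl,
            .det (hd.tail (DRed.fix _ _ b2).dStep) (fun n Δ Ξ => .fix _ _ n Δ Ξ hv')
            (.sub (h5.inst2 hA b2 hN'' (.fix _) (.fix h5)) h2 h3)⟩
        -- An approximated function is applied. After normalisation of its two parts, the concrete
        -- application takes no further step here: as a whole it becomes the unevaluated term of
        -- `Rel.call`.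
        · refine ⟨.hole, .hole, _, _, _, .hole _ _ _, .refl _, rfl,
            .det hd (fun n Δ Ξ => .beta _ _ n Δ Ξ hv') (.sub ?_ h2 h3)⟩
          simp only [Tm.inst1, Tm.subst, approxVal_subst]
          exact .call hb (.sub (.app h5 hN''.cTy) (.refl _) (Itv.one_mul_one_mul_le _))
      · obtain ⟨E, E₁, τ', X, R, ⟨h1, h2, h3⟩, h4, rfl, h6⟩ := ihN hv' rfl
        refine ⟨.appR V E, .appR M E₁, τ', X, R, ⟨⟨a2, h1⟩, ⟨hv, h2⟩, ?_⟩, ?_, rfl, h6⟩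
        · intro A' hA' X K X₁ hX
          obtain ⟨J, hJ⟩ := h3 A' hA' X K X₁ hX
          exact ⟨_, .app (a3.mono id hA') hJ⟩
        · exact hd.trans (h4.plug (E := .appR V .hole) ⟨a2, trivial⟩)
    · obtain ⟨E, E₁, τ', X, R, ⟨h1, h2, h3⟩, h4, rfl, h6⟩ := ihM hv rfl
      refine ⟨.appL E N₁, .appL E₁ M₁, τ', X, R, ⟨h1, h2, ?_⟩, ?_, rfl, h6⟩
      · intro A' hA' X K X₁ hX
        obtain ⟨J, hJ⟩ := h3 A' hA' X K X₁ hX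
        exact ⟨_, .app hJ (hN'.mono id hA')⟩
      · exact h4.plug (E := .appL .hole N₁) trivial
  | @ite Γ N N₁ N₂ M M₁ M₂ B I J σ hM' hN' hP' ihM =>
    subst hΓ
    by_cases hv : M.IsSymVal
    · obtain ⟨V, a1, a2, a3, -, a4⟩ := hM'.normalize hv
      obtain ⟨r, -, rfl, hr⟩ := a4 _ rfl
      have hd := a1.plug (E := .ite .hole N₁ N₂) trivial
      exact ⟨.hole, .hole, _, _, _, .hole _ _ _, .refl _, rfl,
        .ite hv hr (fun h => hd.tail (DRed.iteLe _ _ _ h).dStep)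
          (fun h => hd.tail (DRed.iteGt _ _ _ h).dStep) hN' hP'⟩
    · obtain ⟨E, E₁, τ', X, R, ⟨h1, h2, h3⟩, h4, rfl, h6⟩ := ihM hv rfl
      refine ⟨.ite E N₁ N₂, .ite E₁ M₁ M₂, τ', X, R, ⟨h1, h2, ?_⟩, ?_, rfl, h6⟩
      · intro A' hA' X K X₁ hX
        obtain ⟨J, hJ⟩ := h3 A' hA' X K X₁ hX
        exact ⟨_, .ite hJ (hN'.mono id hA') (hP'.mono id hA')⟩
      · exact h4.plug (E := .ite .hole N₁ N₂) trivial
  | @score Γ N M I J hM' ihM =>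
    subst hΓ
    by_cases hv : M.IsSymVal
    · obtain ⟨V, a1, a2, a3, -, a4⟩ := hM'.normalize hv
      obtain ⟨r, hI, rfl, hr⟩ := a4 _ rfl
      have hd := a1.plug (E := .score .hole) trivial
      exact ⟨.hole, .hole, _, _, _, .hole _ _ _, .refl _, rfl,
        .score hv hr hd fun h => ⟨hI, Itv.mem_mk2_top.2 h⟩⟩
    · obtain ⟨E, E₁, τ', X, R, ⟨h1, h2, h3⟩, h4, rfl, h6⟩ := ihM hv rfl
      refine ⟨.score E, .score E₁, τ', X, R, ⟨h1, h2, ?_⟩, ?_, rfl, h6⟩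
      · intro A' hA' X K X₁ hX
        obtain ⟨J, hJ⟩ := h3 A' hA' X K X₁ hX
        exact ⟨_, .score hJ⟩
      · exact h4.plug (E := .score .hole) trivial
  | prim o args args₁ I J h ih =>
    subst hΓ
    have hex : {i | ¬ (args₁ i).IsSymVal}.Nonempty := by
      by_contra hne
      refine hM (.prim o args₁ fun i => ?_)
      by_contra hi
      exact hne ⟨i, hi⟩
    obtain ⟨i, hi, hmin⟩ := WellFounded.has_min (wellFounded_lt (α := Fin (F.arity o))) _ hex
    have hlt : ∀ j, j < i → (args₁ j).IsSymVal := fun j hj => by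
      by_contra hc
      exact hmin j hc hj
    -- Arguments to the left of the first symbolic non-value have to be values in the concrete
    -- context too, so the operations postponed in them are carried out now.
    have hnorm : ∀ j, ∃ V, j < i → DSteps (args j) V ∧ V.IsVal ∧
        Rel b A [] V (.base (I j)) .one (args₁ j) := by
      intro j
      by_cases hj : j < i
      · obtain ⟨V, h1, h2, h3, -⟩ := (h j).normalize (hlt j hj)
        exact ⟨V, fun _ => ⟨h1, h2, h3⟩⟩
      · exact ⟨args j, fun hj' => absurd hj' hj⟩
    choose V hV using hnorm
    have hd := dSteps_prim o (args := args) (args' := V) i.val fun j hj =>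
      ⟨(hV j hj).1, (hV j hj).2.1⟩
    obtain ⟨E, E₁, τ', X, R, ⟨h1, h2, h3⟩, h4, h5, h6⟩ := ih i hi rfl
    have hok : ∀ j < i, ((fun j : Fin (F.arity o) =>
        if j.val < i.val then V j else args j) j).IsVal := fun j hj => by
      simp only
      rw [if_pos (show j.val < i.val from hj)]
      exact (hV j hj).2.1
    refine ⟨.prim o (fun j => if j.val < i.val then V j else args j) i E, .prim o args₁ i E₁, τ',
      X, R, ⟨⟨hok, h1⟩, ⟨hlt, h2⟩, ?_⟩, ?_, by simp [ECtx.plug, ← h5], h6⟩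
    · intro A' hA' X K X₁ hX
      obtain ⟨J', hJ⟩ := h3 A' hA' X K X₁ hX
      refine ⟨_, .prim o _ _ I
        (fun j => if j = i then J' else if j < i then .one else J j) fun j => ?_⟩
      by_cases hj : j = i
      · subst hj
        simpa using hJ
      · simp only [Function.update_of_ne hj, if_neg hj]
        by_cases hj' : j < i
        · rw [if_pos hj', if_pos (show j.val < i.val from hj')]
          exact (hV j hj').2.2.mono id hA'
        · rw [if_neg hj', if_neg (show ¬ j.val < i.val from hj')]
          exact (h j).mono id hA'
    · refine hd.trans ?_
      have := h4.plug (E := .prim o (fun j => if j.val < i.val then V j else args j) i .hole)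
        ⟨hok, trivial⟩
      simp only [ECtx.plug] at this
      convert this using 2
      · funext j
        by_cases hj : j = i
        · subst hj; simp
        · rw [Function.update_of_ne hj]
      · rfl

end

section

variable {F : Signature.{u}} {L L₁ : Type}
variable {b : Prop} {A A' : Set (ℕ → ℝ)}

/-! ## Programs and their symbolic reading -/

/-- The trivial interval type. -/
def Ty.top : Ty → ITy
  | .real => .base (.mk2 ⊥ ⊤)
  | .arr a b => .arr a.top b.top (.mk2 ⊥ ⊤)

theorem Itv.le_top (I : Itv) : I.Le (.mk2 ⊥ ⊤) := fun _ _ => ⟨bot_le, _root_.le_top⟩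

theorem Itv.mem_top (x : ℝ) : x ∈ (Itv.mk2 ⊥ ⊤).carrier := ⟨bot_le, _root_.le_top⟩

/-- With unbounded intervals everywhere a simple typing becomes an interval typing, so a program is
an instance of its own symbolic reading. -/
theorem HasType.rel {Γ : List Ty} {P : Tm F ℝ} {a : Ty} (h : HasType Γ P a) :
    Rel b A (Γ.map Ty.top) P a.top (.mk2 ⊥ ⊤) (toSym P) := by
  have wk : ∀ {Γ N σ J M}, Rel (F := F) b A Γ N σ J M → Rel b A Γ N σ (.mk2 ⊥ ⊤) M :=
    fun h => .sub h (.refl _) (Itv.le_top _)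
  induction h with
  | var h => exact wk (.var (by simp [h]))
  | lit r => exact wk (.lit (Itv.mem_top _) fun s _ => Itv.mem_point.2 rfl)
  | lam _ ih => exact wk (.lam ih)
  | fix _ ih => exact wk (.fix ih)
  | app _ _ ih1 ih2 => exact wk (.app ih1 ih2)
  | ite _ _ _ ih1 ih2 ih3 => exact wk (.ite ih1 ih2 ih3)
  | prim o args _ ih =>
    exact .sub (.prim o args _ _ _ ih) (.base (Itv.le_top _)) (Itv.le_top _)
  | sample => exact .sub .sample (.base (Itv.le_top _)) (Itv.le_top _)
  | score _ ih => exact .sub (.score ih) (.base (Itv.le_top _)) (Itv.le_top _)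

/-! ### Transfer of the typing chosen by `approxFix` to concrete instances. -/

/-- The untyped part of `Rel`, without approximation. -/
inductive Conc (A : Set (ℕ → ℝ)) : Tm F ℝ → SymTm F → Prop
  | var (i : ℕ) : Conc A (.var i) (.var i)
  | lit {r : ℝ} {V : SymTm F} (hV : ∀ s ∈ A, r ∈ vals s V) : Conc A (.lit r) V
  | lam {N : Tm F ℝ} {M : SymTm F} (h : Conc A N M) : Conc A (.lam N) (.lam M)
  | fix {N : Tm F ℝ} {M : SymTm F} (h : Conc A N M) : Conc A (.fix N) (.fix M)
  | app {N N₁ : Tm F ℝ} {M M₁ : SymTm F} (h : Conc A N M) (h₁ : Conc A N₁ M₁) :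
      Conc A (.app N N₁) (.app M M₁)
  | ite {N N₁ N₂ : Tm F ℝ} {M M₁ M₂ : SymTm F} (h : Conc A N M) (h₁ : Conc A N₁ M₁)
      (h₂ : Conc A N₂ M₂) : Conc A (.ite N N₁ N₂) (.ite M M₁ M₂)
  | prim (o : F.Op) (args : Fin (F.arity o) → Tm F ℝ) (args₁ : Fin (F.arity o) → SymTm F)
      (h : ∀ i, Conc A (args i) (args₁ i)) : Conc A (.prim o args) (.prim o args₁)
  | sample : Conc A .sample .sample
  | score {N : Tm F ℝ} {M : SymTm F} (h : Conc A N M) : Conc A (.score N) (.score M)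

/-- The typing inside `Rel` is unrelated to the derivation that `approxFix` chooses. So it is
forgotten here, and `ApproxTm.rel` rebuilds the relation along the new derivation. This requires
that no approximating value yet stands for an unknown concrete one. -/
theorem Rel.conc {Γ : List ITy} {N : Tm F ℝ} {σ : ITy} {J : Itv} {M : SymTm F}
    (h : Rel b A Γ N σ J M) (hb : ¬ b) : Conc A N M := by
  induction h with
  | var => exact .var _
  | sub _ _ _ ih => exact ih
  | lit _ hV => exact .lit hV
  | lam _ ih => exact .lam ih
  | fix _ ih => exact .fix ih
  | app _ _ ih1 ih2 => exact .app ih1 ih2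
  | ite _ _ _ ih1 ih2 ih3 => exact .ite ih1 ih2 ih3
  | prim o _ _ _ _ _ ih => exact .prim o _ _ ih
  | sample => exact .sample
  | score _ ih => exact .score ih
  | val h => exact absurd h hb
  | call h => exact absurd h hb
  | ret _ h => exact absurd h hb

theorem HasITy.lit_cTy {Γ : List ITy} {M : SymTm F} {σ : ITy} {J : Itv} (h : HasITy Γ M σ J)
    {s : ℕ → ℝ} (hs : ∀ i, s i ∈ (Itv.mk2 0 1).carrier) {r : ℝ} (hr : r ∈ vals s M) :
    CTy Γ (.lit r : Tm F ℝ) σ J := by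
  induction h generalizing r with
  | sub _ hσ hI ih => exact .sub (ih hr) hσ hI
  | itv I => exact .lit hr
  | svar i =>
    obtain rfl : r = s i := hr
    exact .lit (hs i)
  | prim o args I J _ ih =>
    obtain ⟨x, hx, rfl⟩ := hr
    refine .sub (.lit (Itv.lift_mem fun i => ?_)) (.refl _)
      (Itv.one_le (Itv.one_mem_prod fun i => ((ih i (hx i)).val (.lit _)).1))
    obtain ⟨I', h1, h2⟩ := (ih i (hx i)).lit_inv
    cases h1
    exact h2
  | _ => simp [vals] at hr

theorem ApproxTm.hasITy {Γ : List ITy} {M M₁ : SymTm F} {σ : ITy} {J : Itv}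
    (h : ApproxTm Γ M σ J M₁) : HasITy Γ M σ J := by
  induction h with
  | var h => exact .var h
  | sub _ h1 h2 ih => exact .sub ih h1 h2
  | itv => exact .itv _
  | svar => exact .svar _
  | lam _ ih => exact .lam ih
  | fix h => exact h
  | app _ _ ih1 ih2 => exact .app ih1 ih2
  | ite _ _ _ ih1 ih2 ih3 => exact .ite ih1 ih2 ih3
  | prim o _ _ I J _ ih => exact .prim o _ I J ih
  | sample => exact .sample
  | score _ ih => exact .score ih

theorem ApproxTm.eq_of_vals {Γ : List ITy} {M M₁ : SymTm F} {σ : ITy} {J : Itv}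
    (h : ApproxTm Γ M σ J M₁) {s : ℕ → ℝ} (hr : (vals s M).Nonempty) : M₁ = M := by
  induction h with
  | sub _ _ _ ih => exact ih hr
  | itv => rfl
  | svar => rfl
  | prim o args args₁ I J _ ih =>
    obtain ⟨_, x, hx, rfl⟩ := hr
    congr 1
    funext i
    exact ih i ⟨_, hx i⟩
  | _ => simp [vals] at hr

theorem HasITy.cTy {Γ : List ITy} {M : SymTm F} {σ : ITy} {J : Itv} (h : HasITy Γ M σ J)
    (hA : A.Nonempty) (hu : ∀ s ∈ A, ∀ i, s i ∈ (Itv.mk2 0 1).carrier) {N : Tm F ℝ}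
    (hN : Conc A N M) : CTy Γ N σ J := by
  -- A concrete number may face a symbolic term of any shape that `vals` covers, so a `lit` case has
  -- to be treated under every typing rule.
  have lit_case : ∀ {Γ : List ITy} {M : SymTm F} {σ : ITy} {J : Itv} {r : ℝ}, HasITy Γ M σ J →
      (∀ s ∈ A, r ∈ vals s M) → CTy Γ (.lit r : Tm F ℝ) σ J := fun h hV => by
    obtain ⟨s, hs⟩ := hA
    exact h.lit_cTy (hu s hs) (hV s hs)
  induction h generalizing N with
  | sub _ hσ hI ih => exact .sub (ih hN) hσ hI
  | var h => cases hN with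
    | var => exact .var h
    | lit hV => exact lit_case (.var h) hV
  | itv => cases hN with | lit hV => exact lit_case (.itv _) hV
  | svar => cases hN with | lit hV => exact lit_case (.svar _) hV
  | lam h ih => cases hN with
    | lam h' => exact .lam (ih h')
    | lit hV => exact lit_case (.lam h) hV
  | fix h ih => cases hN with
    | fix h' => exact .fix (ih h')
    | lit hV => exact lit_case (.fix h) hV
  | app h1 h2 ih1 ih2 => cases hN with
    | app h h' => exact .app (ih1 h) (ih2 h')
    | lit hV => exact lit_case (.app h1 h2) hV
  | ite h1 h2 h3 ih1 ih2 ih3 => cases hN with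
    | ite h h' h'' => exact .ite (ih1 h) (ih2 h') (ih3 h'')
    | lit hV => exact lit_case (.ite h1 h2 h3) hV
  | prim o args I J h ih => cases hN with
    | prim _ _ _ h' => exact .prim o _ I J fun i => ih i (h' i)
    | lit hV => exact lit_case (.prim o args I J h) hV
  | sample => cases hN with
    | sample => exact .sample
    | lit hV => exact lit_case .sample hV
  | score h ih => cases hN with
    | score h' => exact .score (ih h')
    | lit hV => exact lit_case (.score h) hV

theorem ApproxTm.rel {Γ : List ITy} {M M₁ : SymTm F} {σ : ITy} {J : Itv}
    (h : ApproxTm Γ M σ J M₁) (hA : A.Nonempty)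
    (hu : ∀ s ∈ A, ∀ i, s i ∈ (Itv.mk2 0 1).carrier) {N : Tm F ℝ} (hN : Conc A N M) (hb : b) :
    Rel b A Γ N σ J M₁ := by
  have lit_case : ∀ {Γ : List ITy} {M M₁ : SymTm F} {σ : ITy} {J : Itv} {r : ℝ},
      ApproxTm Γ M σ J M₁ → (∀ s ∈ A, r ∈ vals s M) →
      Rel b A Γ (.lit r : Tm F ℝ) σ J M₁ := fun h hV => by
    obtain ⟨s, hs⟩ := hA
    have hc := h.hasITy.lit_cTy (hu s hs) (hV s hs)
    obtain ⟨I, rfl, hI⟩ := hc.lit_inv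
    rw [h.eq_of_vals ⟨_, hV s hs⟩]
    exact .sub (.lit hI hV) (.refl _) (Itv.one_le (hc.val (.lit _)).1)
  induction h generalizing N with
  | sub _ hσ hI ih => exact .sub (ih hN) hσ hI
  | var h => cases hN with
    | var => exact .var h
    | lit hV => exact lit_case (.var h) hV
  | itv => cases hN with | lit hV => exact lit_case (.itv _) hV
  | svar => cases hN with | lit hV => exact lit_case (.svar _) hV
  | lam h ih => cases hN with
    | lam h' => exact .lam (ih h')
    | lit hV => exact lit_case (.lam h) hV
  | fix h => cases hN with
    -- The concrete fixpoint is a value of the type that the derivation gives it, which is all that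
    -- `approxVal` stands for.
    | fix h' => exact .val hb (.fix _) (h.cTy hA hu (.fix h'))
    | lit hV => exact lit_case (.fix h) hV
  | app h1 h2 ih1 ih2 => cases hN with
    | app h h' => exact .app (ih1 h) (ih2 h')
    | lit hV => exact lit_case (.app h1 h2) hV
  | ite h1 h2 h3 ih1 ih2 ih3 => cases hN with
    | ite h h' h'' => exact .ite (ih1 h) (ih2 h') (ih3 h'')
    | lit hV => exact lit_case (.ite h1 h2 h3) hV
  | prim o args args₁ I J h ih => cases hN with
    | prim _ _ _ h' => exact .prim o _ _ I J fun i => ih i (h' i)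
    | lit hV => exact lit_case (.prim o args args₁ I J h) hV
  | sample => cases hN with
    | sample => exact .sample
    | lit hV => exact lit_case .sample hV
  | score h ih => cases hN with
    | score h' => exact .score (ih h')
    | lit hV => exact lit_case (.score h) hV

/-! ## Syntactic invariants -/

/-- All literals of the term satisfy `p`, and fixpoints occur only if `q` holds. -/
def Tm.All (p : L → Prop) (q : Prop) : Tm F L → Prop
  | var _ => True
  | lit c => p c
  | lam M => M.All p q
  | fix M => q ∧ M.All p q
  | app M N => M.All p q ∧ N.All p q
  | ite M N P => M.All p q ∧ N.All p q ∧ P.All p q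
  | prim _ args => ∀ i, (args i).All p q
  | sample => True
  | score M => M.All p q

section All

variable {p p' : L → Prop} {q q' : Prop}

theorem Tm.All.mono {M : Tm F L} (h : M.All p q) (hp : ∀ c, p c → p' c) (hq : q → q') :
    M.All p' q' := by
  induction M with
  | fix M ih => exact ⟨hq h.1, ih h.2⟩
  | _ => simp_all [Tm.All]

theorem Tm.All.rename {M : Tm F L} (h : M.All p q) (ρ : ℕ → ℕ) : (M.rename ρ).All p q := by
  induction M generalizing ρ with
  | fix M ih => exact ⟨h.1, ih h.2 _⟩
  | _ => simp_all [Tm.All, Tm.rename]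

theorem Tm.All.upSubst {θ : ℕ → Tm F L} (h : ∀ i, (θ i).All p q) (i : ℕ) :
    (Tm.upSubst θ i).All p q := by
  cases i with
  | zero => trivial
  | succ i => exact (h i).rename _

theorem Tm.All.subst {M : Tm F L} (h : M.All p q) {θ : ℕ → Tm F L} (hθ : ∀ i, (θ i).All p q) :
    (M.subst θ).All p q := by
  induction M generalizing θ with
  | var i => exact hθ i
  | lit c => exact h
  | lam M ih => exact ih h (Tm.All.upSubst hθ)
  | fix M ih => exact ⟨h.1, ih h.2 (Tm.All.upSubst (Tm.All.upSubst hθ))⟩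
  | app M N ih1 ih2 => exact ⟨ih1 h.1 hθ, ih2 h.2 hθ⟩
  | ite M N P ih1 ih2 ih3 => exact ⟨ih1 h.1 hθ, ih2 h.2.1 hθ, ih3 h.2.2 hθ⟩
  | prim o args ih => exact fun i => ih i (h i) hθ
  | sample => trivial
  | score M ih => exact ih h hθ

theorem Tm.All.inst1 {M V : Tm F L} (h : M.All p q) (hV : V.All p q) :
    (M.inst1 V).All p q :=
  h.subst fun i => by
    rcases i with _ | i
    · exact hV
    · trivial

theorem Tm.All.inst2 {M V W : Tm F L} (h : M.All p q) (hV : V.All p q) (hW : W.All p q) :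
    (M.inst2 V W).All p q :=
  h.subst fun i => by
    rcases i with _ | _ | i
    · exact hV
    · exact hW
    · trivial

theorem ECtx.all_hole {E : ECtx F L} {a : Tm F L} (h : (E.plug a).All p q) : a.All p q := by
  induction E with
  | hole => exact h
  | appL E N ih => exact ih h.1
  | appR V E ih => exact ih h.2
  | ite E N P ih => exact ih h.1
  | prim o args i E ih => exact ih (by simpa using h i)
  | score E ih => exact ih h

theorem ECtx.all_plug {E : ECtx F L} {a b : Tm F L} (h : (E.plug a).All p q)
    (hb : b.All p q) : (E.plug b).All p q := by
  induction E with
  | hole => exact hb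
  | appL E N ih => exact ⟨ih h.1, h.2⟩
  | appR V E ih => exact ⟨h.1, ih h.2⟩
  | ite E N P ih => exact ⟨ih h.1, h.2⟩
  | prim o args i E ih =>
    intro j
    by_cases hj : j = i
    · subst hj
      simpa using ih (by simpa using h j)
    · simpa [Function.update_of_ne hj] using h j
  | score E ih => exact ih h

theorem Tm.all_false_iff (M : Tm F L) : M.All (fun _ => True) False ↔ ¬ M.HasFix := by
  induction M <;> simp_all [Tm.All, Tm.HasFix]

theorem Tm.all_true (M : Tm F L) : M.All (fun _ => True) True := by
  induction M <;> simp_all [Tm.All]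

end All

theorem approxVal_all {p : SymLit → Prop} {q : Prop} (hp : ∀ I, p (.itv I)) (σ : ITy) :
    (approxVal σ : SymTm F).All p q := by
  induction σ with
  | base I => exact hp I
  | arr σ τ J _ ih => exact ⟨ih, hp J⟩

/-- The outermost fixpoints disappear together with everything inside them, and their substitutes
are free of fixpoints. As reduction creates no fixpoints either, `approxFix` acts at most once along
a branch. -/
theorem ApproxTm.all {Γ : List ITy} {M M₁ : SymTm F} {σ : ITy} {J : Itv} {p : SymLit → Prop}
    {q : Prop} (h : ApproxTm Γ M σ J M₁) (hp : ∀ I, p (.itv I)) (hM : M.All p q) :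
    M₁.All p False := by
  induction h with
  | sub _ _ _ ih => exact ih hM
  | fix h => exact approxVal_all hp _
  | var => trivial
  | itv => exact hp _
  | svar => exact hM
  | lam _ ih => exact ih hM
  | app _ _ ih1 ih2 => exact ⟨ih1 hM.1, ih2 hM.2⟩
  | ite _ _ _ ih1 ih2 ih3 => exact ⟨ih1 hM.1, ih2 hM.2.1, ih3 hM.2.2⟩
  | prim o args args₁ I J _ ih => exact fun i => ih i (hM i)
  | sample => trivial
  | score _ ih => exact ih hM

/-- The literal is not a sample variable with an index of at least `n`. -/
def SymLit.Below (n : ℕ) : SymLit → Prop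
  | .itv _ => True
  | .svar i => i < n

theorem SymLit.Below.mono {n m : ℕ} (h : n ≤ m) (c : SymLit) (hc : c.Below n) : c.Below m := by
  cases c with
  | itv => trivial
  | svar i => exact lt_of_lt_of_le hc h

/-- All sample variables in the term have an index below `n`. -/
def Scoped (n : ℕ) (M : SymTm F) : Prop := M.All (SymLit.Below n) True

theorem Scoped.mono {n m : ℕ} (h : n ≤ m) {M : SymTm F} (hM : Scoped n M) : Scoped m M :=
  Tm.All.mono hM (SymLit.Below.mono h) id

theorem Scoped.vals_eq {n : ℕ} {M : SymTm F} (hM : Scoped n M) {s s' : ℕ → ℝ}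
    (h : ∀ i < n, s i = s' i) : vals s M = vals s' M := by
  induction M with
  | lit c =>
    cases c with
    | itv I => rfl
    | svar i => simp only [vals]; rw [h i hM]
  | prim o args ih =>
    simp only [vals]
    congr! 5 with y x
    exact forall_congr' fun i => by rw [ih i (hM i)]
  | _ => rfl

theorem toSym_scoped (P : Tm F ℝ) : Scoped 0 (toSym P) := by
  rw [Scoped, toSym]
  induction P <;> simp_all [Tm.All, Tm.map, SymLit.Below]

/-- All components of a configuration are scoped. -/
structure SymConf.Good (ψ : SymConf F) : Prop where
  tm : Scoped ψ.n ψ.tm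
  constraints : ∀ C ∈ ψ.constraints, Scoped ψ.n C.lhs
  scores : ∀ W ∈ ψ.scores, Scoped ψ.n W

/-! ## Symbolic steps -/

theorem SymRedex.head {R R' : SymTm F} {n n' : ℕ} {Δ Δ' : List (Constraint F)}
    {Ξ Ξ' : List (SymTm F)} (h : SymRedex R n Δ Ξ R' n' Δ' Ξ') : HeadForm Tm.IsSymVal R := by
  cases h with
  | beta _ _ _ _ _ hV => exact .app (.lam _) hV
  | fix _ _ _ _ _ hV => exact .app (.fix _) hV
  | sample => exact .sample
  | iteLe _ _ _ _ _ _ hV => exact .ite hV _ _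
  | iteGt _ _ _ _ _ _ hV => exact .ite hV _ _
  | score _ _ _ _ hV => exact .score hV

theorem symStep_iff {E : ECtx F SymLit} (hE : E.Ok Tm.IsSymVal) {R : SymTm F}
    (hR : HeadForm Tm.IsSymVal R) {n : ℕ} {Δ : List (Constraint F)} {Ξ : List (SymTm F)}
    {ψ : SymConf F} : SymStep ⟨E.plug R, n, Δ, Ξ⟩ ψ ↔
      ∃ R', SymRedex R n Δ Ξ R' ψ.n ψ.constraints ψ.scores ∧ ψ.tm = E.plug R' := by
  rw [SymStep, inCtx_iff]
  constructor
  · rintro ⟨E', a', b, hE', hr, h1, h2⟩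
    obtain ⟨rfl, h⟩ := ECtx.unique valLike_isSymVal hR hr.head hE hE' h1
    exact ⟨b, hr, by rw [h2, h]⟩
  · rintro ⟨b, hr, h⟩
    exact ⟨E, R, b, hE, hr, rfl, h⟩

theorem SymStep.exists_redex {φ ψ : SymConf F} (h : SymStep φ ψ) :
    ∃ (E : ECtx F SymLit) (R R' : SymTm F), E.Ok Tm.IsSymVal ∧
      SymRedex R φ.n φ.constraints φ.scores R' ψ.n ψ.constraints ψ.scores ∧
      φ.tm = E.plug R ∧ ψ.tm = E.plug R' := by
  rw [SymStep, inCtx_iff] at h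
  exact h

theorem SymStep.good {φ ψ : SymConf F} (h : SymStep φ ψ) (hφ : φ.Good) : ψ.Good := by
  obtain ⟨E, R, R', -, hr, h1, h2⟩ := h.exists_redex
  obtain ⟨M, n, Δ, Ξ⟩ := φ
  obtain ⟨M', n', Δ', Ξ'⟩ := ψ
  obtain ⟨g1, g2, g3⟩ := hφ
  simp only at h1 h2 hr g1 g2 g3
  subst h1 h2
  have hR := ECtx.all_hole g1
  cases hr with
  | beta _ _ _ _ _ hV => exact ⟨ECtx.all_plug g1 (Tm.All.inst1 hR.1 hR.2), g2, g3⟩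
  | fix _ _ _ _ _ hV => exact ⟨ECtx.all_plug g1 (Tm.All.inst2 hR.1.2 hR.2 hR.1), g2, g3⟩
  | sample =>
    exact ⟨ECtx.all_plug (Scoped.mono (Nat.le_succ _) g1) (Nat.lt_succ_self n),
      fun C hC => (g2 C hC).mono (Nat.le_succ _), fun W hW => (g3 W hW).mono (Nat.le_succ _)⟩
  | iteLe _ _ _ _ _ _ hV =>
    refine ⟨ECtx.all_plug g1 hR.2.1, fun C hC => ?_, g3⟩
    rcases List.mem_cons.1 hC with rfl | hC
    · exact hR.1
    · exact g2 C hC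
  | iteGt _ _ _ _ _ _ hV =>
    refine ⟨ECtx.all_plug g1 hR.2.2, fun C hC => ?_, g3⟩
    rcases List.mem_cons.1 hC with rfl | hC
    · exact hR.1
    · exact g2 C hC
  | score _ _ _ _ hV =>
    refine ⟨ECtx.all_plug g1 hR, fun C hC => ?_, fun W hW => ?_⟩
    · rcases List.mem_cons.1 hC with rfl | hC
      · exact hR
      · exact g2 C hC
    · rcases List.mem_cons.1 hW with rfl | hW
      · exact hR
      · exact g3 W hW

theorem SymRedex.not_hasFix {E : ECtx F SymLit} {R R' : SymTm F} {n n' : ℕ}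
    {Δ Δ' : List (Constraint F)} {Ξ Ξ' : List (SymTm F)} (hr : SymRedex R n Δ Ξ R' n' Δ' Ξ')
    (h : ¬ (E.plug R).HasFix) : ¬ (E.plug R').HasFix := by
  rw [← Tm.all_false_iff] at h ⊢
  have hR := ECtx.all_hole h
  refine ECtx.all_plug h ?_
  cases hr with
  | beta => exact Tm.All.inst1 hR.1 hR.2
  | fix => exact hR.1.1.elim
  | sample => trivial
  | iteLe => exact hR.2.1
  | iteGt => exact hR.2.2
  | score => exact hR

/-! ## Matching symbolic and concrete steps -/

/-- The ways in which a concrete term `N` of type `σ` matches a symbolic redex in the context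
`E₁`. -/
inductive StepRel (b : Prop) (A : Set (ℕ → ℝ)) (N : Tm F ℝ) (σ : ITy) (E₁ : ECtx F SymLit) :
    SymTm F → Prop
  | det {R R' : SymTm F} {X : Tm F ℝ} {J : Itv} (hR : ∀ n Δ Ξ, SymRedex R n Δ Ξ R' n Δ Ξ)
      (hN : DSteps N X) (hX : Rel b A [] X σ J (E₁.plug R')) : StepRel b A N σ E₁ R
  | sample {E : ECtx F ℝ} (hE : E.Ok Tm.IsVal) (hN : DSteps N (E.plug .sample))
      (hX : ∀ A' ⊆ A, ∀ (r : ℝ) (V : SymTm F), r ∈ (Itv.mk2 0 1).carrier →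
        (∀ s ∈ A', r ∈ vals s V) → ∃ J, Rel b A' [] (E.plug (.lit r)) σ J (E₁.plug V)) :
      StepRel b A N σ E₁ .sample
  | ite {V P Q : SymTm F} {X Y : Tm F ℝ} {r : ℝ} {J J' : Itv} (hV : V.IsSymVal)
      (hr : ∀ s ∈ A, r ∈ vals s V) (hP : r ≤ 0 → DSteps N X) (hQ : 0 < r → DSteps N Y)
      (hX : Rel b A [] X σ J (E₁.plug P)) (hY : Rel b A [] Y σ J' (E₁.plug Q)) :
      StepRel b A N σ E₁ (.ite V P Q)
  | score {V : SymTm F} {r : ℝ} {E : ECtx F ℝ} (hE : E.Ok Tm.IsVal) (hV : V.IsSymVal)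
      (hr : ∀ s ∈ A, r ∈ vals s V) (hN : DSteps N (E.plug (.score (.lit r))))
      (hX : 0 ≤ r → ∃ J, Rel b A [] (E.plug (.lit r)) σ J (E₁.plug V)) :
      StepRel b A N σ E₁ (.score V)
  | call {E : ECtx F ℝ} {X : Tm F ℝ} {τ : ITy} {J : Itv} (hE : E.Ok Tm.IsVal)
      (hN : DSteps N (E.plug X)) (hX : CTy [] X τ J)
      (hV : ∀ V : Tm F ℝ, V.IsVal → CTy [] V τ .one →
        ∃ J', Rel b A [] (E.plug V) σ J' (E₁.plug (.lit (.itv J)))) :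
      StepRel b A N σ E₁ (.score (.lit (.itv J)))

/-- Progress and simulation. -/
theorem Rel.step (hA : A.Nonempty) {N : Tm F ℝ} {σ : ITy} {J : Itv} {M : SymTm F}
    (h : Rel b A [] N σ J M) (hM : ¬ M.IsSymVal) :
    ∃ (E₁ : ECtx F SymLit) (R : SymTm F), E₁.Ok Tm.IsSymVal ∧ HeadForm Tm.IsSymVal R ∧
      M = E₁.plug R ∧ StepRel b A N σ E₁ R := by
  obtain ⟨E, E₁, τ, X, R, ⟨h1, h2, h3⟩, h4, rfl, h6⟩ := h.decompose hA hM
  cases h6 with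
  | det hd hR hrel =>
    obtain ⟨J', hJ⟩ := h3 A Subset.rfl _ _ _ hrel
    exact ⟨E₁, R, h2, (hR 0 [] []).head, rfl, .det hR (h4.trans (hd.plug h1)) hJ⟩
  | sample =>
    exact ⟨E₁, _, h2, .sample, rfl, .sample h1 h4 fun A' hA' r V hr hV =>
      h3 A' hA' _ _ _ (.lit hr hV)⟩
  | ite hV hr hN hP hN' hP' =>
    obtain ⟨J₁, hJ₁⟩ := h3 A Subset.rfl _ _ _ hN'
    obtain ⟨J₂, hJ₂⟩ := h3 A Subset.rfl _ _ _ hP'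
    exact ⟨E₁, _, h2, .ite hV _ _, rfl, .ite hV hr (fun h => h4.trans ((hN h).plug h1))
      (fun h => h4.trans ((hP h).plug h1)) hJ₁ hJ₂⟩
  | score hV hr hd hrel =>
    exact ⟨E₁, _, h2, .score hV, rfl, .score h1 hV hr (h4.trans (hd.plug h1)) fun h =>
      h3 A Subset.rfl _ _ _ (.lit (hrel h) hr)⟩
  | @call X τ J₀ hb hX =>
    -- The redex is the `score` in argument position, so the symbolic context is one layer deeper
    -- than the concrete one.
    refine ⟨E₁.comp (.appR (.lam (approxVal τ)) .hole), _, h2.comp ⟨.lam _, trivial⟩,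
      .score (.lit _), by rw [ECtx.plug_comp]; rfl, .call h1 h4 hX fun V hv hV => ?_⟩
    rw [ECtx.plug_comp]
    exact h3 A Subset.rfl _ _ _ (.ret J₀ hb hv hV)

theorem Rel.stepRel (hA : A.Nonempty) {N : Tm F ℝ} {σ : ITy} {J : Itv} {E₁ : ECtx F SymLit}
    {R : SymTm F} (h : Rel b A [] N σ J (E₁.plug R)) (hE : E₁.Ok Tm.IsSymVal)
    (hR : HeadForm Tm.IsSymVal R) : StepRel b A N σ E₁ R := by
  obtain ⟨E', R', h1, h2, h3, h4⟩ := h.step hA (valLike_isSymVal.plug (hR.not_val valLike_isSymVal))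
  obtain ⟨rfl, he⟩ := ECtx.unique valLike_isSymVal hR h2 hE h1 h3
  cases h4 with
  | det hR hN hX => exact .det hR hN (by rw [he]; exact hX)
  | sample hE hN hX => exact .sample hE hN fun A' hA' r V => by rw [he]; exact hX A' hA' r V
  | ite hV hr hP hQ hX hY =>
    exact .ite hV hr hP hQ (by rw [he]; exact hX) (by rw [he]; exact hY)
  | score hE hV hr hN hX => exact .score hE hV hr hN (by rw [he]; exact hX)
  | call hE hN hX hV => exact .call hE hN hX (by rw [he]; exact hV)

end

section

variable {F : Signature.{u}} {L L₁ : Type}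
open Filter Topology

/-! ## Analytic sets are null measurable -/

/-- Choquet's capacitability argument. The coordinates are bounded one after another; continuity of
the outer measure from below keeps the measure of the image above `c`. All bounds together cut out a
compact product. -/
theorem exists_isCompact_of_lt {X : Type*} [TopologicalSpace X] [MeasurableSpace X]
    {μ : Measure X} [μ.OuterRegular] {f : (ℕ → ℕ) → X} (hf : Continuous f) {c : ℝ≥0∞}
    (hc : c < μ (range f)) : ∃ K, IsCompact K ∧ K ⊆ range f ∧ c ≤ μ K := by
  let C : ℕ → (ℕ → ℕ) → Set (ℕ → ℕ) := fun n k => {x | ∀ i < n, x i ≤ k i}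
  have step : ∀ (S : Set (ℕ → ℕ)) (n : ℕ), c < μ (f '' S) →
      ∃ m, c < μ (f '' (S ∩ {x | x n ≤ m})) := by
    intro S n hS
    have hm : Monotone fun m => f '' (S ∩ {x : ℕ → ℕ | x n ≤ m}) := fun m m' h =>
      image_mono (inter_subset_inter_right _ fun x hx => le_trans hx h)
    have hu : f '' S = ⋃ m, f '' (S ∩ {x : ℕ → ℕ | x n ≤ m}) := by
      rw [← image_iUnion, ← inter_iUnion]
      congr 1
      refine (inter_eq_left.2 fun x _ => mem_iUnion.2 ⟨x n, le_refl (x n)⟩).symm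
    rw [hu, hm.measure_iUnion] at hS
    exact lt_iSup_iff.1 hS
  choose! g hg using step
  let S : ℕ → Set (ℕ → ℕ) := fun n => Nat.rec univ (fun n S => S ∩ {x | x n ≤ g S n}) n
  have hS : ∀ n, c < μ (f '' S n) := by
    intro n
    induction n with
    | zero => simpa [S] using hc
    | succ n ih => exact hg _ _ ih
  let k : ℕ → ℕ := fun n => g (S n) n
  have hSC : ∀ n, S n = C n k := by
    intro n
    induction n with
    | zero => simp [S, C]
    | succ n ih =>
      have : S (n + 1) = S n ∩ {x | x n ≤ k n} := rfl
      rw [this, ih]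
      ext x
      simp only [C, mem_inter_iff, mem_ofPred_eq, Nat.lt_succ_iff_lt_or_eq]
      constructor
      · rintro ⟨h1, h2⟩ i (hi | rfl)
        · exact h1 i hi
        · exact h2
      · exact fun h => ⟨fun i hi => h i (.inl hi), h n (.inr rfl)⟩
  let K : Set (ℕ → ℕ) := univ.pi fun i => Iic (k i)
  have hK : IsCompact K := isCompact_univ_pi fun i => (finite_Iic (k i)).isCompact
  refine ⟨f '' K, hK.image hf, image_subset_range _ _, ?_⟩
  rw [Set.measure_eq_iInf_isOpen]
  refine le_iInf₂ fun U hU => le_iInf fun hUo => ?_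
  -- Outer regularity reduces the estimate to open sets around the compact image; each of them
  -- already contains the image of a stage with finitely many bounds.
  suffices h : ∃ n, C n k ⊆ f ⁻¹' U by
    obtain ⟨n, hn⟩ := h
    refine (hS n).le.trans (measure_mono ?_)
    rw [hSC]
    exact image_subset_iff.2 hn
  by_contra! hcon
  simp only [not_subset] at hcon
  choose x hx hxU using hcon
  -- Truncation moves the points into the compact product and changes no coordinate `i < n` of `x
  -- n`. Hence a limit of a subsequence of `y` is also a limit of that subsequence of `x`.
  let y : ℕ → ℕ → ℕ := fun n i => min (x n i) (k i)
  have hy : ∀ n, y n ∈ K := fun n i _ => show min (x n i) (k i) ≤ k i from min_le_right _ _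
  obtain ⟨z, hz, ψ, hψ, hlim⟩ := hK.tendsto_subseq hy
  have hlim' : Tendsto (fun n => x (ψ n)) atTop (𝓝 z) := by
    rw [tendsto_pi_nhds] at hlim ⊢
    intro i
    refine (hlim i).congr' ?_
    filter_upwards [eventually_gt_atTop i] with n hn
    exact min_eq_left (hx (ψ n) i (hn.trans_le hψ.le_apply))
  have hzU : z ∈ f ⁻¹' U := hU (mem_image_of_mem f hz)
  obtain ⟨n, hn⟩ := (hlim'.eventually ((hUo.preimage hf).mem_nhds hzU)).exists
  exact hxU _ hn

/-- Compact subsets exhaust the measure of the analytic set, which therefore differs from a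
countable union of them by a null set. -/
theorem nullMeasurableSet_of_analyticSet {X : Type*} [TopologicalSpace X] [T2Space X]
    [MeasurableSpace X] [BorelSpace X] {μ : Measure X} [IsFiniteMeasure μ] [μ.OuterRegular]
    {A : Set X} (hA : AnalyticSet A) : NullMeasurableSet A μ := by
  rw [AnalyticSet] at hA
  rcases hA with rfl | ⟨f, hf, rfl⟩
  · exact nullMeasurableSet_empty
  rcases eq_or_ne (μ (range f)) 0 with h0 | h0
  · exact NullMeasurableSet.of_null h0
  obtain ⟨u, -, hu, hlim⟩ := exists_seq_strictMono_tendsto' (pos_iff_ne_zero.2 h0)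
  choose K hK hKf hKμ using fun n => exists_isCompact_of_lt hf (hu n).2
  have hm : MeasurableSet (⋃ n, K n) := MeasurableSet.iUnion fun n => (hK n).measurableSet
  refine NullMeasurableSet.congr hm.nullMeasurableSet
    (ae_eq_of_subset_of_measure_ge (iUnion_subset hKf) ?_ hm.nullMeasurableSet
      (measure_ne_top _ _))
  exact le_of_tendsto' hlim fun n => (hKμ n).trans (measure_mono (subset_iUnion K n))

/-! ## Measurability of sets of values -/

/-- The set of values of a symbolic value is the range of a measurable function of the sample
variables and a parameter. -/
theorem exists_vals_eq_range (V : SymTm F) :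
    ∃ (Y : Type) (_ : MeasurableSpace Y) (_ : StandardBorelSpace Y) (h : (ℕ → ℝ) × Y → ℝ),
      Measurable h ∧ ∀ s, vals s V = range fun y => h (s, y) := by
  have empty : ∀ V : SymTm F, (∀ s, vals s V = ∅) → ∃ (Y : Type) (_ : MeasurableSpace Y)
      (_ : StandardBorelSpace Y) (h : (ℕ → ℝ) × Y → ℝ),
      Measurable h ∧ ∀ s, vals s V = range fun y => h (s, y) := fun V hV => by
    refine ⟨(∅ : Set ℝ), inferInstance, MeasurableSet.empty.standardBorel, fun _ => 0,
      measurable_const, fun s => ?_⟩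
    rw [hV, range_eq_empty]
  induction V with
  | lit c =>
    cases c with
    | itv I =>
      refine ⟨I.carrier, inferInstance, I.isClosed.measurableSet.standardBorel, fun p => p.2,
        measurable_subtype_coe.comp measurable_snd, fun s => ?_⟩
      simp [vals]
    | svar i =>
      refine ⟨Unit, inferInstance, inferInstance, fun p => p.1 i,
        (measurable_pi_apply i).comp measurable_fst, fun s => ?_⟩
      simp [vals]
  | prim o args ih =>
    choose Y m b h hm hv using ih
    refine ⟨∀ i, Y i, inferInstance, inferInstance, fun p => F.fn o fun i => h i (p.1, p.2 i),
      (F.measurable_fn o).comp (measurable_pi_lambda _ fun i => (hm i).comp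
        (measurable_fst.prodMk ((measurable_pi_apply i).comp measurable_snd))), fun s => ?_⟩
    ext y
    simp only [vals, mem_ofPred_eq, hv, mem_range]
    constructor
    · rintro ⟨x, hx, rfl⟩
      choose z hz using hx
      exact ⟨z, by simp only [hz]⟩
    · rintro ⟨z, rfl⟩
      exact ⟨fun i => h i (s, z i), fun i => ⟨z i, rfl⟩, rfl⟩
  | _ => exact empty _ fun s => rfl

theorem measurable_sampleEnv (n : ℕ) :
    Measurable fun s : Fin n → unitInterval => sampleEnv s := by
  refine measurable_pi_lambda _ fun i => ?_
  unfold sampleEnv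
  by_cases h : i < n
  · simp only [h, dif_pos]
    exact measurable_subtype_coe.comp (measurable_pi_apply _)
  · simp only [h]
    exact measurable_const

/-- The set is the projection of a Borel set along the parameter space, hence analytic. With merely
measurable primitive operations it need not be Borel. -/
theorem nullMeasurableSet_exists_vals {n : ℕ} (V : SymTm F) {B : Set ℝ} (hB : MeasurableSet B) :
    NullMeasurableSet {s : Fin n → unitInterval | ∃ t ∈ vals (sampleEnv s) V, t ∈ B} := by
  obtain ⟨Y, _, _, h, hm, hv⟩ := exists_vals_eq_range V
  have : {s : Fin n → unitInterval | ∃ t ∈ vals (sampleEnv s) V, t ∈ B} =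
      Prod.fst '' {p : (Fin n → unitInterval) × Y | h (sampleEnv p.1, p.2) ∈ B} := by
    ext s
    simp [hv]
  rw [this]
  refine nullMeasurableSet_of_analyticSet (MeasurableSet.analyticSet_image ?_ measurable_fst)
  exact (hm.comp (((measurable_sampleEnv n).comp measurable_fst).prodMk measurable_snd)) hB

theorem aemeasurable_iSup_vals {n : ℕ} (V : SymTm F) :
    AEMeasurable fun s : Fin n → unitInterval =>
      ⨆ t ∈ vals (sampleEnv s) V, ENNReal.ofReal t := by
  refine NullMeasurable.aemeasurable ?_
  have : Measurable (α := NullMeasurableSpace (Fin n → unitInterval) volume) fun s =>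
      ⨆ t ∈ vals (sampleEnv s) V, ENNReal.ofReal t := by
    refine measurable_of_Ioi fun c => ?_
    have : ((fun s : Fin n → unitInterval => ⨆ t ∈ vals (sampleEnv s) V, ENNReal.ofReal t) ⁻¹'
        Ioi c) = {s | ∃ t ∈ vals (sampleEnv s) V, t ∈ {t | c < ENNReal.ofReal t}} := by
      ext s
      simp [lt_iSup_iff]
    exact this ▸ nullMeasurableSet_exists_vals V
      (measurableSet_lt measurable_const ENNReal.measurable_ofReal)
  exact fun t ht => this ht

theorem Cmp.measurableSet (c : Cmp) (r : ℝ) : MeasurableSet {t | c.Holds t r} := by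
  cases c
  · exact measurableSet_Iic
  · exact measurableSet_Iio
  · exact measurableSet_Ici
  · exact measurableSet_Ioi

/-! ## Upper integrals -/

section UpperIntegral

variable {X : Type*} [MeasurableSpace X] {μ : Measure X}

/-- The upper integral. -/
def uint (μ : Measure X) (f : X → ℝ≥0∞) : ℝ≥0∞ :=
  ⨅ (g : X → ℝ≥0∞) (_ : Measurable g ∧ f ≤ᵐ[μ] g), ∫⁻ x, g x ∂μ

theorem uint_le {f g : X → ℝ≥0∞} (hg : Measurable g) (h : f ≤ᵐ[μ] g) :
    uint μ f ≤ ∫⁻ x, g x ∂μ := iInf₂_le g ⟨hg, h⟩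

theorem uint_mono {f g : X → ℝ≥0∞} (h : f ≤ g) : uint μ f ≤ uint μ g :=
  le_iInf₂ fun _ hk => uint_le hk.1 (hk.2.mono fun x hx => (h x).trans hx)

theorem uint_le_lintegral {f : X → ℝ≥0∞} (hf : AEMeasurable f μ) :
    uint μ f ≤ ∫⁻ x, f x ∂μ := by
  rw [lintegral_congr_ae hf.ae_eq_mk]
  exact uint_le hf.measurable_mk hf.ae_eq_mk.le

theorem le_uint [IsProbabilityMeasure μ] {f : X → ℝ≥0∞} {c : ℝ≥0∞} (h : ∀ x, c ≤ f x) :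
    c ≤ uint μ f := by
  refine le_iInf₂ fun g hg => ?_
  calc c = ∫⁻ _, c ∂μ := by simp
    _ ≤ _ := lintegral_mono_ae (hg.2.mono fun x hx => (h x).trans hx)

theorem uint_add_le (f g : X → ℝ≥0∞) : uint μ (f + g) ≤ uint μ f + uint μ g := by
  conv_rhs => simp only [uint, ENNReal.iInf_add, ENNReal.add_iInf]
  refine le_iInf₂ fun f' hf => le_iInf₂ fun g' hg => ?_
  rw [← lintegral_add_left hg.1]
  refine uint_le (hg.1.add hf.1) ?_
  filter_upwards [hf.2, hg.2] with x h1 h2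
  exact add_le_add h2 h1

end UpperIntegral

/-! ### Splitting off the last sample of a trace. -/

section Snoc

variable {n : ℕ}

/-- Appending one entry to a trace. -/
def snocEquiv (n : ℕ) :
    (Fin n → unitInterval) × unitInterval ≃ᵐ (Fin (n + 1) → unitInterval) :=
  MeasurableEquiv.prodComm.trans
    (MeasurableEquiv.piFinSuccAbove (fun _ => unitInterval) (Fin.last n)).symm

theorem measurePreserving_snocEquiv (n : ℕ) : MeasurePreserving (snocEquiv n) :=
  ((volume_preserving_piFinSuccAbove (fun _ => unitInterval) (Fin.last n)).symm _).comp
    Measure.measurePreserving_swap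

theorem snocEquiv_apply_lt (s : Fin n → unitInterval) (r : unitInterval) (i : ℕ) (h : i < n) :
    snocEquiv n (s, r) ⟨i, h.trans (Nat.lt_succ_self n)⟩ = s ⟨i, h⟩ := by
  have : (⟨i, h.trans (Nat.lt_succ_self n)⟩ : Fin (n + 1)) = Fin.castSucc ⟨i, h⟩ := rfl
  rw [this]
  change Fin.insertNth (α := fun _ => unitInterval) (Fin.last n) r s _ = _
  rw [Fin.insertNth_last', Fin.snoc_castSucc]

theorem snocEquiv_apply_last (s : Fin n → unitInterval) (r : unitInterval) :
    snocEquiv n (s, r) (Fin.last n) = r := by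
  change Fin.insertNth (α := fun _ => unitInterval) (Fin.last n) r s _ = _
  rw [Fin.insertNth_last', Fin.snoc_last]

/-- For a nonmeasurable function `lintegral` is a lower integral, and this half of Tonelli's theorem
holds for it without measurability. -/
theorem lintegral_snoc_le {f : (Fin (n + 1) → unitInterval) → ℝ≥0∞}
    {h : (Fin n → unitInterval) → ℝ≥0∞} (hf : ∀ s, ∫⁻ r, f (snocEquiv n (s, r)) ≤ h s) :
    ∫⁻ s, f s ≤ ∫⁻ s, h s := by
  rw [← (measurePreserving_snocEquiv n).lintegral_comp_emb (snocEquiv n).measurableEmbedding,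
    Measure.volume_eq_prod]
  exact (lintegral_prod_le _).trans (lintegral_mono hf)

/-- The dual half for upper integrals: almost every slice of a measurable majorant of `f` is almost
everywhere a majorant of the corresponding slice of `f`. -/
theorem uint_le_uint_snoc {f : (Fin (n + 1) → unitInterval) → ℝ≥0∞}
    {h : (Fin n → unitInterval) → ℝ≥0∞} (hf : ∀ s (g : unitInterval → ℝ≥0∞),
      (∀ᵐ r, f (snocEquiv n (s, r)) ≤ g r) → h s ≤ ∫⁻ r, g r) :
    uint volume h ≤ uint volume f := by
  refine le_iInf₂ fun g hg => ?_
  have hm : Measurable fun p => g (snocEquiv n p) := hg.1.comp (snocEquiv n).measurable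
  have h1 := (measurePreserving_snocEquiv n).quasiMeasurePreserving.ae hg.2
  rw [Measure.volume_eq_prod] at h1
  have h2 := Measure.ae_ae_of_ae_prod h1
  rw [← (measurePreserving_snocEquiv n).lintegral_comp hg.1, Measure.volume_eq_prod,
    lintegral_prod _ hm.aemeasurable]
  exact uint_le hm.lintegral_prod_right' (h2.mono fun s hs => hf s _ hs)

end Snoc

end

section

variable {F : Signature.{u}} {L L₁ : Type}
open Filter Topology

variable {U : Set ℝ} {n : ℕ}

/-! ## Environments -/

/-- The assignments of values to all sample variables that extend the trace `s`. -/
def envs (s : Fin n → unitInterval) : Set (ℕ → ℝ) :=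
  -- Coordinates beyond `n` are confined to `[0, 1]` as well, since this is the type of every sample
  -- variable.
  {e | (∀ i (h : i < n), e i = s ⟨i, h⟩) ∧ ∀ i, e i ∈ (Itv.mk2 0 1).carrier}

theorem unitInterval_mem (r : unitInterval) : (r : ℝ) ∈ (Itv.mk2 0 1).carrier :=
  Itv.mem_unit.2 r.2

theorem sampleEnv_mem_envs (s : Fin n → unitInterval) : sampleEnv s ∈ envs s := by
  refine ⟨fun i h => by simp [sampleEnv, h], fun i => ?_⟩
  unfold sampleEnv
  split
  · exact unitInterval_mem _
  · exact Itv.mem_unit.2 ⟨le_rfl, zero_le_one⟩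

theorem envs_nonempty (s : Fin n → unitInterval) : (envs s).Nonempty := ⟨_, sampleEnv_mem_envs s⟩

theorem envs_snoc_subset (s : Fin n → unitInterval) (r : unitInterval) :
    envs (snocEquiv n (s, r)) ⊆ envs s := fun e he =>
  ⟨fun i h => by rw [he.1 i (h.trans (Nat.lt_succ_self n)), snocEquiv_apply_lt], he.2⟩

theorem envs_snoc_last {s : Fin n → unitInterval} {r : unitInterval} {e : ℕ → ℝ}
    (he : e ∈ envs (snocEquiv n (s, r))) : e n = r := by
  rw [he.1 n (Nat.lt_succ_self n)]
  exact congrArg _ (snocEquiv_apply_last s r)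

theorem Scoped.vals_snoc {M : SymTm F} (hM : Scoped n M) (s : Fin n → unitInterval)
    (r : unitInterval) : vals (sampleEnv (snocEquiv n (s, r))) M = vals (sampleEnv s) M :=
  hM.vals_eq fun i h => by
    rw [(envs_snoc_subset s r (sampleEnv_mem_envs _)).1 i h, (sampleEnv_mem_envs s).1 i h]

/-! ## Weights of a path -/

open Classical in
/-- The upper bound on the weight of a path on a trace. -/
def uwt (Δ : List (Constraint F)) (Ξ : List (SymTm F)) (s : Fin n → unitInterval) : ℝ≥0∞ :=
  (Δ.map fun C => if ∃ t ∈ vals (sampleEnv s) C.lhs, C.cmp.Holds t C.rhs then 1 else 0).prod *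
    (Ξ.map fun W => ⨆ t ∈ vals (sampleEnv s) W, ENNReal.ofReal t).prod

open Classical in
/-- The lower bound on the weight of a path on a trace. -/
def lwt (Δ : List (Constraint F)) (Ξ : List (SymTm F)) (s : Fin n → unitInterval) : ℝ≥0∞ :=
  (Δ.map fun C => if ∀ t ∈ vals (sampleEnv s) C.lhs, C.cmp.Holds t C.rhs then 1 else 0).prod *
    (Ξ.map fun W => ⨅ t ∈ vals (sampleEnv s) W, ENNReal.ofReal t).prod

open Classical in
theorem prod_ite_one_zero {α : Type*} (l : List α) (p : α → Prop) :
    (l.map fun x => if p x then (1 : ℝ≥0∞) else 0).prod = if ∀ x ∈ l, p x then 1 else 0 := by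
  induction l with
  | nil => simp
  | cons x l ih =>
    rw [List.map_cons, List.prod_cons, ih]
    by_cases h : p x <;> simp [h]

open Classical in
theorem uwt_eq (Δ : List (Constraint F)) (Ξ : List (SymTm F)) (s : Fin n → unitInterval) :
    uwt Δ Ξ s = if ∀ C ∈ Δ, ∃ t ∈ vals (sampleEnv s) C.lhs, C.cmp.Holds t C.rhs then
      (Ξ.map fun W => ⨆ t ∈ vals (sampleEnv s) W, ENNReal.ofReal t).prod else 0 := by
  rw [uwt, prod_ite_one_zero, ite_mul, one_mul, zero_mul]

open Classical in
theorem lwt_eq (Δ : List (Constraint F)) (Ξ : List (SymTm F)) (s : Fin n → unitInterval) :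
    lwt Δ Ξ s = if ∀ C ∈ Δ, ∀ t ∈ vals (sampleEnv s) C.lhs, C.cmp.Holds t C.rhs then
      (Ξ.map fun W => ⨅ t ∈ vals (sampleEnv s) W, ENNReal.ofReal t).prod else 0 := by
  rw [lwt, prod_ite_one_zero, ite_mul, one_mul, zero_mul]

section Weights

variable {Δ : List (Constraint F)} {Ξ : List (SymTm F)} {s : Fin n → unitInterval}
  {C : Constraint F} {W : SymTm F}

theorem uwt_cons_of (h : ∃ t ∈ vals (sampleEnv s) C.lhs, C.cmp.Holds t C.rhs) :
    uwt (C :: Δ) Ξ s = uwt Δ Ξ s := by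
  simp only [uwt, List.map_cons, List.prod_cons, if_pos h, one_mul]

theorem lwt_cons_of (h : ∀ t ∈ vals (sampleEnv s) C.lhs, C.cmp.Holds t C.rhs) :
    lwt (C :: Δ) Ξ s = lwt Δ Ξ s := by
  simp only [lwt, List.map_cons, List.prod_cons, if_pos h, one_mul]

theorem lwt_cons_of_not (h : ¬ ∀ t ∈ vals (sampleEnv s) C.lhs, C.cmp.Holds t C.rhs) :
    lwt (C :: Δ) Ξ s = 0 := by
  simp only [lwt, List.map_cons, List.prod_cons, if_neg h, zero_mul]

theorem lwt_cons_le : lwt (C :: Δ) Ξ s ≤ lwt Δ Ξ s := by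
  by_cases h : ∀ t ∈ vals (sampleEnv s) C.lhs, C.cmp.Holds t C.rhs
  · rw [lwt_cons_of h]
  · rw [lwt_cons_of_not h]
    exact zero_le

theorem uwt_score : uwt Δ (W :: Ξ) s =
    (⨆ t ∈ vals (sampleEnv s) W, ENNReal.ofReal t) * uwt Δ Ξ s := by
  simp only [uwt, List.map_cons, List.prod_cons]
  ring

theorem lwt_score : lwt Δ (W :: Ξ) s =
    (⨅ t ∈ vals (sampleEnv s) W, ENNReal.ofReal t) * lwt Δ Ξ s := by
  simp only [lwt, List.map_cons, List.prod_cons]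
  ring

theorem uwt_snoc (hΔ : ∀ C ∈ Δ, Scoped n C.lhs) (hΞ : ∀ W ∈ Ξ, Scoped n W) (r : unitInterval) :
    uwt Δ Ξ (snocEquiv n (s, r)) = uwt Δ Ξ s := by
  unfold uwt
  congr 2
  · exact List.map_congr_left fun C hC => by rw [(hΔ C hC).vals_snoc]
  · exact List.map_congr_left fun W hW => by rw [(hΞ W hW).vals_snoc]

theorem lwt_snoc (hΔ : ∀ C ∈ Δ, Scoped n C.lhs) (hΞ : ∀ W ∈ Ξ, Scoped n W) (r : unitInterval) :
    lwt Δ Ξ (snocEquiv n (s, r)) = lwt Δ Ξ s := by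
  unfold lwt
  congr 2
  · exact List.map_congr_left fun C hC => by rw [(hΔ C hC).vals_snoc]
  · exact List.map_congr_left fun W hW => by rw [(hΞ W hW).vals_snoc]

end Weights

/-! ## Bounds at a trace -/

/-- The program `N` of real type is an instance of `M` at the trace `s`. -/
def RelAt (M : SymTm F) (s : Fin n → unitInterval) (N : Tm F ℝ) : Prop :=
  -- The flag is read off `M`: approximating values are admitted only when no fixpoints are left, a
  -- state that `approxFix` brings about and reduction preserves.
  ∃ I J : Itv, Rel (¬ M.HasFix) (envs s) [] N (.base I) J M

theorem RelAt.of_rel {b : Prop} {A : Set (ℕ → ℝ)} {M : SymTm F} {s : Fin n → unitInterval}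
    {N : Tm F ℝ} {I J : Itv} (h : Rel b A [] N (.base I) J M) (hb : b → ¬ M.HasFix)
    (hA : envs s ⊆ A) : RelAt M s N := ⟨I, J, h.mono hb hA⟩

/-- The least upper bound on the denotations of the instances of `M` at `s`. -/
def upd (U : Set ℝ) (M : SymTm F) (s : Fin n → unitInterval) : ℝ≥0∞ :=
  ⨆ (N : Tm F ℝ) (_ : RelAt M s N), den .ofReal U N

/-- The greatest lower bound on the denotations, scaled by `w`, of the terminating instances of
`M` at `s`. -/
def lod (U : Set ℝ) (w : ℝ≥0∞) (M : SymTm F) (s : Fin n → unitInterval) : ℝ≥0∞ :=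
  -- The first term makes the bound 0 at weight 0 even if there are no instances. At weight `⊤` the
  -- infimum is over nothing and the bound is `⊤`. This does no harm: a finite weight becomes
  -- infinite only by scoring a value with an empty set of numbers, and then there is no terminating
  -- instance (see `lod_score`).
  w * ⊤ ⊓ ⨅ (N : Tm F ℝ) (_ : RelAt M s N ∧ term N = 1 ∧ w ≠ ⊤), w * den .ofReal U N

/-! ### One-step inequalities at a fixed trace. -/

section Pointwise

variable {s : Fin n → unitInterval} {E : ECtx F SymLit} {M R R' : SymTm F} {N : Tm F ℝ}
  {w w' c : ℝ≥0∞}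

theorem RelAt.le_upd (h : RelAt M s N) : den .ofReal U N ≤ upd U M s := le_iSup₂_of_le N h le_rfl

theorem lod_le (h : RelAt M s N) (ht : term N = 1) (hw : w ≠ ⊤) :
    lod U w M s ≤ w * den .ofReal U N := inf_le_right.trans (iInf₂_le N ⟨h, ht, hw⟩)

theorem lod_zero : lod U 0 M s = 0 := by
  rw [lod, zero_mul]
  exact le_zero_iff.1 inf_le_left

theorem le_lod (h0 : w = 0 → c = 0)
    (h : w ≠ 0 → w ≠ ⊤ → ∀ N, RelAt M s N → term N = 1 → c ≤ w * den .ofReal U N) :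
    c ≤ lod U w M s := by
  by_cases hw : w = 0
  · rw [h0 hw]
    exact zero_le
  · refine le_inf ?_ (le_iInf₂ fun N hN => h hw hN.2.2 N hN.1 hN.2.1)
    rw [ENNReal.mul_top hw]
    exact le_top

theorem RelAt.stepRel (h : RelAt (E.plug R) s N) (hE : E.Ok Tm.IsSymVal)
    (hR : HeadForm Tm.IsSymVal R) :
    ∃ I, StepRel (¬ (E.plug R).HasFix) (envs s) N (.base I) E R := by
  obtain ⟨I, J, h⟩ := h
  exact ⟨I, h.stepRel (envs_nonempty s) hE hR⟩

theorem RelAt.det (h : RelAt (E.plug R) s N) (hE : E.Ok Tm.IsSymVal)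
    (hR : ∀ n Δ Ξ, SymRedex R n Δ Ξ R' n Δ Ξ)
    (hu : ∀ R'', (∀ n Δ Ξ, SymRedex R n Δ Ξ R'' n Δ Ξ) → R'' = R') :
    ∃ X, DSteps N X ∧ RelAt (E.plug R') s X := by
  obtain ⟨I, h⟩ := h.stepRel hE (hR 0 [] []).head
  cases h with
  | det h1 h2 h3 =>
    obtain rfl := hu _ h1
    exact ⟨_, h2, .of_rel h3 (fun h => (h1 0 [] []).not_hasFix h) Subset.rfl⟩
  | sample => have := hR 0 [] []; generalize [] = Δ at this; cases this
  | ite => have := hR 0 [] []; cases this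
  | score => have := hR 0 [] []; cases this
  | call => have := hR 0 [] []; cases this

theorem upd_det (hU : MeasurableSet U) (hE : E.Ok Tm.IsSymVal)
    (hR : ∀ n Δ Ξ, SymRedex R n Δ Ξ R' n Δ Ξ)
    (hu : ∀ R'', (∀ n Δ Ξ, SymRedex R n Δ Ξ R'' n Δ Ξ) → R'' = R') :
    upd U (E.plug R) s ≤ upd U (E.plug R') s :=
  iSup₂_le fun N hN => by
    obtain ⟨X, h1, h2⟩ := hN.det hE hR hu
    rw [h1.den wf_ofReal hU]
    exact h2.le_upd

theorem lod_det (hU : MeasurableSet U) (hE : E.Ok Tm.IsSymVal)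
    (hR : ∀ n Δ Ξ, SymRedex R n Δ Ξ R' n Δ Ξ)
    (hu : ∀ R'', (∀ n Δ Ξ, SymRedex R n Δ Ξ R'' n Δ Ξ) → R'' = R') :
    lod U w (E.plug R') s ≤ lod U w (E.plug R) s := by
  refine le_lod (fun h => by rw [h, lod_zero]) fun _ hw N hN ht => ?_
  obtain ⟨X, h1, h2⟩ := hN.det hE hR hu
  rw [h1.den wf_ofReal hU]
  exact lod_le h2 (h1.term ▸ ht) hw

theorem RelAt.sample (h : RelAt (E.plug .sample) s N) (hE : E.Ok Tm.IsSymVal) :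
    ∃ E' : ECtx F ℝ, E'.Ok Tm.IsVal ∧ DSteps N (E'.plug .sample) ∧ ∀ r : unitInterval,
      RelAt (E.plug (.lit (.svar n))) (snocEquiv n (s, r)) (E'.plug (.lit (r : ℝ))) := by
  obtain ⟨I, h⟩ := h.stepRel hE .sample
  cases h with
  | det h1 => have := h1 0 [] []; cases this
  | sample h1 h2 h3 =>
    refine ⟨_, h1, h2, fun r => ?_⟩
    obtain ⟨J, hJ⟩ := h3 (envs (snocEquiv n (s, r))) (envs_snoc_subset s r) r (.lit (.svar n))
      (unitInterval_mem r) fun e he => (envs_snoc_last he).symm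
    exact .of_rel hJ (fun h => (SymRedex.sample n [] []).not_hasFix h) Subset.rfl

theorem upd_sample (hU : MeasurableSet U) (hE : E.Ok Tm.IsSymVal) {g : unitInterval → ℝ≥0∞}
    (hg : ∀ᵐ r, w * upd U (E.plug (.lit (.svar n))) (snocEquiv n (s, r)) ≤ g r) :
    w * upd U (E.plug .sample) s ≤ ∫⁻ r, g r := by
  simp only [upd, ENNReal.mul_iSup]
  refine iSup₂_le fun N hN => ?_
  obtain ⟨E', h1, h2, h3⟩ := hN.sample hE
  rw [h2.den wf_ofReal hU, den_sample wf_ofReal hU h1,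
    ← lintegral_const_mul _ (measurable_den_lit wf_ofReal hU _)]
  refine lintegral_mono_ae (hg.mono fun r hr => le_trans ?_ hr)
  gcongr
  exact (h3 r).le_upd

theorem lod_sample (hU : MeasurableSet U) (hE : E.Ok Tm.IsSymVal) :
    ∫⁻ r, lod U w (E.plug (.lit (.svar n))) (snocEquiv n (s, r)) ≤ lod U w (E.plug .sample) s := by
  refine le_lod (fun h => by simp only [h, lod_zero, lintegral_zero]) fun _ hw N hN ht => ?_
  obtain ⟨E', h1, h2, h3⟩ := hN.sample hE
  rw [h2.den wf_ofReal hU, den_sample wf_ofReal hU h1,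
    ← lintegral_const_mul _ (measurable_den_lit wf_ofReal hU _)]
  rw [h2.term] at ht
  exact lintegral_mono_ae ((ae_term_eq_one h1 ht).mono fun r hr => lod_le (h3 r) hr hw)

theorem RelAt.ite {V P Q : SymTm F} (h : RelAt (E.plug (.ite V P Q)) s N)
    (hE : E.Ok Tm.IsSymVal) (hV : V.IsSymVal) :
    ∃ r ∈ vals (sampleEnv s) V, ∃ X, DSteps N X ∧
      ((r ≤ 0 ∧ RelAt (E.plug P) s X) ∨ (0 < r ∧ RelAt (E.plug Q) s X)) := by
  obtain ⟨I, h⟩ := h.stepRel hE (.ite hV _ _)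
  cases h with
  | det h1 => have := h1 0 [] []; cases this
  | @ite _ _ _ X Y r _ _ _ h1 h2 h3 h4 h5 =>
    refine ⟨r, h1 _ (sampleEnv_mem_envs s), ?_⟩
    rcases le_or_gt r 0 with hr | hr
    · exact ⟨X, h2 hr, .inl ⟨hr, .of_rel h4
        (fun h => (SymRedex.iteLe V P Q n [] [] hV).not_hasFix h) Subset.rfl⟩⟩
    · exact ⟨Y, h3 hr, .inr ⟨hr, .of_rel h5
        (fun h => (SymRedex.iteGt V P Q n [] [] hV).not_hasFix h) Subset.rfl⟩⟩

variable {Δ : List (Constraint F)} {Ξ : List (SymTm F)}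

theorem upd_ite (hU : MeasurableSet U) (hE : E.Ok Tm.IsSymVal) {V P Q : SymTm F}
    (hV : V.IsSymVal) :
    uwt Δ Ξ s * upd U (E.plug (.ite V P Q)) s ≤
      uwt (⟨V, .le, 0⟩ :: Δ) Ξ s * upd U (E.plug P) s +
        uwt (⟨V, .gt, 0⟩ :: Δ) Ξ s * upd U (E.plug Q) s := by
  conv_lhs => simp only [upd, ENNReal.mul_iSup]
  refine iSup₂_le fun N hN => ?_
  obtain ⟨r, hr, X, h1, ⟨h2, h3⟩ | ⟨h2, h3⟩⟩ := hN.ite hE hV <;> rw [h1.den wf_ofReal hU]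
  · refine le_add_right ?_
    rw [uwt_cons_of (C := ⟨V, .le, 0⟩) ⟨r, hr, h2⟩]
    gcongr
    exact h3.le_upd
  · refine le_add_left ?_
    rw [uwt_cons_of (C := ⟨V, .gt, 0⟩) ⟨r, hr, h2⟩]
    gcongr
    exact h3.le_upd

/-- The guard of an instance violates the constraint of the branch not taken, and the lower weight
demands this constraint for all values. So one of the two summands vanishes. -/
theorem lod_ite (hU : MeasurableSet U) (hE : E.Ok Tm.IsSymVal) {V P Q : SymTm F}
    (hV : V.IsSymVal) :
    lod U (lwt (⟨V, .le, 0⟩ :: Δ) Ξ s) (E.plug P) s +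
        lod U (lwt (⟨V, .gt, 0⟩ :: Δ) Ξ s) (E.plug Q) s ≤
      lod U (lwt Δ Ξ s) (E.plug (.ite V P Q)) s := by
  have hle := fun C => lwt_cons_le (Δ := Δ) (Ξ := Ξ) (s := s) (C := C)
  refine le_lod (fun h => ?_) fun _ hw N hN ht => ?_
  · rw [h] at hle
    rw [le_zero_iff.1 (hle _), le_zero_iff.1 (hle _), lod_zero, lod_zero, add_zero]
  obtain ⟨r, hr, X, h1, ⟨h2, h3⟩ | ⟨h2, h3⟩⟩ := hN.ite hE hV <;>
    rw [h1.den wf_ofReal hU] <;> rw [h1.term] at ht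
  · rw [lwt_cons_of_not (C := ⟨V, .gt, 0⟩) fun h => absurd (h r hr) (not_lt.2 h2), lod_zero,
      add_zero]
    refine (lod_le h3 ht (ne_top_of_le_ne_top hw (hle _))).trans ?_
    gcongr
    exact hle _
  · rw [lwt_cons_of_not (C := ⟨V, .le, 0⟩) fun h => absurd (h r hr) (not_le.2 h2), lod_zero,
      zero_add]
    refine (lod_le h3 ht (ne_top_of_le_ne_top hw (hle _))).trans ?_
    gcongr
    exact hle _

theorem dStep_score {E' : ECtx F ℝ} (hE' : E'.Ok Tm.IsVal) {r : ℝ} (hr : 0 ≤ r) :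
    DStep (E'.plug (.score (.lit r))) r (E'.plug (.lit r)) := (DRed.score r hr).dStep.plug hE'

theorem den_score_neg {φ : ℝ → ℝ≥0∞} {U : Set ℝ} {E' : ECtx F ℝ} (hE' : E'.Ok Tm.IsVal) {r : ℝ}
    (hr : r < 0) : den φ U (E'.plug (.score (.lit r))) = 0 := by
  have hh : HeadForm Tm.IsVal (.score (.lit r) : Tm F ℝ) := .score (.lit r)
  refine den_stuck (stuck_plug_of_head hE' hh (fun f b h => ?_) nofun)
    (plug_ne_lit (hh.not_val valLike_isVal))
  cases h with
  | score _ h => exact absurd h (not_le.2 hr)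

theorem RelAt.score {V : SymTm F} (h : RelAt (E.plug (.score V)) s N)
    (hE : E.Ok Tm.IsSymVal) (hV : V.IsSymVal) :
    ∃ E' : ECtx F ℝ, E'.Ok Tm.IsVal ∧
      ((∃ r ∈ vals (sampleEnv s) V, DSteps N (E'.plug (.score (.lit r))) ∧
        (0 ≤ r → RelAt (E.plug V) s (E'.plug (.lit r)))) ∨
      ∃ (J : Itv) (τ : ITy) (X : Tm F ℝ), V = .lit (.itv J) ∧ DSteps N (E'.plug X) ∧
        CTy [] X τ J ∧ ∀ Y, Y.IsVal → CTy [] Y τ .one → RelAt (E.plug V) s (E'.plug Y)) := by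
  have hf : ¬ (E.plug (.score V)).HasFix → ¬ (E.plug V).HasFix :=
    fun h => (SymRedex.score V n [] [] hV).not_hasFix h
  obtain ⟨I, h⟩ := h.stepRel hE (.score hV)
  cases h with
  | det h1 => have := h1 0 [] []; cases this
  | score h1 _ h3 h4 h5 =>
    refine ⟨_, h1, .inl ⟨_, h3 _ (sampleEnv_mem_envs s), h4, fun hr => ?_⟩⟩
    obtain ⟨J, hJ⟩ := h5 hr
    exact .of_rel hJ hf Subset.rfl
  | call h1 h2 h3 h4 =>
    refine ⟨_, h1, .inr ⟨_, _, _, rfl, h2, h3, fun Y hY hY' => ?_⟩⟩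
    obtain ⟨J, hJ⟩ := h4 Y hY hY'
    exact .of_rel hJ hf Subset.rfl

theorem upd_score (hU : MeasurableSet U) (hE : E.Ok Tm.IsSymVal) {V : SymTm F}
    (hV : V.IsSymVal) :
    uwt Δ Ξ s * upd U (E.plug (.score V)) s ≤
      uwt (⟨V, .ge, 0⟩ :: Δ) (V :: Ξ) s * upd U (E.plug V) s := by
  conv_lhs => simp only [upd, ENNReal.mul_iSup]
  refine iSup₂_le fun N hN => ?_
  obtain ⟨E', hE', ⟨r, hr, h1, h2⟩ | ⟨J, τ, X, rfl, h1, h2, h3⟩⟩ := hN.score hE hV <;>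
    rw [h1.den wf_ofReal hU]
  · rcases le_or_gt 0 r with h0 | h0
    · rw [den_dStep wf_ofReal hU (dStep_score hE' h0), uwt_cons_of (C := ⟨V, .ge, 0⟩) ⟨r, hr, h0⟩, uwt_score,
        mul_left_comm, mul_assoc]
      gcongr
      · exact le_iSup₂_of_le r hr le_rfl
      · exact (h2 h0).le_upd
    · rw [den_score_neg hE' h0, mul_zero]
      exact zero_le
  · have h := den_plug_le hU hE' (fun Y hY hY' => (h3 Y hY hY').le_upd) h2 (U := U)
    -- If `J` contains no nonnegative number, the new constraint fails and the right side is 0; the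
    -- left side is 0 too, because `ENNReal.ofReal` vanishes on `J`.
    by_cases hJ : ∃ t ∈ J.carrier, (0 : ℝ) ≤ t
    · rw [uwt_cons_of (C := ⟨.lit (.itv J), .ge, 0⟩) hJ, uwt_score, mul_comm (⨆ t ∈ _, _),
        mul_assoc]
      gcongr
      exact h
    · have h0 : (⨆ t ∈ J.carrier, ENNReal.ofReal t) = 0 := by
        simp only [ENNReal.iSup_eq_zero]
        exact fun t ht => ENNReal.ofReal_of_nonpos (not_le.1 fun h => hJ ⟨t, ht, h⟩).le
      rw [h0, zero_mul] at h
      rw [le_zero_iff.1 h, mul_zero]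
      exact zero_le

theorem lod_score (hU : MeasurableSet U) (hE : E.Ok Tm.IsSymVal) {V : SymTm F}
    (hV : V.IsSymVal) :
    lod U (lwt (⟨V, .ge, 0⟩ :: Δ) (V :: Ξ) s) (E.plug V) s ≤
      lod U (lwt Δ Ξ s) (E.plug (.score V)) s := by
  have hle := lwt_cons_le (Δ := Δ) (Ξ := V :: Ξ) (s := s) (C := ⟨V, .ge, 0⟩)
  rw [lwt_score (Δ := Δ)] at hle
  generalize lwt (⟨V, .ge, 0⟩ :: Δ) (V :: Ξ) s = w' at hle
  generalize lwt Δ Ξ s = w at hle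
  refine le_lod (fun h => ?_) fun _ hw N hN ht => ?_
  · rw [h, mul_zero] at hle
    rw [le_zero_iff.1 hle, lod_zero]
  have htop : ∀ r ∈ vals (sampleEnv s) V, w' ≤ ENNReal.ofReal r * w := fun r hr =>
    hle.trans (mul_le_mul_left (iInf₂_le r hr) _)
  have hfin : ∀ r ∈ vals (sampleEnv s) V, w' ≠ ⊤ := fun r hr =>
    ne_top_of_le_ne_top (ENNReal.mul_ne_top ENNReal.ofReal_ne_top hw) (htop r hr)
  obtain ⟨E', hE', ⟨r, hr, h1, h2⟩ | ⟨J, τ, X, rfl, h1, h2, h3⟩⟩ := hN.score hE hV <;>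
    rw [h1.den wf_ofReal hU] <;> rw [h1.term] at ht
  · rcases le_or_gt 0 r with h0 | h0
    · rw [term_dStep (dStep_score hE' h0)] at ht
      rw [den_dStep wf_ofReal hU (dStep_score hE' h0), mul_left_comm, ← mul_assoc]
      refine (lod_le (h2 h0) ht (hfin r hr)).trans ?_
      gcongr
      exact htop r hr
    · rw [term, den_score_neg hE' h0] at ht
      exact absurd ht zero_ne_one
  · obtain ⟨t, ht'⟩ := h2.nonempty hE' ht
    have hw' := hfin t ht'
    by_cases h0 : w' = 0
    · rw [h0, lod_zero]
      exact zero_le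
    -- `le_den_plug` concerns denotations without path weight, so `w'` is divided out first and
    -- restored afterwards. This is possible because `w'` is neither 0 nor `⊤`.
    have h := le_den_plug hU hE' (c := lod U w' (E.plug (.lit (.itv J))) s / w')
      (fun Y hY hY' ht => ENNReal.div_le_of_le_mul' (lod_le (h3 Y hY hY') ht hw')) h2 ht
    calc lod U w' (E.plug (.lit (.itv J))) s
        = w' * (lod U w' (E.plug (.lit (.itv J))) s / w') := (ENNReal.mul_div_cancel h0 hw').symm
      _ ≤ (⨅ t ∈ J.carrier, ENNReal.ofReal t) * w *
          (lod U w' (E.plug (.lit (.itv J))) s / w') := mul_le_mul_left hle _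
      _ = w * ((⨅ t ∈ J.carrier, ENNReal.ofReal t) *
          (lod U w' (E.plug (.lit (.itv J))) s / w')) := by ring
      _ ≤ _ := mul_le_mul_right h _

theorem RelAt.value (h : RelAt M s N) (hM : M.IsSymVal) :
    ∃ r ∈ vals (sampleEnv s) M, DSteps N (.lit r) := by
  obtain ⟨I, J, h⟩ := h
  obtain ⟨V, h1, -, -, -, h2⟩ := h.normalize hM
  obtain ⟨r, -, rfl, hr⟩ := h2 I rfl
  exact ⟨r, hr _ (sampleEnv_mem_envs s), h1⟩

/-- Since `M` contains a fixpoint, its instance involves no approximation so far and `Rel.conc`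
applies; since `R` contains none, instances of `R` may use approximating values. -/
theorem RelAt.approx {I J : Itv} (h : ApproxTm [] M (.base I) J R) (hN : RelAt M s N)
    (hM : M.HasFix) : RelAt R s N := by
  obtain ⟨I', J', hN⟩ := hN
  have hR : ¬ R.HasFix := (Tm.all_false_iff R).1
    (h.all (q := True) (fun _ => trivial) M.all_true)
  exact ⟨I, J, h.rel (envs_nonempty s) (fun e he => he.2) (hN.conc (not_not.2 hM)) hR⟩

end Pointwise

end

section

variable {F : Signature.{u}} {L L₁ : Type}
variable {U : Set ℝ}

/-! ## Integral bounds for configurations -/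

/-- The upper bound that a configuration contributes. -/
def Gub (U : Set ℝ) (ψ : SymConf F) : ℝ≥0∞ :=
  uint volume fun s : Fin ψ.n → unitInterval => uwt ψ.constraints ψ.scores s * upd U ψ.tm s

/-- The lower bound that a configuration contributes. -/
def Glb (U : Set ℝ) (ψ : SymConf F) : ℝ≥0∞ :=
  ∫⁻ s : Fin ψ.n → unitInterval, lod U (lwt ψ.constraints ψ.scores s) ψ.tm s

theorem relAt_toSym {P : Tm F ℝ} (hP : HasType [] P .real) (s : Fin 0 → unitInterval) :
    RelAt (toSym P) s P := ⟨_, _, hP.rel⟩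

theorem den_le_Gub {P : Tm F ℝ} (hP : HasType [] P .real) :
    den .ofReal U P ≤ Gub U ⟨toSym P, 0, [], []⟩ := by
  refine le_uint fun s => ?_
  rw [show uwt (F := F) [] [] s = 1 by simp [uwt], one_mul]
  exact (relAt_toSym hP s).le_upd

theorem Glb_le_den {P : Tm F ℝ} (hP : HasType [] P .real) (ht : term P = 1) :
    Glb U ⟨toSym P, 0, [], []⟩ ≤ den .ofReal U P := by
  calc _ ≤ ∫⁻ _ : Fin 0 → unitInterval, den .ofReal U P := lintegral_mono fun s => by
        have hw : lwt (F := F) [] [] s = 1 := by simp [lwt]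
        change lod U (lwt [] [] s) (toSym P) s ≤ _
        rw [hw]
        exact (lod_le (relAt_toSym hP s) ht ENNReal.one_ne_top).trans_eq (one_mul _)
    _ = _ := by simp

open Classical in
theorem Gub_le_ub (hU : MeasurableSet U) {ψ : SymConf F} (hV : ψ.tm.IsSymVal) :
    Gub U ψ ≤ ub ψ U := by
  refine le_trans (uint_mono fun s => ?_) (uint_le_lintegral ?_)
  · rw [ite_and, ← uwt_eq]
    by_cases h : (vals (sampleEnv s) ψ.tm ∩ U).Nonempty
    · rw [if_pos h]
      refine mul_le_of_le_one_right' (iSup₂_le fun N hN => ?_)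
      obtain ⟨r, -, h1⟩ := hN.value hV
      rw [h1.den wf_ofReal hU, den_lit wf_ofReal]
      exact indicator_le_self' (fun _ _ => zero_le) _
    · rw [if_neg h]
      have h0 : upd U ψ.tm s = 0 := by
        simp only [upd, ENNReal.iSup_eq_zero]
        intro N hN
        obtain ⟨r, hr, h1⟩ := hN.value hV
        rw [h1.den wf_ofReal hU, den_lit wf_ofReal]
        exact indicator_of_notMem (fun hr' => h ⟨r, hr, hr'⟩) _
      rw [h0, mul_zero]
  -- An upper integral is bounded by `lintegral` only for an almost everywhere measurable integrand,
  -- so the integrand of `ub` has to be shown to be one.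
  · have hc : NullMeasurableSet {s : Fin ψ.n → unitInterval |
        (vals (sampleEnv s) ψ.tm ∩ U).Nonempty ∧
        ∀ C ∈ ψ.constraints, ∃ t ∈ vals (sampleEnv s) C.lhs, C.cmp.Holds t C.rhs} := by
      refine NullMeasurableSet.inter (nullMeasurableSet_exists_vals ψ.tm hU) ?_
      generalize ψ.constraints = Δ
      induction Δ with
      | nil => exact (NullMeasurableSet.const True).congr (.of_forall fun s => by simp; trivial)
      | cons C Δ ih =>
        simp only [List.forall_mem_cons]
        exact (nullMeasurableSet_exists_vals C.lhs (C.cmp.measurableSet C.rhs)).inter ih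
    have hp : AEMeasurable fun s : Fin ψ.n → unitInterval =>
        (ψ.scores.map fun W => ⨆ t ∈ vals (sampleEnv s) W, ENNReal.ofReal t).prod := by
      generalize ψ.scores = Ξ
      induction Ξ with
      | nil => simp
      | cons W Ξ ih =>
        simp only [List.map_cons, List.prod_cons]
        exact (aemeasurable_iSup_vals W).mul ih
    exact (hp.indicator₀ hc).congr (.of_forall fun s => by simp [indicator_apply])

open Classical in
theorem lb_le_Glb (hU : MeasurableSet U) {ψ : SymConf F} (hV : ψ.tm.IsSymVal) :
    lb ψ U ≤ Glb U ψ := by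
  refine lintegral_mono fun s => ?_
  simp only
  rw [ite_and, ← lwt_eq]
  by_cases h : vals (sampleEnv s) ψ.tm ⊆ U
  · rw [if_pos h]
    refine le_lod id fun _ _ N hN _ => ?_
    obtain ⟨r, hr, h1⟩ := hN.value hV
    rw [h1.den wf_ofReal hU, den_lit wf_ofReal, indicator_of_mem (h hr), Pi.one_apply, mul_one]
  · rw [if_neg h]
    exact zero_le

theorem Gub_le_of_approxFix {ψ ψ₁ : SymConf F} (h : ApproxFix ψ ψ₁) (hf : ψ.tm.HasFix) :
    Gub U ψ ≤ Gub U ψ₁ := by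
  obtain ⟨I, J, N, h, rfl⟩ := h
  refine uint_mono fun s => mul_le_mul_right (iSup₂_le fun X hX => ?_) _
  exact (hX.approx h hf).le_upd

theorem Glb_le_of_approxFix {ψ ψ₁ : SymConf F} (h : ApproxFix ψ ψ₁) (hf : ψ.tm.HasFix) :
    Glb U ψ₁ ≤ Glb U ψ := by
  obtain ⟨I, J, N, h, rfl⟩ := h
  refine lintegral_mono fun s => le_lod (fun h => ?_) fun _ hw X hX ht =>
    lod_le (hX.approx h hf) ht hw
  rw [h, lod_zero]

theorem ApproxFix.good {ψ ψ₁ : SymConf F} (h : ApproxFix ψ ψ₁) (hψ : ψ.Good) : ψ₁.Good := by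
  obtain ⟨I, J, N, h, rfl⟩ := h
  exact ⟨(h.all (fun _ => trivial) hψ.tm).mono (fun _ => id) False.elim, hψ.2, hψ.3⟩

/-! ## Successors of a configuration -/

/-- The possible sets of successors of a configuration. -/
inductive SymSucc : SymConf F → Set (SymConf F) → Prop
  | none {ψ : SymConf F} (h : ∀ x, ¬ SymStep ψ x) : SymSucc ψ ∅
  | det {E : ECtx F SymLit} {R R' : SymTm F} {n : ℕ} {Δ : List (Constraint F)}
      {Ξ : List (SymTm F)} (hE : E.Ok Tm.IsSymVal) (hR : ∀ n Δ Ξ, SymRedex R n Δ Ξ R' n Δ Ξ)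
      (hu : ∀ R'', (∀ n Δ Ξ, SymRedex R n Δ Ξ R'' n Δ Ξ) → R'' = R') :
      SymSucc ⟨E.plug R, n, Δ, Ξ⟩ {⟨E.plug R', n, Δ, Ξ⟩}
  | sample {E : ECtx F SymLit} {n : ℕ} {Δ : List (Constraint F)} {Ξ : List (SymTm F)}
      (hE : E.Ok Tm.IsSymVal) :
      SymSucc ⟨E.plug .sample, n, Δ, Ξ⟩ {⟨E.plug (.lit (.svar n)), n + 1, Δ, Ξ⟩}
  | ite {E : ECtx F SymLit} {V P Q : SymTm F} {n : ℕ} {Δ : List (Constraint F)}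
      {Ξ : List (SymTm F)} (hE : E.Ok Tm.IsSymVal) (hV : V.IsSymVal) :
      SymSucc ⟨E.plug (.ite V P Q), n, Δ, Ξ⟩
        ({⟨E.plug P, n, ⟨V, .le, 0⟩ :: Δ, Ξ⟩} ∪ {⟨E.plug Q, n, ⟨V, .gt, 0⟩ :: Δ, Ξ⟩})
  | score {E : ECtx F SymLit} {V : SymTm F} {n : ℕ} {Δ : List (Constraint F)}
      {Ξ : List (SymTm F)} (hE : E.Ok Tm.IsSymVal) (hV : V.IsSymVal) :
      SymSucc ⟨E.plug (.score V), n, Δ, Ξ⟩ {⟨E.plug V, n, ⟨V, .ge, 0⟩ :: Δ, V :: Ξ⟩}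

theorem symSucc (ψ : SymConf F) : SymSucc ψ {x | SymStep ψ x} := by
  by_cases h : ∃ x, SymStep ψ x
  swap
  · rw [show {x | SymStep ψ x} = ∅ from eq_empty_of_forall_notMem fun x hx => h ⟨x, hx⟩]
    exact .none fun x hx => h ⟨x, hx⟩
  obtain ⟨x, hx⟩ := h
  obtain ⟨E, R, R', hE, hr, h1, -⟩ := hx.exists_redex
  obtain ⟨M, n, Δ, Ξ⟩ := ψ
  simp only at h1 hr
  subst h1
  have hset : {x | SymStep ⟨E.plug R, n, Δ, Ξ⟩ x} = {x | ∃ R', SymRedex R n Δ Ξ R' x.n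
      x.constraints x.scores ∧ x.tm = E.plug R'} := Set.ext fun x => symStep_iff hE hr.head
  rw [hset]
  clear hset hx
  generalize x.n = n', x.constraints = Δ', x.scores = Ξ' at hr
  cases hr with
  | beta M V _ _ _ hV =>
    refine cast (congrArg _ ?_) (SymSucc.det (n := n) (Δ := Δ) (Ξ := Ξ) hE
      (fun n Δ Ξ => .beta M V n Δ Ξ hV)
      fun R'' h => by have := h 0 [] []; cases this; rfl)
    ext ⟨M', n', Δ', Ξ'⟩
    constructor
    · rintro ⟨⟩
      exact ⟨_, .beta M V n Δ Ξ hV, rfl⟩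
    · rintro ⟨R', h, rfl⟩
      cases h
      rfl
  | fix M V _ _ _ hV =>
    refine cast (congrArg _ ?_) (SymSucc.det (n := n) (Δ := Δ) (Ξ := Ξ) hE
      (fun n Δ Ξ => .fix M V n Δ Ξ hV)
      fun R'' h => by have := h 0 [] []; cases this; rfl)
    ext ⟨M', n', Δ', Ξ'⟩
    constructor
    · rintro ⟨⟩
      exact ⟨_, .fix M V n Δ Ξ hV, rfl⟩
    · rintro ⟨R', h, rfl⟩
      cases h
      rfl
  | sample =>
    refine cast (congrArg _ ?_) (SymSucc.sample (n := n) (Δ := Δ) (Ξ := Ξ) hE)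
    ext ⟨M', n', Δ', Ξ'⟩
    constructor
    · rintro ⟨⟩
      exact ⟨_, .sample n Δ Ξ, rfl⟩
    · rintro ⟨R', h, rfl⟩
      cases h
      rfl
  | iteLe V _ Q _ _ _ hV =>
    refine cast (congrArg _ ?_) (SymSucc.ite (P := R') (Q := Q) (n := n) (Δ := Δ) (Ξ := Ξ) hE hV)
    ext ⟨M', n', Δ', Ξ'⟩
    constructor
    · rintro (h | h) <;> cases mem_singleton_iff.1 h
      · exact ⟨_, .iteLe V R' Q n Δ Ξ hV, rfl⟩
      · exact ⟨_, .iteGt V R' Q n Δ Ξ hV, rfl⟩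
    · rintro ⟨R', h, rfl⟩
      cases h
      · exact .inl rfl
      · exact .inr rfl
  | iteGt V P _ _ _ _ hV =>
    refine cast (congrArg _ ?_) (SymSucc.ite (P := P) (Q := R') (n := n) (Δ := Δ) (Ξ := Ξ) hE hV)
    ext ⟨M', n', Δ', Ξ'⟩
    constructor
    · rintro (h | h) <;> cases mem_singleton_iff.1 h
      · exact ⟨_, .iteLe V P R' n Δ Ξ hV, rfl⟩
      · exact ⟨_, .iteGt V P R' n Δ Ξ hV, rfl⟩
    · rintro ⟨R', h, rfl⟩
      cases h
      · exact .inl rfl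
      · exact .inr rfl
  | score _ _ _ _ hV =>
    refine cast (congrArg _ ?_) (SymSucc.score (n := n) (Δ := Δ) (Ξ := Ξ) hE hV)
    ext ⟨M', n', Δ', Ξ'⟩
    constructor
    · rintro ⟨⟩
      exact ⟨_, .score R' n Δ Ξ hV, rfl⟩
    · rintro ⟨R'', h, rfl⟩
      cases h
      rfl

/-- Progress: a symbolic configuration that is stuck has no instances, so dropping it loses nothing
of the upper bound. -/
theorem RelAt.exists_symStep {ψ : SymConf F} {n : ℕ} {s : Fin n → unitInterval} {N : Tm F ℝ}
    (h : RelAt ψ.tm s N) (hV : ¬ ψ.tm.IsSymVal) : ∃ x, SymStep ψ x := by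
  obtain ⟨I, J, h⟩ := h
  obtain ⟨E, R, hE, hR, h1, h2⟩ := h.step (envs_nonempty s) hV
  obtain ⟨M, n, Δ, Ξ⟩ := ψ
  simp only at h1
  subst h1
  have mk : ∀ {R' n' Δ' Ξ'}, SymRedex R n Δ Ξ R' n' Δ' Ξ' →
      ∃ x, SymStep ⟨E.plug R, n, Δ, Ξ⟩ x := fun {R' n' Δ' Ξ'} h =>
    ⟨⟨E.plug R', n', Δ', Ξ'⟩, (symStep_iff hE hR).2 ⟨R', h, rfl⟩⟩
  cases h2 with
  | det h1 => exact mk (h1 n Δ Ξ)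
  | sample => exact mk (.sample n Δ Ξ)
  | ite hV' => exact mk (.iteLe _ _ _ n Δ Ξ hV')
  | score _ hV' => exact mk (.score _ n Δ Ξ hV')
  | call => exact mk (.score _ n Δ Ξ (.lit _))

theorem SymSucc.finite {ψ : SymConf F} {X : Set (SymConf F)} (h : SymSucc ψ X) : X.Finite := by
  cases h with
  | none => exact finite_empty
  | ite => exact (finite_singleton _).union (finite_singleton _)
  | _ => exact finite_singleton _

theorem SymSucc.Gub_le (hU : MeasurableSet U) {ψ : SymConf F} {X : Set (SymConf F)}
    (h : SymSucc ψ X) (hg : ψ.Good) (hV : ¬ ψ.tm.IsSymVal) :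
    Gub U ψ ≤ ∑' x : X, Gub U x.1 := by
  cases h with
  | none h =>
    have h0 : ∀ s : Fin ψ.n → unitInterval,
        uwt ψ.constraints ψ.scores s * upd U ψ.tm s = (0 : (Fin ψ.n → unitInterval) → ℝ≥0∞) s := by
      intro s
      have : upd U ψ.tm s = 0 := by
        simp only [upd, ENNReal.iSup_eq_zero]
        intro N hN
        obtain ⟨x, hx⟩ := hN.exists_symStep hV
        exact absurd hx (h x)
      rw [this, mul_zero, Pi.zero_apply]
    refine (uint_le measurable_zero (.of_forall fun s => (h0 s).le)).trans ?_
    simp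
  | det hE hR hu =>
    rw [tsum_singleton]
    exact uint_mono fun s => mul_le_mul_right (upd_det hU hE hR hu) _
  | sample hE =>
    rw [tsum_singleton]
    refine uint_le_uint_snoc fun s g h => ?_
    simp only [uwt_snoc hg.2 hg.3] at h
    exact upd_sample hU hE h
  | ite hE hV' =>
    rw [ENNReal.summable.tsum_union_disjoint (by simp) ENNReal.summable, tsum_singleton,
      tsum_singleton]
    exact (uint_mono fun s => upd_ite hU hE hV').trans (uint_add_le _ _)
  | score hE hV' =>
    rw [tsum_singleton]
    exact uint_mono fun s => upd_score hU hE hV'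

theorem SymSucc.le_Glb (hU : MeasurableSet U) {ψ : SymConf F} {X : Set (SymConf F)}
    (h : SymSucc ψ X) (hg : ψ.Good) : ∑' x : X, Glb U x.1 ≤ Glb U ψ := by
  cases h with
  | none h => simp
  | det hE hR hu =>
    rw [tsum_singleton]
    exact lintegral_mono fun s => lod_det hU hE hR hu
  | sample hE =>
    rw [tsum_singleton]
    refine lintegral_snoc_le fun s => ?_
    simp only [lwt_snoc hg.2 hg.3]
    exact lod_sample hU hE
  | ite hE hV =>
    refine (ENNReal.tsum_union_le _ _ _).trans ?_
    rw [tsum_singleton, tsum_singleton]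
    -- Lower integrals are superadditive without any measurability, as upper integrals are
    -- subadditive.
    exact (le_lintegral_add _ _).trans (lintegral_mono fun s => lod_ite hU hE hV)
  | score hE hV =>
    rw [tsum_singleton]
    exact lintegral_mono fun s => lod_score hU hE hV

/-! ## Divergent lists -/

/-- Neither list is a suffix of the other. -/
def Div {α : Type*} (l m : List α) : Prop := ¬ l <:+ m ∧ ¬ m <:+ l

theorem Div.symm {α : Type*} {l m : List α} (h : Div l m) : Div m l := ⟨h.2, h.1⟩

/-- Constraints are added at the head, so the list of a configuration is a suffix of the lists of
its descendants. Divergence, once created by a conditional, therefore persists along both branches.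
-/
theorem Div.of_suffix {α : Type*} {l l' m : List α} (h : Div l m) (hl : l <:+ l') : Div l' m :=
  ⟨fun h' => h.1 (hl.trans h'), fun h' =>
    (List.suffix_or_suffix_of_suffix hl h').elim h.1 h.2⟩

theorem not_div_self {α : Type*} (l : List α) : ¬ Div l l := fun h => h.1 List.suffix_rfl

theorem div_cons {α : Type*} {a b : α} (h : a ≠ b) (l : List α) : Div (a :: l) (b :: l) := by
  have : ∀ {a b : α}, a ≠ b → ¬ (a :: l) <:+ (b :: l) := fun hab h' =>
    hab (List.cons.inj (h'.eq_of_length rfl)).1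
  exact ⟨this h, this h.symm⟩

theorem SymSucc.suffix {ψ : SymConf F} {X : Set (SymConf F)} (h : SymSucc ψ X) :
    ∀ x ∈ X, ψ.constraints <:+ x.constraints := by
  cases h with
  | none => simp
  | ite =>
    rintro x (rfl | rfl) <;> exact List.suffix_cons _ _
  | score =>
    rintro x rfl
    exact List.suffix_cons _ _
  | _ =>
    rintro x rfl
    exact List.suffix_rfl

theorem SymSucc.pairwise {ψ : SymConf F} {X : Set (SymConf F)} (h : SymSucc ψ X) :
    X.Pairwise fun x y => Div x.constraints y.constraints := by
  cases h with
  | none => exact pairwise_empty _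
  | ite =>
    rintro x (rfl | rfl) y (rfl | rfl) hxy
    · exact absurd rfl hxy
    · exact div_cons (by simp) _
    · exact div_cons (by simp) _
    · exact absurd rfl hxy
  | _ => exact pairwise_singleton _ _

/-! ## The invariant of the algorithm -/

/-- The invariant of the algorithm on the program `P`. -/
structure AlgInv (U : Set ℝ) (P : Tm F ℝ) (S : Set (SymConf F × ℕ)) (T : Set (SymConf F)) :
    Prop where
  finite_left : S.Finite
  finite_right : T.Finite
  good : ∀ p ∈ S, p.1.Good
  -- Both collections are sets, and two equal entries would be counted once. Divergence of the
  -- constraints excludes this, so that the sum in `upper` loses no contribution.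
  pairwise : S.Pairwise fun p q => Div p.1.constraints q.1.constraints
  div : ∀ p ∈ S, ∀ ψ ∈ T, Div p.1.constraints ψ.constraints
  upper : den .ofReal U P ≤ ∑' p : S, Gub U p.1.1 + ∑' ψ : T, ub ψ.1 U
  lower : term P = 1 → ∑' p : S, Glb U p.1.1 + ∑' ψ : T, lb ψ.1 U ≤ den .ofReal U P

theorem AlgInv.init {P : Tm F ℝ} (hP : HasType [] P .real) :
    AlgInv U P {(⟨toSym P, 0, [], []⟩, 0)} ∅ where
  finite_left := finite_singleton _
  finite_right := finite_empty
  good := by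
    rintro p rfl
    exact ⟨toSym_scoped P, by simp, by simp⟩
  pairwise := pairwise_singleton _ _
  div := by simp
  upper := by
    rw [tsum_singleton ((⟨toSym P, 0, [], []⟩, 0) : SymConf F × ℕ) fun p => Gub U p.1]
    exact (den_le_Gub hP).trans le_self_add
  lower ht := by
    rw [tsum_singleton ((⟨toSym P, 0, [], []⟩, 0) : SymConf F × ℕ) fun p => Glb U p.1]
    simpa using Glb_le_den hP ht

theorem tsum_diff_singleton_add {α : Type*} {S : Set α} {a : α} (ha : a ∈ S) (f : α → ℝ≥0∞) :
    ∑' x : (S \ {a} : Set α), f x + f a = ∑' x : S, f x := by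
  conv_rhs => rw [← sdiff_union_of_subset (singleton_subset_iff.2 ha)]
  rw [ENNReal.summable.tsum_union_disjoint disjoint_sdiff_left ENNReal.summable, tsum_singleton]

section Invariant

variable {P : Tm F ℝ} {S : Set (SymConf F × ℕ)} {T : Set (SymConf F)} {ψ : SymConf F} {d : ℕ}

/-- The common part of symbolic steps and `approxFix`: a configuration is exchanged for descendants
whose total contributions weaken the bounds on either side. -/
theorem AlgInv.replace (h : AlgInv U P S T) (hS : (ψ, d) ∈ S) {X : Set (SymConf F × ℕ)}
    (hf : X.Finite) (hg : ∀ x ∈ X, x.1.Good)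
    (hp : X.Pairwise fun p q => Div p.1.constraints q.1.constraints)
    (hs : ∀ x ∈ X, ψ.constraints <:+ x.1.constraints)
    (hu : Gub U ψ ≤ ∑' x : X, Gub U x.1.1) (hl : ∑' x : X, Glb U x.1.1 ≤ Glb U ψ) :
    AlgInv U P (S \ {(ψ, d)} ∪ X) T := by
  have hd : ∀ p ∈ S \ {(ψ, d)}, ∀ x ∈ X, Div x.1.constraints p.1.constraints := fun p hp x hx =>
    (h.pairwise hS hp.1 fun e => hp.2 e.symm).of_suffix (hs x hx)
  have hdisj : Disjoint (S \ {(ψ, d)}) X := disjoint_left.2 fun p hp hpX =>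
    not_div_self _ (hd p hp p hpX)
  refine ⟨(h.finite_left.sdiff).union hf, h.finite_right, ?_, ?_, ?_, ?_, fun ht => ?_⟩
  · rintro p (hp | hp)
    · exact h.good p hp.1
    · exact hg p hp
  · rintro p (hp' | hp') q (hq | hq) hpq
    · exact h.pairwise hp'.1 hq.1 hpq
    · exact (hd p hp' q hq).symm
    · exact hd q hq p hp'
    · exact hp hp' hq hpq
  · rintro p (hp | hp) χ hχ
    · exact h.div p hp.1 χ hχ
    · exact (h.div _ hS χ hχ).of_suffix (hs p hp)
  · rw [ENNReal.summable.tsum_union_disjoint (f := fun p : SymConf F × ℕ => Gub U p.1) hdisj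
      ENNReal.summable]
    refine h.upper.trans ?_
    rw [← tsum_diff_singleton_add hS fun p => Gub U p.1]
    gcongr
  · refine le_trans ?_ (h.lower ht)
    rw [← tsum_diff_singleton_add hS fun p => Glb U p.1]
    gcongr
    refine (ENNReal.tsum_union_le (fun p : SymConf F × ℕ => Glb U p.1) _ _).trans ?_
    gcongr

theorem AlgInv.terminated (hU : MeasurableSet U) (h : AlgInv U P S T) (hS : (ψ, d) ∈ S)
    (hV : ψ.tm.IsSymVal) : AlgInv U P (S \ {(ψ, d)}) (T ∪ {ψ}) := by
  have hdisj : Disjoint T {ψ} := disjoint_singleton_right.2 fun hψ =>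
    not_div_self _ (h.div _ hS _ hψ)
  refine ⟨h.finite_left.sdiff, h.finite_right.union (finite_singleton _),
    fun p hp => h.good p hp.1, h.pairwise.mono sdiff_subset, ?_, ?_, fun ht => ?_⟩
  · rintro p hp χ (hχ | rfl)
    · exact h.div p hp.1 χ hχ
    · exact h.pairwise hp.1 hS hp.2
  · rw [ENNReal.summable.tsum_union_disjoint (f := fun χ : SymConf F => ub χ U) hdisj
      ENNReal.summable, tsum_singleton ψ fun χ => ub χ U]
    refine h.upper.trans ?_
    rw [← tsum_diff_singleton_add hS fun p => Gub U p.1, add_assoc, add_comm (Gub U ψ)]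
    gcongr
    exact Gub_le_ub hU hV
  · refine le_trans ?_ (h.lower ht)
    rw [← tsum_diff_singleton_add hS fun p => Glb U p.1, add_assoc, add_comm (Glb U ψ)]
    gcongr
    rw [ENNReal.summable.tsum_union_disjoint (f := fun χ : SymConf F => lb χ U) hdisj
      ENNReal.summable, tsum_singleton ψ fun χ => lb χ U]
    gcongr
    exact lb_le_Glb hU hV

theorem AlgInv.algStep (hU : MeasurableSet U) {D : ℕ} {σ τ : AlgState F} (h : AlgInv U P σ.S σ.T)
    (hs : AlgStep D σ τ) : AlgInv U P τ.S τ.T := by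
  cases hs with
  | terminated S T ψ d hS hV => exact h.terminated hU hS hV
  | step S T ψ d hS hV _ =>
    have hX : {p : SymConf F × ℕ | SymStep ψ p.1 ∧ p.2 = d + 1} =
        (fun x => (x, d + 1)) '' {x | SymStep ψ x} := by
      ext ⟨x, e⟩
      simp [eq_comm]
    have hinj : InjOn (fun x : SymConf F => (x, d + 1)) {x | SymStep ψ x} :=
      fun x _ y _ hxy => (Prod.mk.inj hxy).1
    have hg := h.good _ hS
    refine h.replace hS ?_ (fun x hx => hx.1.good hg) ?_ (fun x hx => (symSucc ψ).suffix _ hx.1)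
      ?_ ?_
    · rw [hX]
      exact (symSucc ψ).finite.image _
    · rintro ⟨x, _⟩ ⟨hx, rfl⟩ ⟨y, _⟩ ⟨hy, rfl⟩ hxy
      exact (symSucc ψ).pairwise hx hy fun e => hxy (Prod.ext e rfl)
    · rw [hX, tsum_image (fun p : SymConf F × ℕ => Gub U p.1) hinj]
      exact (symSucc ψ).Gub_le hU hg hV
    · rw [hX, tsum_image (fun p : SymConf F × ℕ => Glb U p.1) hinj]
      exact (symSucc ψ).le_Glb hU hg
  | approx S T ψ ψ₁ d hS _ hD hA =>
    have hfix : ψ.tm.HasFix := by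
      by_contra hc
      exact hD (.inl hc)
    refine h.replace hS (finite_singleton _) ?_ (pairwise_singleton _ _) ?_ ?_ ?_
    · rintro x rfl
      exact hA.good (h.good _ hS)
    · rintro x rfl
      obtain ⟨I, J, N, -, rfl⟩ := hA
      exact List.suffix_rfl
    · rw [tsum_singleton (ψ₁, d) fun p : SymConf F × ℕ => Gub U p.1]
      exact Gub_le_of_approxFix hA hfix
    · rw [tsum_singleton (ψ₁, d) fun p : SymConf F × ℕ => Glb U p.1]
      exact Glb_le_of_approxFix hA hfix

end Invariant

theorem AlgComputes.algInv (hU : MeasurableSet U) {P : Tm F ℝ} (hP : HasType [] P .real) {D : ℕ}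
    {T : Set (SymConf F)} (hT : AlgComputes P D T) : AlgInv U P ∅ T := by
  suffices h : ∀ σ : AlgState F, Relation.ReflTransGen (AlgStep D)
      ⟨{(⟨toSym P, 0, [], []⟩, 0)}, ∅⟩ σ → AlgInv U P σ.S σ.T from h _ hT
  intro σ h
  induction h with
  | refl => exact .init hP
  | tail _ hs ih => exact ih.algStep hU hs

end

end GuBPI

end

theorem mainTheorem7 {F : GuBPI.Signature} (P : GuBPI.Tm F ℝ) (hP : GuBPI.HasType [] P .real)
    (D : ℕ) (T : Set (GuBPI.SymConf F)) (hT : GuBPI.AlgComputes P D T)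
    (U : Set ℝ) (hU : MeasurableSet U) :
    T.Finite ∧
    (GuBPI.AlmostSurelyTerminating P → ∑' Ψ : T, GuBPI.lb Ψ.1 U ≤ GuBPI.denotation P U) ∧
    GuBPI.denotation P U ≤ ∑' Ψ : T, GuBPI.ub Ψ.1 U := by
  have h := hT.algInv hU hP
  rw [GuBPI.denotation_eq_den hU]
  refine ⟨h.finite_right, fun ha => ?_, ?_⟩
  · simpa using h.lower ha.term_eq_one
  · simpa using h.upper
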